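/- **Setting.** Let $\alpha,\beta\in(\tfrac12,1)$, $T,S>0$, and let $B$ be a standard Brownian sheet on $[0,\infty)^2$ (a centred Gaussian process with $E[B(t,s)B(t',s')]=(t\wedge t')(s\wedge s')$). For $H\in(\tfrac12,1)$ put $$c_H=\sqrt{\tfrac{H(2H-1)}{B(2-2H,\,H-\frac12)}},\qquad d_H=\frac1{H+1}\sqrt{\tfrac{2(2H-1)}{H}},\qquad H'=\tfrac{H+1}2,$$ where $B(\cdot,\cdot)$ is the Beta function, $K^H(t,s)=c_Hs^{\frac12-H}\int_s^t(u-s)^{H-\frac32}u^{H-\frac12}\,du$ for $t>s$, and $$Q_H(t,y_1,y_2)=d_H\,1_{[0,t]}(y_1)1_{[0,t]}(y_2)\int_{y_1\vee y_2}^t\frac{\partial K^{H'}}{\partial x}(x,y_1)\frac{\partial K^{H'}}{\partial x}(x,y_2)\,dx .$$ For $\zeta$ square integrable let $M_{t,s}(\zeta)=\int_0^t\!\int_0^s\!\int_0^t\!\int_0^s\zeta(y_1,y_2,u_1,u_2)\,B(dy_1,du_1)B(dy_2,du_2)$ (double Wiener–Itô integral), and let $Z^{\alpha,\beta}(t,s)=M_{t,s}\big(Q_\alpha(t,y_1,y_2)\,Q_\beta(s,u_1,u_2)\big)$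 be the Rosenblatt sheet. For real $k_1,k_2$ let $$\zeta_{k_1,k_2}=k_1(y_1y_2)^{-\frac\alpha2}(u_1u_2)^{-\frac\beta2}+k_2(y_1\vee y_2)^{\frac\alpha2}(y_1\wedge y_2)^{-\frac\alpha2}|y_1-y_2|^{\alpha-1}(u_1\vee u_2)^{\frac\beta2}(u_1\wedge u_2)^{-\frac\beta2}|u_1-u_2|^{\beta-1},$$ $\mathcal K=\{\zeta_{k_1,k_2}:k_1,k_2>0\}$ and $f(t,s,k_1,k_2)=2E\big(Z^{\alpha,\beta}(t,s)-M_{t,s}(\zeta_{k_1,k_2})\big)^2$. Put $C_1(\alpha)=d_\alpha c_{\alpha'}^2B(1-\alpha,\frac\alpha2)^2$, $$C_2(\alpha)=d_\alpha c_{\alpha'}^2\int_0^1\!\!\int_0^s r^{-\alpha}(1-s)^{\frac\alpha2-1}(1-r)^{\frac\alpha2-1}(s-r)^{\alpha-1}\,dr\,ds,$$ $$a(k_2)=1+\tfrac{4k_2^2}{\alpha\beta}B(1-\alpha,2\alpha-1)B(1-\beta,2\beta-1)-\tfrac{8k_2}{\alpha\beta}C_2(\alpha)C_2(\beta),$$ $$b(k_2)=C_1(\alpha)C_1(\beta)-4k_2B(1-\alpha,\alpha)B(1-\beta,\beta),$$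 $$\Delta(k_2)=16T^2\Big(b(k_2)^2-\tfrac{\beta\,a(k_2)}{(1-\alpha)^2(1-\beta)}\Big),\qquad \widetilde\Delta(k_2)=16S^2\Big(b(k_2)^2-\tfrac{\alpha\,a(k_2)}{(1-\beta)^2(1-\alpha)}\Big),$$ $$k_1^*=\frac{4B(1-\alpha,\alpha)B(1-\beta,\beta)C_2(\alpha)C_2(\beta)-B(1-\alpha,2\alpha-1)B(1-\beta,2\beta-1)C_1(\alpha)C_1(\beta)}{16\alpha\beta(1-\alpha)^2(1-\beta)^2B(1-\alpha,\alpha)^2B(1-\beta,\beta)^2-B(1-\alpha,2\alpha-1)B(1-\beta,2\beta-1)}(1-\alpha)^2(1-\beta)^2T^{2\alpha-1}S^{2\beta-1},$$ $$k_2^*=\frac{C_2(\alpha)C_2(\beta)-4\alpha\beta(1-\alpha)^2(1-\beta)^2B(1-\alpha,\alpha)B(1-\beta,\beta)C_1(\alpha)C_1(\beta)}{B(1-\alpha,2\alpha-1)B(1-\beta,2\beta-1)-16\alpha\beta(1-\alpha)^2(1-\beta)^2B(1-\alpha,\alpha)^2B(1-\beta,\beta)^2}.$$ **Theorem.** Suppose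 that $\Delta(k_2^*)\le0$ and that $k_1^*\ge0$, $k_2^*\ge0$. Then $(k_1^*,k_2^*)$ is the unique stationary point of $(k_1,k_2)\mapsto f(T,S,k_1,k_2)$ on $\mathbb R^2$, and $$\inf_{\zeta_{k_1,k_2}\in\mathcal K}\ \sup_{s\in[0,S]}f(T,s,k_1,k_2)=f(T,S,k_1^*,k_2^*)=T^{2\alpha}S^{2\beta}a(k_2^*)-8k_1^*b(k_2^*)TS+4(k_1^*)^2\frac{T^{2-2\alpha}S^{2-2\beta}}{(1-\alpha)^2(1-\beta)^2}.$$ If moreover $\widetilde\Delta(k_2^*)\le0$, then also $$\inf_{\zeta_{k_1,k_2}\in\mathcal K}\ \sup_{t\in[0,T],\,s\in[0,S]}f(t,s,k_1,k_2)=f(T,S,k_1^*,k_2^*).$$ -/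

import Mathlib

open MeasureTheory ProbabilityTheory Set
open scoped NNReal ENNReal

namespace RosenblattSheet

noncomputable section

/-! ### The Brownian sheet and the double Wiener–Itô integral -/

/-- A standard Brownian sheet (in law): a centred Gaussian process indexed by the quadrant with
covariance `(t ∧ t') (s ∧ s')`. Continuity of the paths is not required. -/
structure IsBrownianSheet {Ω : Type*} [MeasurableSpace Ω] (B : ℝ≥0 × ℝ≥0 → Ω → ℝ)
    (P : Measure Ω) : Prop where
  isGaussian : IsGaussianProcess B P
  centered : ∀ p, ∫ ω, B p ω ∂P = 0
  covariance : ∀ p q, cov[B p, B q; P] = (min p.1 q.1 : ℝ) * (min p.2 q.2 : ℝ)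

/-- A half-open rectangle `(a, b] × (c, d]` of the quadrant. -/
structure Rect where
  a : ℝ≥0
  b : ℝ≥0
  c : ℝ≥0
  d : ℝ≥0
  hab : a ≤ b
  hcd : c ≤ d

/-- The rectangle as a subset of the plane. -/
def Rect.toSet (R : Rect) : Set (ℝ × ℝ) :=
  Ioc (R.a : ℝ) (R.b : ℝ) ×ˢ Ioc (R.c : ℝ) (R.d : ℝ)

/-- The increment `B(R)` of `B` over the rectangle `R`. -/
def Rect.increment {Ω : Type*} (R : Rect) (B : ℝ≥0 × ℝ≥0 → Ω → ℝ) (ω : Ω) : ℝ :=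
  B (R.b, R.d) ω - B (R.a, R.d) ω - B (R.b, R.c) ω + B (R.a, R.c) ω

/-- An elementary kernel: a finite linear combination of indicators of products `R × R'` of
disjoint rectangles; it vanishes on the diagonal. -/
structure ElemKernel where
  n : ℕ
  coef : Fin n → ℝ
  left : Fin n → Rect
  right : Fin n → Rect
  disj : ∀ i, Disjoint (left i).toSet (right i).toSet

/-- The elementary kernel as a function of two points of the plane. -/
def ElemKernel.toFun (e : ElemKernel) (p : (ℝ × ℝ) × (ℝ × ℝ)) : ℝ :=
  ∑ i, e.coef i * ((e.left i).toSet ×ˢ (e.right i).toSet).indicator (fun _ => (1 : ℝ)) p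

/-- The double integral `∑ cᵢ B(Rᵢ) B(Rᵢ')` of an elementary kernel. -/
def ElemKernel.integral {Ω : Type*} (e : ElemKernel) (B : ℝ≥0 × ℝ≥0 → Ω → ℝ) (ω : Ω) : ℝ :=
  ∑ i, e.coef i * ((e.left i).increment B ω * (e.right i).increment B ω)

/-- `X` is a version of the double Wiener–Itô integral of the kernel `g` with respect to `B`:
`X` is the `L²(P)`-limit of the integrals of elementary kernels that converge to `g` in `L²`. -/
def IsDoubleWiener {Ω : Type*} [MeasurableSpace Ω] (B : ℝ≥0 × ℝ≥0 → Ω → ℝ) (P : Measure Ω)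
    (g : (ℝ × ℝ) × (ℝ × ℝ) → ℝ) (X : Ω → ℝ) : Prop :=
  MemLp g 2 volume ∧ MemLp X 2 P ∧
    ∀ ε : ℝ≥0∞, 0 < ε → ∃ e : ElemKernel,
      eLpNorm (fun p => g p - e.toFun p) 2 volume < ε ∧
      eLpNorm (fun ω => X ω - e.integral B ω) 2 P < ε

open Classical in
/-- The double Wiener–Itô integral `∫∫ g(p₁, p₂) B(dp₁) B(dp₂)`, determined up to a null set. -/
def doubleWiener {Ω : Type*} [MeasurableSpace Ω] (B : ℝ≥0 × ℝ≥0 → Ω → ℝ) (P : Measure Ω)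
    (g : (ℝ × ℝ) × (ℝ × ℝ) → ℝ) : Ω → ℝ :=
  if h : ∃ X, IsDoubleWiener B P g X then h.choose else 0

/-- `M_{t,s}(ζ) = ∫₀ᵗ∫₀ˢ∫₀ᵗ∫₀ˢ ζ(y₁, y₂, u₁, u₂) B(dy₁, du₁) B(dy₂, du₂)`. -/
def wienerM {Ω : Type*} [MeasurableSpace Ω] (B : ℝ≥0 × ℝ≥0 → Ω → ℝ) (P : Measure Ω)
    (ζ : ℝ → ℝ → ℝ → ℝ → ℝ) (t s : ℝ) : Ω → ℝ :=
  doubleWiener B P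
    (((Icc 0 t ×ˢ Icc 0 s) ×ˢ (Icc 0 t ×ˢ Icc 0 s)).indicator
      (fun p => ζ p.1.1 p.2.1 p.1.2 p.2.2))

/-! ### The Rosenblatt sheet -/

/-- `c_H = √(H (2H - 1) / B(2 - 2H, H - 1/2))`. -/
def cConst (H : ℝ) : ℝ := √(H * (2 * H - 1) / beta (2 - 2 * H) (H - 1 / 2))

/-- The normalizing constant `d_H = (H + 1)⁻¹ (H / (2 (2H - 1)))^{-1/2}`. -/
def dConst (H : ℝ) : ℝ := 1 / (H + 1) * √(2 * (2 * H - 1) / H)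

/-- The kernel `K^H(t, s)` of fractional Brownian motion, for `t > s`. -/
def fbmKernel (H t s : ℝ) : ℝ :=
  cConst H * s ^ (1 / 2 - H) * ∫ u in s..t, (u - s) ^ (H - 3 / 2) * u ^ (H - 1 / 2)

/-- The kernel `Q_H(t, y₁, y₂)`, where `H' = (H + 1) / 2`. -/
def Q (H t y₁ y₂ : ℝ) : ℝ :=
  dConst H * (Icc 0 t).indicator (fun _ => (1 : ℝ)) y₁ * (Icc 0 t).indicator (fun _ => (1 : ℝ)) y₂ *
    ∫ x in (max y₁ y₂)..t,
      deriv (fun z => fbmKernel ((H + 1) / 2) z y₁) x *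
        deriv (fun z => fbmKernel ((H + 1) / 2) z y₂) x

/-- The Rosenblatt sheet `Z^{α,β}(t, s)` driven by `B`. -/
def rosenblattSheet {Ω : Type*} [MeasurableSpace Ω] (B : ℝ≥0 × ℝ≥0 → Ω → ℝ) (P : Measure Ω)
    (α β t s : ℝ) : Ω → ℝ :=
  wienerM B P (fun y₁ y₂ u₁ u₂ => Q α t y₁ y₂ * Q β s u₁ u₂) t s

/-! ### The approximating class and the error -/

/-- The approximating kernel with parameters `k₁, k₂`. -/
def zeta (α β k₁ k₂ : ℝ) (y₁ y₂ u₁ u₂ : ℝ) : ℝ :=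
  k₁ * (y₁ * y₂) ^ (-(α / 2)) * (u₁ * u₂) ^ (-(β / 2)) +
    k₂ * ((max y₁ y₂) ^ (α / 2) * (min y₁ y₂) ^ (-(α / 2)) * |y₁ - y₂| ^ (α - 1)) *
      ((max u₁ u₂) ^ (β / 2) * (min u₁ u₂) ^ (-(β / 2)) * |u₁ - u₂| ^ (β - 1))

/-- The class `𝒦` of approximating kernels with `k₁, k₂ > 0`. -/
def classK (α β : ℝ) : Set (ℝ → ℝ → ℝ → ℝ → ℝ) :=
  {ζ | ∃ k₁ k₂ : ℝ, 0 < k₁ ∧ 0 < k₂ ∧ ζ = zeta α β k₁ k₂}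

/-- `2 E (Z^{α,β}(t, s) - M_{t,s}(ζ))²`. -/
def error {Ω : Type*} [MeasurableSpace Ω] (B : ℝ≥0 × ℝ≥0 → Ω → ℝ) (P : Measure Ω)
    (α β : ℝ) (ζ : ℝ → ℝ → ℝ → ℝ → ℝ) (t s : ℝ) : ℝ :=
  2 * ∫ ω, (rosenblattSheet B P α β t s ω - wienerM B P ζ t s ω) ^ 2 ∂P

/-- `f(t, s, k₁, k₂)`, the error for the kernel with parameters `k₁, k₂`. -/
def f {Ω : Type*} [MeasurableSpace Ω] (B : ℝ≥0 × ℝ≥0 → Ω → ℝ) (P : Measure Ω)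
    (α β t s k₁ k₂ : ℝ) : ℝ :=
  error B P α β (zeta α β k₁ k₂) t s

/-! ### The explicit constants -/

/-- `C₁(α) = d_α c_{α'}² B(1 - α, α/2)²`. -/
def C₁ (α : ℝ) : ℝ := dConst α * cConst ((α + 1) / 2) ^ 2 * beta (1 - α) (α / 2) ^ 2

/-- The constant `C₂(α)`, a double integral over the triangle `0 < r < s < 1`. -/
def C₂ (α : ℝ) : ℝ :=
  dConst α * cConst ((α + 1) / 2) ^ 2 *
    ∫ s in (0 : ℝ)..1, ∫ r in (0 : ℝ)..s,
      r ^ (-α) * (1 - s) ^ (α / 2 - 1) * (1 - r) ^ (α / 2 - 1) * (s - r) ^ (α - 1)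

def aCoef (α β k₂ : ℝ) : ℝ :=
  1 + 4 * k₂ ^ 2 / (α * β) * (beta (1 - α) (2 * α - 1) * beta (1 - β) (2 * β - 1)) -
    8 * k₂ / (α * β) * (C₂ α * C₂ β)

def bCoef (α β k₂ : ℝ) : ℝ :=
  C₁ α * C₁ β - 4 * k₂ * (beta (1 - α) α * beta (1 - β) β)

/-- The discriminant `Δ` attached to the edge `{T} × [0, S]`; the one attached to the edge
`[0, T] × {S}` is `disc β α S`. -/
def disc (α β T k₂ : ℝ) : ℝ :=
  16 * T ^ 2 * (bCoef α β k₂ ^ 2 - β * aCoef α β k₂ / ((1 - α) ^ 2 * (1 - β)))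

/-- `k₁*`. -/
def kOneStar (α β T S : ℝ) : ℝ :=
  (4 * beta (1 - α) α * beta (1 - β) β * C₂ α * C₂ β -
      beta (1 - α) (2 * α - 1) * beta (1 - β) (2 * β - 1) * C₁ α * C₁ β) /
    (16 * α * β * (1 - α) ^ 2 * (1 - β) ^ 2 * beta (1 - α) α ^ 2 * beta (1 - β) β ^ 2 -
      beta (1 - α) (2 * α - 1) * beta (1 - β) (2 * β - 1)) *
    ((1 - α) ^ 2 * (1 - β) ^ 2 * T ^ (2 * α - 1) * S ^ (2 * β - 1))

/-- `k₂*`. -/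
def kTwoStar (α β : ℝ) : ℝ :=
  (C₂ α * C₂ β -
      4 * α * β * (1 - α) ^ 2 * (1 - β) ^ 2 * beta (1 - α) α * beta (1 - β) β * C₁ α * C₁ β) /
    (beta (1 - α) (2 * α - 1) * beta (1 - β) (2 * β - 1) -
      16 * α * β * (1 - α) ^ 2 * (1 - β) ^ 2 * beta (1 - α) α ^ 2 * beta (1 - β) β ^ 2)

end

end RosenblattSheet

namespace RosenblattSheet

/-! ### Fourth moments of Gaussian variables and Wick's formula -/

/-! The double integral is an isometry up to a factor: for symmetric square integrable kernels,
E(M(g) - M(h))² = 2‖g - h‖². On elementary kernels this is Wick's formula together with the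
disjointness of the rectangles; it extends to limits in L² (`IsDoubleWiener.eLpNorm_sub`), and
elementary kernels are dense, so the integrals in question exist (`isDoubleWiener_doubleWiener`).
Hence f = 4‖Q⊗Q - ζ‖².

Off a null set both kernels are built from tensor products, one factor in (y₁, y₂) and one in (u₁,
u₂), so every inner product splits into two integrals over a plane. Only six one-parameter integrals
remain. Tonelli, scaling and Beta integrals evaluate them; the norm of Q also needs a Möbius
substitution (`lintegral_moebius`), and the product of Q with the singular kernel gives C₂. The
outcome is the closed form `f_eq_errFun`, a polynomial of degree two in (k₁, k₂).

By Cauchy–Schwarz and 4α(1 - α) < 1 the determinant of this quadratic form is positive (`gram_pos`).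
So its gradient vanishes at one point only, which is (k₁*, k₂*), and this point is a global minimum
(`stationary_iff`, `errFun_kStar_le`). Since a supremum over time is at least the value at (T, S),
the lower bound follows for every kernel of the class.

For the upper bound, the s-derivative of the error is a positive factor times a quadratic polynomial
in t^(2α-1) s^(2β-1). Its discriminant has the sign of Δ or vanishes, so Δ ≤ 0 makes the error
nondecreasing in s, for each t and each k₁ (`errFun_monotoneOn`). The supremum over s at (k₁*, k₂*)
is thus attained at S; exchanging the roles of t and s then treats the edge s = S. As k₁* or k₂* may
vanish, the point may lie outside the open class: it is approached by (k₁* + η, k₂* + η) with an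
error that is uniform in time (`errFun_add_le`, `iInf_classK_eq`). -/

lemma integral_pow_four_gaussianReal (v : ℝ≥0) :
    ∫ x, x ^ 4 ∂(gaussianReal 0 v) = 3 * (v : ℝ) ^ 2 := by
  have h : iteratedDeriv 4 (mgf (fun x ↦ x) (gaussianReal 0 v)) 0 =
      ∫ x, x ^ 4 ∂(gaussianReal 0 v) := by
    rw [iteratedDeriv_mgf_zero] <;> simp
  rw [← h, mgf_fun_id_gaussianReal]
  simp only [zero_mul, zero_add]
  set E : ℝ → ℝ := fun t ↦ Real.exp (v * t ^ 2 / 2) with hE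
  have hEd : ∀ t, HasDerivAt E (v * t * E t) t := fun t ↦ by
    have h1 : HasDerivAt (fun t : ℝ ↦ v * t ^ 2 / 2) (v * t) t := by
      have := (((hasDerivAt_id t).pow 2).const_mul (v : ℝ)).div_const 2
      convert! this using 1
      simp; ring
    convert! h1.exp using 1
    simp only [hE]; ring
  -- Derivatives of the moment generating function keep the form polynomial times `E`; one
  -- differentiation sends p to p' + v t p.
  have key : ∀ p p' : ℝ → ℝ, (∀ t, HasDerivAt p (p' t) t) →
      deriv (fun t ↦ p t * E t) = fun t ↦ (p' t + v * t * p t) * E t := fun p p' hp ↦ by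
    ext t
    rw [((hp t).fun_mul (hEd t)).deriv]
    ring
  have hid : ∀ t : ℝ, HasDerivAt (fun t : ℝ ↦ t) 1 t := fun t ↦ hasDerivAt_id t
  have d1 : deriv E = fun t ↦ (v * t) * E t := by
    ext t; exact (hEd t).deriv
  have d2 : deriv (fun t ↦ (v * t) * E t) = fun t ↦ (v + v ^ 2 * t ^ 2) * E t := by
    rw [key (fun t ↦ v * t) (fun _ ↦ v) fun t ↦ by
      simpa using (hid t).const_mul (v : ℝ)]
    ext t; ring
  have d3 : deriv (fun t ↦ ((v : ℝ) + v ^ 2 * t ^ 2) * E t) =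
      fun t ↦ (3 * v ^ 2 * t + v ^ 3 * t ^ 3) * E t := by
    rw [key (fun t ↦ v + v ^ 2 * t ^ 2) (fun t ↦ v ^ 2 * (2 * t)) fun t ↦ by
      simpa using (((hid t).pow 2).const_mul ((v : ℝ) ^ 2)).const_add (v : ℝ)]
    ext t; ring
  have d4 : deriv (fun t ↦ (3 * (v : ℝ) ^ 2 * t + v ^ 3 * t ^ 3) * E t) =
      fun t ↦ ((3 * v ^ 2 + v ^ 3 * (3 * t ^ 2)) + v * t * (3 * v ^ 2 * t + v ^ 3 * t ^ 3)) *
        E t := by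
    rw [key _ (fun t ↦ 3 * v ^ 2 + v ^ 3 * (3 * t ^ 2)) fun t ↦ by
      simpa using ((hid t).const_mul (3 * (v : ℝ) ^ 2)).fun_add
        (((hid t).pow 3).const_mul ((v : ℝ) ^ 3))]
  rw [iteratedDeriv_succ, iteratedDeriv_succ, iteratedDeriv_succ, iteratedDeriv_one, d1, d2, d3,
    d4]
  simp [hE]

section Wick

variable {Ω : Type*} {B : ℝ≥0 × ℝ≥0 → Ω → ℝ}

/-- The linear space of finite linear combinations of the values of `B`. -/
def gaussianSpan (B : ℝ≥0 × ℝ≥0 → Ω → ℝ) : Submodule ℝ (Ω → ℝ) := Submodule.span ℝ (range B)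

lemma Rect.increment_mem (R : Rect) : R.increment B ∈ gaussianSpan B := by
  have h : ∀ p, B p ∈ gaussianSpan B := fun p ↦ Submodule.subset_span (mem_range_self p)
  exact add_mem (sub_mem (sub_mem (h _) (h _)) (h _)) (h _)

variable [MeasurableSpace Ω] {P : Measure Ω}

/-- A finite combination is a continuous linear image of a finite-dimensional marginal, which is
Gaussian. -/
lemma hasGaussianLaw_of_mem_gaussianSpan (hB : IsBrownianSheet B P) {X : Ω → ℝ}
    (hX : X ∈ gaussianSpan B) : HasGaussianLaw X P := by
  obtain ⟨c, rfl⟩ := Finsupp.mem_span_range_iff_exists_finsupp.1 hX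
  let L : (c.support → ℝ) →L[ℝ] ℝ :=
    ∑ i : c.support, c i.1 • ContinuousLinearMap.proj (R := ℝ) (φ := fun _ : c.support ↦ ℝ) i
  have := (hB.isGaussian.hasGaussianLaw c.support).map_fun L
  convert! this using 1
  ext ω
  simp only [Finsupp.sum, Finset.sum_apply, Pi.smul_apply, L, _root_.sum_apply,
    _root_.smul_apply, ContinuousLinearMap.proj_apply, Finset.restrict]
  rw [← Finset.sum_coe_sort]

lemma memLp_of_mem_gaussianSpan (hB : IsBrownianSheet B P) {X : Ω → ℝ}
    (hX : X ∈ gaussianSpan B) {p : ℝ≥0∞} (hp : p ≠ ∞) : MemLp X p P :=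
  (hasGaussianLaw_of_mem_gaussianSpan hB hX).memLp hp

lemma integral_eq_zero_of_mem_gaussianSpan (hB : IsBrownianSheet B P) {X : Ω → ℝ}
    (hX : X ∈ gaussianSpan B) : ∫ ω, X ω ∂P = 0 := by
  obtain ⟨c, rfl⟩ := Finsupp.mem_span_range_iff_exists_finsupp.1 hX
  simp only [Finsupp.sum, Finset.sum_apply, Pi.smul_apply, smul_eq_mul]
  rw [integral_finsetSum]
  · simp [integral_const_mul, hB.centered]
  · exact fun i _ ↦ ((hB.isGaussian.hasGaussianLaw_eval i).integrable).const_mul _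

lemma integral_pow_four_of_mem_gaussianSpan (hB : IsBrownianSheet B P) {X : Ω → ℝ}
    (hX : X ∈ gaussianSpan B) : ∫ ω, X ω ^ 4 ∂P = 3 * (∫ ω, X ω ^ 2 ∂P) ^ 2 := by
  have hG := hasGaussianLaw_of_mem_gaussianSpan hB hX
  have h0 := integral_eq_zero_of_mem_gaussianSpan hB hX
  have hm := hG.map_eq_gaussianReal
  have hv : Var[X; P] = ∫ ω, X ω ^ 2 ∂P := by
    rw [variance_eq_integral hG.aemeasurable, h0]; simp
  rw [h0] at hm
  have : ∫ ω, X ω ^ 4 ∂P = ∫ x, x ^ 4 ∂(P.map X) := by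
    rw [integral_map hG.aemeasurable (by fun_prop)]
  rw [this, hm, integral_pow_four_gaussianReal, Real.coe_toNNReal _ (variance_nonneg _ _), hv]

lemma integrable_mul_of_mem_gaussianSpan (hB : IsBrownianSheet B P) {X Y : Ω → ℝ}
    (hX : X ∈ gaussianSpan B) (hY : Y ∈ gaussianSpan B) :
    Integrable (fun ω ↦ X ω * Y ω) P :=
  (memLp_of_mem_gaussianSpan hB hX (by simp) : MemLp X 2 P).integrable_mul
    (memLp_of_mem_gaussianSpan hB hY (by simp) : MemLp Y 2 P)

lemma memLp_mul_of_mem_gaussianSpan (hB : IsBrownianSheet B P) {X Y : Ω → ℝ}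
    (hX : X ∈ gaussianSpan B) (hY : Y ∈ gaussianSpan B) :
    MemLp (fun ω ↦ X ω * Y ω) 2 P := by
  have : ENNReal.HolderTriple 4 4 2 := ⟨by
    rw [← two_mul, show (4 : ℝ≥0∞) = 2 * 2 by norm_num, ENNReal.mul_inv (by simp) (by simp),
      ← mul_assoc, ENNReal.mul_inv_cancel (by simp) (by simp), one_mul]⟩
  exact (memLp_of_mem_gaussianSpan hB hY (by simp) : MemLp Y 4 P).mul
    (memLp_of_mem_gaussianSpan hB hX (by simp) : MemLp X 4 P)

lemma integral_sq_lincomb (hB : IsBrownianSheet B P) {W X Y Z : Ω → ℝ}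
    (hW : W ∈ gaussianSpan B) (hX : X ∈ gaussianSpan B) (hY : Y ∈ gaussianSpan B)
    (hZ : Z ∈ gaussianSpan B) (a b c : ℝ) :
    ∫ ω, (W ω + a * X ω + b * Y ω + c * Z ω) ^ 2 ∂P =
      (∫ ω, W ω * W ω ∂P) + a ^ 2 * (∫ ω, X ω * X ω ∂P) + b ^ 2 * (∫ ω, Y ω * Y ω ∂P) +
        c ^ 2 * (∫ ω, Z ω * Z ω ∂P) + 2 * a * (∫ ω, W ω * X ω ∂P) +
        2 * b * (∫ ω, W ω * Y ω ∂P) + 2 * c * (∫ ω, W ω * Z ω ∂P) +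
        2 * a * b * (∫ ω, X ω * Y ω ∂P) + 2 * a * c * (∫ ω, X ω * Z ω ∂P) +
        2 * b * c * (∫ ω, Y ω * Z ω ∂P) := by
  have i := fun {U V : Ω → ℝ} (hU : U ∈ gaussianSpan B) (hV : V ∈ gaussianSpan B) (r : ℝ) ↦
    (integrable_mul_of_mem_gaussianSpan hB hU hV).const_mul r
  have e : ∀ ω, (W ω + a * X ω + b * Y ω + c * Z ω) ^ 2 =
      1 * (W ω * W ω) + a ^ 2 * (X ω * X ω) + b ^ 2 * (Y ω * Y ω) + c ^ 2 * (Z ω * Z ω) +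
        2 * a * (W ω * X ω) + 2 * b * (W ω * Y ω) + 2 * c * (W ω * Z ω) +
        2 * a * b * (X ω * Y ω) + 2 * a * c * (X ω * Z ω) + 2 * b * c * (Y ω * Z ω) :=
    fun ω ↦ by ring
  simp_rw [e]
  have j1 := i hW hW 1
  have j2 := j1.fun_add (i hX hX (a ^ 2))
  have j3 := j2.fun_add (i hY hY (b ^ 2))
  have j4 := j3.fun_add (i hZ hZ (c ^ 2))
  have j5 := j4.fun_add (i hW hX (2 * a))
  have j6 := j5.fun_add (i hW hY (2 * b))
  have j7 := j6.fun_add (i hW hZ (2 * c))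
  have j8 := j7.fun_add (i hX hY (2 * a * b))
  have j9 := j8.fun_add (i hX hZ (2 * a * c))
  rw [integral_add j9 (i hY hZ _), integral_add j8 (i hX hZ _), integral_add j7 (i hX hY _),
    integral_add j6 (i hW hZ _), integral_add j5 (i hW hY _), integral_add j4 (i hW hX _),
    integral_add j3 (i hZ hZ _), integral_add j2 (i hY hY _), integral_add j1 (i hX hX _)]
  simp only [integral_const_mul, one_mul]

/-- Wick's formula for four centred jointly Gaussian variables. -/
lemma integral_mul_four (hB : IsBrownianSheet B P) {W X Y Z : Ω → ℝ}
    (hW : W ∈ gaussianSpan B) (hX : X ∈ gaussianSpan B) (hY : Y ∈ gaussianSpan B)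
    (hZ : Z ∈ gaussianSpan B) :
    ∫ ω, (W ω * X ω) * (Y ω * Z ω) ∂P =
      (∫ ω, W ω * X ω ∂P) * (∫ ω, Y ω * Z ω ∂P) + (∫ ω, W ω * Y ω ∂P) * (∫ ω, X ω * Z ω ∂P) +
        (∫ ω, W ω * Z ω ∂P) * (∫ ω, X ω * Y ω ∂P) := by
  have hL : ∀ a b c : ℝ, W + a • X + b • Y + c • Z ∈ gaussianSpan B := fun a b c ↦
    add_mem (add_mem (add_mem hW (Submodule.smul_mem _ _ hX)) (Submodule.smul_mem _ _ hY))
      (Submodule.smul_mem _ _ hZ)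
  have h4 : ∀ a b c : ℝ, ∫ ω, (W ω + a * X ω + b * Y ω + c * Z ω) ^ 4 ∂P =
      3 * (∫ ω, (W ω + a * X ω + b * Y ω + c * Z ω) ^ 2 ∂P) ^ 2 := fun a b c ↦ by
    simpa using integral_pow_four_of_mem_gaussianSpan hB (hL a b c)
  have hi : ∀ a b c r : ℝ, Integrable (fun ω ↦ r * (W ω + a * X ω + b * Y ω + c * Z ω) ^ 4) P := by
    intro a b c r
    have := (memLp_of_mem_gaussianSpan hB (hL a b c) (by simp) : MemLp _ ((4 : ℕ) : ℝ≥0∞) P)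
    have := this.integrable_norm_pow (by norm_num)
    refine Integrable.const_mul (this.congr (ae_of_all _ fun ω ↦ ?_)) r
    simp only [Real.norm_eq_abs, Even.pow_abs (by decide : Even 4)]
    simp
  -- Polarization: with the sign of each form as weight, the eight fourth powers add up to 8 · 24 =
  -- 192 times the product. Wick's formula thus reduces to the fourth moment of one Gaussian
  -- variable.
  have e : ∀ ω, (W ω * X ω) * (Y ω * Z ω) =
      1 / 192 * (W ω + 1 * X ω + 1 * Y ω + 1 * Z ω) ^ 4 +
      1 / 192 * (W ω + 1 * X ω + (-1) * Y ω + (-1) * Z ω) ^ 4 +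
      1 / 192 * (W ω + (-1) * X ω + 1 * Y ω + (-1) * Z ω) ^ 4 +
      1 / 192 * (W ω + (-1) * X ω + (-1) * Y ω + 1 * Z ω) ^ 4 +
      (-1 / 192) * (W ω + (-1) * X ω + 1 * Y ω + 1 * Z ω) ^ 4 +
      (-1 / 192) * (W ω + 1 * X ω + (-1) * Y ω + 1 * Z ω) ^ 4 +
      (-1 / 192) * (W ω + 1 * X ω + 1 * Y ω + (-1) * Z ω) ^ 4 +
      (-1 / 192) * (W ω + (-1) * X ω + (-1) * Y ω + (-1) * Z ω) ^ 4 := fun ω ↦ by ring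
  simp_rw [e]
  have j1 := hi 1 1 1 (1 / 192)
  have j2 := j1.fun_add (hi 1 (-1) (-1) (1 / 192))
  have j3 := j2.fun_add (hi (-1) 1 (-1) (1 / 192))
  have j4 := j3.fun_add (hi (-1) (-1) 1 (1 / 192))
  have j5 := j4.fun_add (hi (-1) 1 1 (-1 / 192))
  have j6 := j5.fun_add (hi 1 (-1) 1 (-1 / 192))
  have j7 := j6.fun_add (hi 1 1 (-1) (-1 / 192))
  rw [integral_add j7 (hi _ _ _ _), integral_add j6 (hi _ _ _ _), integral_add j5 (hi _ _ _ _),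
    integral_add j4 (hi _ _ _ _), integral_add j3 (hi _ _ _ _), integral_add j2 (hi _ _ _ _),
    integral_add j1 (hi _ _ _ _)]
  simp only [integral_const_mul, h4, integral_sq_lincomb hB hW hX hY hZ]
  ring

end Wick

/-! ### The isometry on elementary kernels -/

section ElemIsometry

/-- The area of the intersection of two rectangles. -/
noncomputable def Rect.interArea (R R' : Rect) : ℝ := volume.real (R.toSet ∩ R'.toSet)

lemma Rect.measurableSet_toSet (R : Rect) : MeasurableSet R.toSet :=
  measurableSet_Ioc.prod measurableSet_Ioc

lemma volume_real_Ioc_inter_Ioc {a b c d : ℝ} (hab : a ≤ b) (hcd : c ≤ d) :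
    volume.real (Ioc a b ∩ Ioc c d) = min b d - min a d - min b c + min a c := by
  rw [Ioc_inter_Ioc, Real.volume_real_Ioc]
  grind

lemma Rect.interArea_eq (R R' : Rect) :
    R.interArea R' =
      (min (R.b : ℝ) R'.b - min (R.a : ℝ) R'.b - min (R.b : ℝ) R'.a + min (R.a : ℝ) R'.a) *
        (min (R.d : ℝ) R'.d - min (R.c : ℝ) R'.d - min (R.d : ℝ) R'.c + min (R.c : ℝ) R'.c) := by
  rw [Rect.interArea, Rect.toSet, Rect.toSet, prod_inter_prod, Measure.volume_eq_prod,
    measureReal_prod_prod, volume_real_Ioc_inter_Ioc (NNReal.coe_le_coe.2 R.hab)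
      (NNReal.coe_le_coe.2 R'.hab), volume_real_Ioc_inter_Ioc (NNReal.coe_le_coe.2 R.hcd)
      (NNReal.coe_le_coe.2 R'.hcd)]

lemma Rect.interArea_eq_zero {R R' : Rect} (h : Disjoint R.toSet R'.toSet) :
    R.interArea R' = 0 := by
  rw [interArea, h.inter_eq, measureReal_empty]

variable {Ω : Type*} [MeasurableSpace Ω] {P : Measure Ω} {B : ℝ≥0 × ℝ≥0 → Ω → ℝ}

lemma integral_mul_eq_min (hB : IsBrownianSheet B P) (p q : ℝ≥0 × ℝ≥0) :
    ∫ ω, B p ω * B q ω ∂P = (min p.1 q.1 : ℝ) * (min p.2 q.2 : ℝ) := by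
  rw [← hB.covariance p q, covariance]
  simp [hB.centered]

lemma integral_increment_mul (hB : IsBrownianSheet B P) (R : Rect) {X : Ω → ℝ}
    (hX : X ∈ gaussianSpan B) :
    ∫ ω, R.increment B ω * X ω ∂P =
      (∫ ω, B (R.b, R.d) ω * X ω ∂P) - (∫ ω, B (R.a, R.d) ω * X ω ∂P) -
        (∫ ω, B (R.b, R.c) ω * X ω ∂P) + ∫ ω, B (R.a, R.c) ω * X ω ∂P := by
  have i := fun p ↦ integrable_mul_of_mem_gaussianSpan hB
    (Submodule.subset_span (mem_range_self p) : B p ∈ gaussianSpan B) hX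
  simp only [Rect.increment, add_mul, sub_mul]
  have j : Integrable (fun ω ↦ B (R.b, R.d) ω * X ω - B (R.a, R.d) ω * X ω) P := (i _).sub (i _)
  have k : Integrable (fun ω ↦ B (R.b, R.d) ω * X ω - B (R.a, R.d) ω * X ω -
    B (R.b, R.c) ω * X ω) P := j.sub (i _)
  rw [integral_add k (i _), integral_sub j (i _), integral_sub (i _) (i _)]

/-- Expanding both increments gives the same alternating sum of products of minima as the area of
the intersection in `Rect.interArea_eq`. -/
lemma integral_increment_mul_increment (hB : IsBrownianSheet B P) (R R' : Rect) :
    ∫ ω, R.increment B ω * R'.increment B ω ∂P = R.interArea R' := by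
  rw [integral_increment_mul hB R R'.increment_mem]
  have h : ∀ p, ∫ ω, B p ω * R'.increment B ω ∂P =
      (min p.1 R'.b : ℝ) * (min p.2 R'.d : ℝ) - (min p.1 R'.a : ℝ) * (min p.2 R'.d : ℝ) -
      (min p.1 R'.b : ℝ) * (min p.2 R'.c : ℝ) + (min p.1 R'.a : ℝ) * (min p.2 R'.c : ℝ) := by
    intro p
    simp_rw [mul_comm (B p _)]
    rw [integral_increment_mul hB R' (Submodule.subset_span (mem_range_self p))]
    simp only [integral_mul_eq_min hB, min_comm]
  simp only [h, Rect.interArea_eq]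
  ring

lemma ElemKernel.memLp_integral (hB : IsBrownianSheet B P) (e : ElemKernel) :
    MemLp (e.integral B) 2 P := by
  have : e.integral B = fun ω ↦ ∑ i, e.coef i *
      ((e.left i).increment B ω * (e.right i).increment B ω) := rfl
  rw [this]
  exact memLp_finsetSum _ fun i _ ↦ (memLp_mul_of_mem_gaussianSpan hB
    (e.left i).increment_mem (e.right i).increment_mem).const_mul _

lemma ElemKernel.integral_sq_integral (hB : IsBrownianSheet B P) (e : ElemKernel) :
    ∫ ω, e.integral B ω ^ 2 ∂P = ∑ i, ∑ j, e.coef i * e.coef j *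
      ((e.left i).interArea (e.left j) * (e.right i).interArea (e.right j) +
        (e.left i).interArea (e.right j) * (e.right i).interArea (e.left j)) := by
  have hi : ∀ i j, Integrable (fun ω ↦ e.coef i * e.coef j *
      (((e.left i).increment B ω * (e.right i).increment B ω) *
        ((e.left j).increment B ω * (e.right j).increment B ω))) P := fun i j ↦
    ((memLp_mul_of_mem_gaussianSpan hB (e.left i).increment_mem
      (e.right i).increment_mem).integrable_mul (memLp_mul_of_mem_gaussianSpan hB
        (e.left j).increment_mem (e.right j).increment_mem)).const_mul _
  have hsq : ∀ ω, e.integral B ω ^ 2 = ∑ i, ∑ j, e.coef i * e.coef j *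
      (((e.left i).increment B ω * (e.right i).increment B ω) *
        ((e.left j).increment B ω * (e.right j).increment B ω)) := fun ω ↦ by
    rw [sq, ElemKernel.integral, Finset.sum_mul_sum]
    exact Finset.sum_congr rfl fun i _ ↦ Finset.sum_congr rfl fun j _ ↦ by ring
  simp_rw [hsq]
  rw [integral_finsetSum _ fun i _ ↦ integrable_finsetSum _ fun j _ ↦ hi i j]
  refine Finset.sum_congr rfl fun i _ ↦ ?_
  rw [integral_finsetSum _ fun j _ ↦ hi i j]
  refine Finset.sum_congr rfl fun j _ ↦ ?_
  rw [integral_const_mul, integral_mul_four hB (e.left i).increment_mem (e.right i).increment_mem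
    (e.left j).increment_mem (e.right j).increment_mem]
  -- The pairing of the two factors of one term drops out because their rectangles are disjoint;
  -- this is why elementary kernels must vanish on the diagonal.
  simp only [integral_increment_mul_increment hB, Rect.interArea_eq_zero (e.disj i)]
  ring

/-- The indicator function of a rectangle. -/
noncomputable def Rect.ind (R : Rect) : ℝ × ℝ → ℝ := R.toSet.indicator 1

lemma Rect.ind_mul_ind (R R' : Rect) (p : ℝ × ℝ) :
    R.ind p * R'.ind p = (R.toSet ∩ R'.toSet).indicator 1 p := by
  rw [Rect.ind, Rect.ind, inter_indicator_one]; rfl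

lemma Rect.volume_toSet_lt_top (R : Rect) : volume R.toSet < ∞ := by
  rw [Rect.toSet, Measure.volume_eq_prod, Measure.prod_prod]
  simp [ENNReal.mul_lt_top]

lemma Rect.integrable_ind_mul_ind (R R' : Rect) :
    Integrable (fun p ↦ R.ind p * R'.ind p) := by
  simp_rw [Rect.ind_mul_ind]
  refine (integrable_indicator_iff (R.measurableSet_toSet.inter R'.measurableSet_toSet)).2 ?_
  refine integrableOn_const (ne_of_lt ?_)
  exact (measure_mono inter_subset_left).trans_lt R.volume_toSet_lt_top

lemma Rect.integral_ind_mul_ind (R R' : Rect) : ∫ p, R.ind p * R'.ind p = R.interArea R' := by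
  simp_rw [Rect.ind_mul_ind]
  rw [integral_indicator_one (R.measurableSet_toSet.inter R'.measurableSet_toSet)]
  rfl

lemma ElemKernel.toFun_eq (e : ElemKernel) (p : (ℝ × ℝ) × (ℝ × ℝ)) :
    e.toFun p = ∑ i, e.coef i * ((e.left i).ind p.1 * (e.right i).ind p.2) := by
  refine Finset.sum_congr rfl fun i _ ↦ ?_
  congr 1
  simp only [Rect.ind, indicator, mem_prod, Pi.one_apply]
  split_ifs <;> simp_all

lemma ElemKernel.memLp_toFun (e : ElemKernel) : MemLp e.toFun 2 := by
  have : e.toFun = fun p ↦ ∑ i, e.coef i *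
      ((e.left i).toSet ×ˢ (e.right i).toSet).indicator (fun _ => (1 : ℝ)) p := rfl
  rw [this]
  refine memLp_finsetSum _ fun i _ ↦ MemLp.const_mul ?_ _
  refine memLp_indicator_const _
    ((e.left i).measurableSet_toSet.prod (e.right i).measurableSet_toSet) _ (Or.inr ?_)
  rw [Measure.volume_eq_prod, Measure.prod_prod]
  exact (ENNReal.mul_lt_top (e.left i).volume_toSet_lt_top (e.right i).volume_toSet_lt_top).ne

/-- Expanding the square gives four products of indicators; exchanging the two points matches them
in pairs, and the two remaining values are the two Wick pairings of
`ElemKernel.integral_sq_integral`. -/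
lemma ElemKernel.integral_sq_symm (e : ElemKernel) :
    ∫ p, (e.toFun p + e.toFun p.swap) ^ 2 = 2 * ∑ i, ∑ j, e.coef i * e.coef j *
      ((e.left i).interArea (e.left j) * (e.right i).interArea (e.right j) +
        (e.left i).interArea (e.right j) * (e.right i).interArea (e.left j)) := by
  have hintg : ∀ (r : ℝ) (A A' C C' : Rect), Integrable (fun p : (ℝ × ℝ) × (ℝ × ℝ) ↦
      r * ((A.ind p.1 * A'.ind p.1) * (C.ind p.2 * C'.ind p.2))) := fun r A A' C C' ↦
    ((A.integrable_ind_mul_ind A').mul_prod (C.integrable_ind_mul_ind C')).const_mul r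
  have hval : ∀ A A' C C' : Rect, ∫ p : (ℝ × ℝ) × (ℝ × ℝ),
      (A.ind p.1 * A'.ind p.1) * (C.ind p.2 * C'.ind p.2) =
      A.interArea A' * C.interArea C' := fun A A' C C' ↦ by
    rw [Measure.volume_eq_prod, integral_prod_mul (fun x ↦ A.ind x * A'.ind x)
      (fun x ↦ C.ind x * C'.ind x), A.integral_ind_mul_ind, C.integral_ind_mul_ind]
  have hsq : ∀ p : (ℝ × ℝ) × (ℝ × ℝ), (e.toFun p + e.toFun p.swap) ^ 2 = ∑ i, ∑ j,
      (e.coef i * e.coef j *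
        (((e.left i).ind p.1 * (e.left j).ind p.1) * ((e.right i).ind p.2 * (e.right j).ind p.2)) +
      e.coef i * e.coef j *
        (((e.left i).ind p.1 * (e.right j).ind p.1) * ((e.right i).ind p.2 * (e.left j).ind p.2)) +
      e.coef i * e.coef j *
        (((e.right i).ind p.1 * (e.left j).ind p.1) * ((e.left i).ind p.2 * (e.right j).ind p.2)) +
      e.coef i * e.coef j *
        (((e.right i).ind p.1 * (e.right j).ind p.1) *
          ((e.left i).ind p.2 * (e.left j).ind p.2))) := fun p ↦ by
    rw [sq, e.toFun_eq, e.toFun_eq, ← Finset.sum_add_distrib, Finset.sum_mul_sum]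
    refine Finset.sum_congr rfl fun i _ ↦ Finset.sum_congr rfl fun j _ ↦ ?_
    simp only [Prod.fst_swap, Prod.snd_swap]
    ring
  simp_rw [hsq]
  have hi := fun i j ↦ (((hintg (e.coef i * e.coef j) (e.left i) (e.left j) (e.right i)
    (e.right j)).fun_add (hintg (e.coef i * e.coef j) (e.left i) (e.right j) (e.right i)
    (e.left j))).fun_add (hintg (e.coef i * e.coef j) (e.right i) (e.left j) (e.left i)
    (e.right j))).fun_add (hintg (e.coef i * e.coef j) (e.right i) (e.right j) (e.left i)
    (e.left j))
  rw [integral_finsetSum _ fun i _ ↦ integrable_finsetSum _ fun j _ ↦ hi i j, Finset.mul_sum]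
  refine Finset.sum_congr rfl fun i _ ↦ ?_
  rw [integral_finsetSum _ fun j _ ↦ hi i j, Finset.mul_sum]
  refine Finset.sum_congr rfl fun j _ ↦ ?_
  rw [integral_add (((hintg _ _ _ _ _).fun_add (hintg _ _ _ _ _)).fun_add (hintg _ _ _ _ _))
      (hintg _ _ _ _ _), integral_add ((hintg _ _ _ _ _).fun_add (hintg _ _ _ _ _))
      (hintg _ _ _ _ _), integral_add (hintg _ _ _ _ _) (hintg _ _ _ _ _)]
  simp only [integral_const_mul, hval]
  ring

end ElemIsometry

/-! ### Symmetrization and the isometry for general kernels -/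

section Isometry

lemma eLpNorm_two_eq_ofReal_sqrt {X : Type*} [MeasurableSpace X] {μ : Measure X} {g : X → ℝ}
    (hg : MemLp g 2 μ) : eLpNorm g 2 μ = ENNReal.ofReal (√(∫ x, g x ^ 2 ∂μ)) := by
  rw [hg.eLpNorm_eq_integral_rpow_norm (by simp) (by simp), Real.sqrt_eq_rpow]
  simp

/-- The normalized symmetrization of a kernel. -/
noncomputable def symm (g : (ℝ × ℝ) × (ℝ × ℝ) → ℝ) (p : (ℝ × ℝ) × (ℝ × ℝ)) : ℝ :=
  √(1 / 2) * (g p + g p.swap)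

lemma measurePreserving_swap_plane :
    MeasurePreserving (Prod.swap : (ℝ × ℝ) × (ℝ × ℝ) → (ℝ × ℝ) × (ℝ × ℝ)) :=
  Measure.measurePreserving_swap

lemma memLp_comp_swap {g : (ℝ × ℝ) × (ℝ × ℝ) → ℝ} (hg : MemLp g 2) :
    MemLp (fun p : (ℝ × ℝ) × (ℝ × ℝ) ↦ g p.swap) 2 :=
  hg.comp_measurePreserving measurePreserving_swap_plane

lemma memLp_symm {g : (ℝ × ℝ) × (ℝ × ℝ) → ℝ} (hg : MemLp g 2) : MemLp (symm g) 2 :=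
  (hg.add (memLp_comp_swap hg)).const_mul _

lemma eLpNorm_symm_le {g : (ℝ × ℝ) × (ℝ × ℝ) → ℝ} (hg : MemLp g 2) :
    eLpNorm (symm g) 2 ≤ 2 * eLpNorm g 2 := by
  have h1 : eLpNorm (symm g) 2 ≤ eLpNorm (g + fun p : (ℝ × ℝ) × (ℝ × ℝ) ↦ g p.swap) 2 := by
    refine eLpNorm_mono fun p ↦ ?_
    rw [symm, norm_mul, Real.norm_of_nonneg (Real.sqrt_nonneg _)]
    refine mul_le_of_le_one_left (norm_nonneg _) ?_
    exact Real.sqrt_le_iff.2 ⟨by norm_num, by norm_num⟩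
  refine h1.trans ((eLpNorm_add_le hg.1 (memLp_comp_swap hg).1 (by norm_num)).trans ?_)
  have h2 : eLpNorm (fun p : (ℝ × ℝ) × (ℝ × ℝ) ↦ g p.swap) 2 = eLpNorm g 2 :=
    eLpNorm_comp_measurePreserving hg.1 measurePreserving_swap_plane
  rw [h2, two_mul]

lemma symm_sub (g h : (ℝ × ℝ) × (ℝ × ℝ) → ℝ) : symm (g - h) = symm g - symm h := by
  ext p; simp only [symm, Pi.sub_apply]; ring

lemma integral_sq_symm_of_symmetric {g : (ℝ × ℝ) × (ℝ × ℝ) → ℝ} (h : ∀ p, g p.swap = g p) :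
    ∫ p, symm g p ^ 2 = 2 * ∫ p, g p ^ 2 := by
  rw [← integral_const_mul]
  congr 1 with p
  rw [symm, h, mul_pow, Real.sq_sqrt (by norm_num)]
  ring

/-- The difference of two elementary kernels. -/
def ElemKernel.sub (e e' : ElemKernel) : ElemKernel where
  n := e.n + e'.n
  coef := Fin.append e.coef fun i ↦ -e'.coef i
  left := Fin.append e.left e'.left
  right := Fin.append e.right e'.right
  disj i := by
    refine Fin.addCases (fun i ↦ ?_) (fun i ↦ ?_) i
    · simpa using e.disj i
    · simpa using e'.disj i

lemma ElemKernel.toFun_sub (e e' : ElemKernel) : (e.sub e').toFun = e.toFun - e'.toFun := by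
  ext p
  refine (Fin.sum_univ_add (a := e.n) (b := e'.n) _).trans ?_
  simp only [ElemKernel.toFun, ElemKernel.sub, Fin.append_left, Fin.append_right,
    Pi.sub_apply, neg_mul, Finset.sum_neg_distrib, sub_eq_add_neg]

variable {Ω : Type*} {B : ℝ≥0 × ℝ≥0 → Ω → ℝ}

lemma ElemKernel.integral_sub (e e' : ElemKernel) :
    (e.sub e').integral B = e.integral B - e'.integral B := by
  ext p
  refine (Fin.sum_univ_add (a := e.n) (b := e'.n) _).trans ?_
  simp only [ElemKernel.integral, ElemKernel.sub, Fin.append_left, Fin.append_right,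
    Pi.sub_apply, neg_mul, Finset.sum_neg_distrib, sub_eq_add_neg]

variable [MeasurableSpace Ω] {P : Measure Ω}

/-- The factor √(1/2) in `symm` is chosen to make this an equality of norms, with no symmetry
assumed of the kernel. -/
lemma ElemKernel.eLpNorm_integral (hB : IsBrownianSheet B P) (e : ElemKernel) :
    eLpNorm (e.integral B) 2 P = eLpNorm (symm e.toFun) 2 := by
  rw [eLpNorm_two_eq_ofReal_sqrt (e.memLp_integral hB),
    eLpNorm_two_eq_ofReal_sqrt (memLp_symm e.memLp_toFun), e.integral_sq_integral hB]
  have : ∫ p, symm e.toFun p ^ 2 = 1 / 2 * ∫ p, (e.toFun p + e.toFun p.swap) ^ 2 := by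
    rw [← integral_const_mul]
    congr 1 with p
    rw [symm, mul_pow, Real.sq_sqrt (by norm_num)]
  rw [this, e.integral_sq_symm]
  congr 2
  ring

lemma ElemKernel.eLpNorm_integral_sub (hB : IsBrownianSheet B P) (e e' : ElemKernel) :
    eLpNorm (e.integral B - e'.integral B) 2 P = eLpNorm (symm (e.toFun - e'.toFun)) 2 := by
  rw [← ElemKernel.integral_sub, ElemKernel.eLpNorm_integral hB, ElemKernel.toFun_sub]

/-- The isometry passes to the limit. It holds for any versions `X` and `Y`, so the choice made in
`doubleWiener` plays no role. -/
lemma IsDoubleWiener.eLpNorm_sub (hB : IsBrownianSheet B P) {g h : (ℝ × ℝ) × (ℝ × ℝ) → ℝ}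
    {X Y : Ω → ℝ} (hX : IsDoubleWiener B P g X) (hY : IsDoubleWiener B P h Y) :
    eLpNorm (X - Y) 2 P = eLpNorm (symm (g - h)) 2 := by
  obtain ⟨hg, hXm, hX⟩ := hX
  obtain ⟨hh, hYm, hY⟩ := hY
  -- Replacing `X` and `Y` by elementary integrals costs 2ε; replacing the kernels costs 4ε, as
  -- symmetrization at most doubles the norm.
  have key : ∀ ε : ℝ≥0, 0 < ε → eLpNorm (X - Y) 2 P ≤ eLpNorm (symm (g - h)) 2 + 6 * ε ∧
      eLpNorm (symm (g - h)) 2 ≤ eLpNorm (X - Y) 2 P + 6 * ε := by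
    intro ε hε
    obtain ⟨e, he1, he2⟩ := hX ε (by exact_mod_cast hε)
    obtain ⟨e', he1', he2'⟩ := hY ε (by exact_mod_cast hε)
    change eLpNorm (g - e.toFun) 2 volume < ε at he1
    change eLpNorm (h - e'.toFun) 2 volume < ε at he1'
    change eLpNorm (X - e.integral B) 2 P < ε at he2
    change eLpNorm (Y - e'.integral B) 2 P < ε at he2'
    have hI := ElemKernel.eLpNorm_integral_sub hB e e'
    have m1 := e.memLp_toFun
    have m1' := e'.memLp_toFun
    have m2 := e.memLp_integral hB
    have m2' := e'.memLp_integral hB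
    have a1 : eLpNorm ((X - e.integral B) - (Y - e'.integral B)) 2 P ≤ ε + ε :=
      (eLpNorm_sub_le (hXm.sub m2).1 (hYm.sub m2').1 (by norm_num)).trans
        (add_le_add he2.le he2'.le)
    have a2 : eLpNorm (symm ((g - e.toFun) - (h - e'.toFun))) 2 ≤ 2 * (ε + ε) :=
      (eLpNorm_symm_le ((hg.sub m1).sub (hh.sub m1'))).trans (by
        gcongr
        exact (eLpNorm_sub_le (hg.sub m1).1 (hh.sub m1').1 (by norm_num)).trans
          (add_le_add he1.le he1'.le))
    have m3 := memLp_symm ((hg.sub m1).sub (hh.sub m1'))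
    have m4 := (hXm.sub m2).sub (hYm.sub m2')
    have m5 := memLp_symm (m1.sub m1')
    have m6 := m2.sub m2'
    have six : (ε + ε : ℝ≥0∞) + 2 * (ε + ε) = 6 * ε := by ring
    constructor
    · have e1 : X - Y = ((X - e.integral B) - (Y - e'.integral B)) +
          (e.integral B - e'.integral B) := by abel
      have e2 : symm (e.toFun - e'.toFun) =
          symm (g - h) - symm ((g - e.toFun) - (h - e'.toFun)) := by
        rw [← symm_sub]; congr 1; abel
      have b1 : eLpNorm (X - Y) 2 P ≤ eLpNorm (symm (e.toFun - e'.toFun)) 2 + (ε + ε) := by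
        rw [e1, ← hI, add_comm (eLpNorm _ _ _)]
        exact (eLpNorm_add_le m4.1 m6.1 (by norm_num)).trans (by gcongr)
      have b2 : eLpNorm (symm (e.toFun - e'.toFun)) 2 ≤
          eLpNorm (symm (g - h)) 2 + 2 * (ε + ε) := by
        rw [e2]
        exact (eLpNorm_sub_le (memLp_symm (hg.sub hh)).1 m3.1 (by norm_num)).trans (by gcongr)
      rw [← six, add_comm (ε + ε : ℝ≥0∞), ← add_assoc]
      exact b1.trans (by gcongr)
    · have e1 : e.integral B - e'.integral B = (X - Y) -
          ((X - e.integral B) - (Y - e'.integral B)) := by abel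
      have e2 : symm (g - h) = symm (e.toFun - e'.toFun) +
          symm ((g - e.toFun) - (h - e'.toFun)) := by
        simp only [symm_sub]; abel
      have b1 : eLpNorm (symm (g - h)) 2 ≤
          eLpNorm (symm (e.toFun - e'.toFun)) 2 + 2 * (ε + ε) := by
        rw [e2]
        exact (eLpNorm_add_le m5.1 m3.1 (by norm_num)).trans (by gcongr)
      have b2 : eLpNorm (symm (e.toFun - e'.toFun)) 2 ≤ eLpNorm (X - Y) 2 P + (ε + ε) := by
        rw [← hI, e1]
        exact (eLpNorm_sub_le (hXm.sub hYm).1 m4.1 (by norm_num)).trans (by gcongr)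
      rw [← six, ← add_assoc]
      exact b1.trans (by gcongr)
  have h6 : ∀ ε : ℝ≥0, 6 * ((ε / 6 : ℝ≥0) : ℝ≥0∞) = ε := fun ε ↦ by
    rw [← ENNReal.coe_ofNat, ← ENNReal.coe_mul]
    congr 1
    field_simp
  apply le_antisymm
  · refine ENNReal.le_of_forall_pos_le_add fun ε hε _ ↦ ?_
    simpa only [h6] using (key (ε / 6) (by positivity)).1
  · refine ENNReal.le_of_forall_pos_le_add fun ε hε _ ↦ ?_
    simpa only [h6] using (key (ε / 6) (by positivity)).2

lemma IsDoubleWiener.integral_sq_sub (hB : IsBrownianSheet B P) {g h : (ℝ × ℝ) × (ℝ × ℝ) → ℝ}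
    {X Y : Ω → ℝ} (hX : IsDoubleWiener B P g X) (hY : IsDoubleWiener B P h Y)
    (hg : ∀ p, g p.swap = g p) (hh : ∀ p, h p.swap = h p) :
    ∫ ω, (X ω - Y ω) ^ 2 ∂P = 2 * ∫ p, (g p - h p) ^ 2 := by
  have := hX.eLpNorm_sub hB hY
  rw [eLpNorm_two_eq_ofReal_sqrt (hX.2.1.sub hY.2.1),
    eLpNorm_two_eq_ofReal_sqrt (memLp_symm (hX.1.sub hY.1)),
    ENNReal.ofReal_eq_ofReal_iff (Real.sqrt_nonneg _) (Real.sqrt_nonneg _),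
    Real.sqrt_inj (integral_nonneg fun _ ↦ sq_nonneg _) (integral_nonneg fun _ ↦ sq_nonneg _),
    integral_sq_symm_of_symmetric (fun p ↦ by simp [hg, hh])] at this
  exact this

end Isometry

/-! ### Density of the elementary kernels -/

section Density

open Filter Topology

/-- The lower left corner of the cell of the grid of mesh `1 / (n + 1)` that contains `y`. -/
noncomputable def gridCorner (n : ℕ) (y : ℝ) : ℝ := ((⌈y * (n + 1)⌉₊ - 1 : ℕ) : ℝ) / (n + 1)

/-- Cells are open on the left, so the ceiling minus one is the cell index. For y ≤ 0 the truncated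
subtraction in `gridCorner` returns 0, a value that is never used. -/
lemma mem_gridCell_iff {n i : ℕ} {y : ℝ} :
    y ∈ Ioc ((i : ℝ) / (n + 1)) ((i + 1 : ℝ) / (n + 1)) ↔ ⌈y * (n + 1)⌉₊ = i + 1 := by
  have hn : (0 : ℝ) < n + 1 := by positivity
  rw [Nat.ceil_eq_iff (by omega), mem_Ioc, div_lt_iff₀ hn, le_div_iff₀ hn]
  simp

lemma tendsto_gridCorner {y : ℝ} (hy : 0 < y) :
    Tendsto (fun n ↦ gridCorner n y) atTop (𝓝 y) := by
  have h1 : Tendsto (fun n : ℕ ↦ y - 1 / ((n : ℝ) + 1)) atTop (𝓝 y) := by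
    simpa using (tendsto_one_div_add_atTop_nhds_zero_nat (𝕜 := ℝ)).const_sub y
  have key : ∀ n : ℕ, y - 1 / ((n : ℝ) + 1) ≤ gridCorner n y ∧ gridCorner n y ≤ y := by
    intro n
    have hn : (0 : ℝ) < n + 1 := by positivity
    have hc : ⌈y * (n + 1)⌉₊ = (⌈y * (n + 1)⌉₊ - 1) + 1 := by
      have : 0 < ⌈y * (n + 1)⌉₊ := Nat.ceil_pos.2 (by positivity)
      omega
    have := mem_gridCell_iff.2 hc
    rw [gridCorner]
    refine ⟨?_, this.1.le⟩
    have h2 := this.2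
    rw [add_div] at h2
    linarith
  exact tendsto_of_tendsto_of_tendsto_of_le_of_le h1 tendsto_const_nhds
    (fun n ↦ (key n).1) fun n ↦ (key n).2

/-- The cell with indices `i, j` of the grid of mesh `1 / (n + 1)`. -/
noncomputable def gridRect (n : ℕ) (i : ℕ × ℕ) : Rect where
  a := (i.1 : ℝ≥0) / (n + 1)
  b := (i.1 + 1 : ℝ≥0) / (n + 1)
  c := (i.2 : ℝ≥0) / (n + 1)
  d := (i.2 + 1 : ℝ≥0) / (n + 1)
  hab := by gcongr; simp
  hcd := by gcongr; simp

lemma mem_gridRect_iff {n : ℕ} {i : ℕ × ℕ} {p : ℝ × ℝ} :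
    p ∈ (gridRect n i).toSet ↔ ⌈p.1 * (n + 1)⌉₊ = i.1 + 1 ∧ ⌈p.2 * (n + 1)⌉₊ = i.2 + 1 := by
  rw [← mem_gridCell_iff, ← mem_gridCell_iff]
  simp [gridRect, Rect.toSet, mem_prod]

/-- The indices of the pairs of distinct cells of the grid of mesh `1 / (n + 1)` in `(0, K]²`. -/
def gridIndex (n K : ℕ) : Finset ((ℕ × ℕ) × (ℕ × ℕ)) :=
  (((Finset.range (K * (n + 1)) ×ˢ Finset.range (K * (n + 1))) ×ˢ
    (Finset.range (K * (n + 1)) ×ˢ Finset.range (K * (n + 1)))).filter fun x ↦ x.1 ≠ x.2)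

/-- The step function approximation of `φ` on the grid of mesh `1 / (n + 1)`. -/
noncomputable def gridKernel (φ : (ℝ × ℝ) × (ℝ × ℝ) → ℝ) (n K : ℕ) : ElemKernel where
  n := (gridIndex n K).card
  coef i := φ
    (((((gridIndex n K).equivFin.symm i).1.1.1 : ℝ) / (n + 1),
      (((gridIndex n K).equivFin.symm i).1.1.2 : ℝ) / (n + 1)),
     ((((gridIndex n K).equivFin.symm i).1.2.1 : ℝ) / (n + 1),
      (((gridIndex n K).equivFin.symm i).1.2.2 : ℝ) / (n + 1)))
  left i := gridRect n ((gridIndex n K).equivFin.symm i).1.1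
  right i := gridRect n ((gridIndex n K).equivFin.symm i).1.2
  disj i := by
    have h := (Finset.mem_filter.1 ((gridIndex n K).equivFin.symm i).2).2
    refine disjoint_left.2 fun p hp hp' ↦ h ?_
    rw [mem_gridRect_iff] at hp hp'
    ext <;> omega

-- At most one pair of cells contains the point, so the sum has at most one nonzero term; it has
-- none when both components lie in the same cell.
open Classical in
lemma gridKernel_toFun (φ : (ℝ × ℝ) × (ℝ × ℝ) → ℝ) (n K : ℕ) (p : (ℝ × ℝ) × (ℝ × ℝ)) :
    (gridKernel φ n K).toFun p =
      if ((p.1.1 ∈ Ioc (0 : ℝ) K ∧ p.1.2 ∈ Ioc (0 : ℝ) K) ∧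
          (p.2.1 ∈ Ioc (0 : ℝ) K ∧ p.2.2 ∈ Ioc (0 : ℝ) K)) ∧
        (gridCorner n p.1.1, gridCorner n p.1.2) ≠ (gridCorner n p.2.1, gridCorner n p.2.2)
      then φ ((gridCorner n p.1.1, gridCorner n p.1.2), (gridCorner n p.2.1, gridCorner n p.2.2))
      else 0 := by
  have hn : (0 : ℝ) < n + 1 := by positivity
  have h1 : (gridKernel φ n K).toFun p = ∑ x ∈ gridIndex n K,
      φ (((x.1.1 : ℝ) / (n + 1), (x.1.2 : ℝ) / (n + 1)),
        ((x.2.1 : ℝ) / (n + 1), (x.2.2 : ℝ) / (n + 1))) *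
      ((gridRect n x.1).toSet ×ˢ (gridRect n x.2).toSet).indicator (fun _ ↦ (1 : ℝ)) p := by
    rw [← Finset.sum_coe_sort]
    exact Equiv.sum_comp (gridIndex n K).equivFin.symm (fun x ↦
      φ (((x.1.1.1 : ℝ) / (n + 1), (x.1.1.2 : ℝ) / (n + 1)),
        ((x.1.2.1 : ℝ) / (n + 1), (x.1.2.2 : ℝ) / (n + 1))) *
      ((gridRect n x.1.1).toSet ×ˢ (gridRect n x.1.2).toSet).indicator (fun _ ↦ (1 : ℝ)) p)
  rw [h1]
  have hpos : ∀ y : ℝ, 0 < y ↔ 0 < ⌈y * (n + 1)⌉₊ := fun y ↦ by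
    rw [Nat.ceil_pos, mul_pos_iff_of_pos_right hn]
  have hle : ∀ y : ℝ, y ≤ K ↔ ⌈y * (n + 1)⌉₊ ≤ K * (n + 1) := fun y ↦ by
    rw [Nat.ceil_le]; push_cast; rw [mul_le_mul_iff_left₀ hn]
  have hcorner : ∀ y z : ℝ, 0 < y → 0 < z → (gridCorner n y = gridCorner n z ↔
      ⌈y * (n + 1)⌉₊ = ⌈z * (n + 1)⌉₊) := fun y z hy hz ↦ by
    rw [hpos] at hy hz
    rw [gridCorner, gridCorner, div_left_inj' hn.ne', Nat.cast_inj]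
    omega
  split_ifs with h
  · obtain ⟨⟨⟨h1, h2⟩, h3, h4⟩, hne⟩ := h
    have q1 := (hpos _).1 h1.1
    have q2 := (hpos _).1 h2.1
    have q3 := (hpos _).1 h3.1
    have q4 := (hpos _).1 h4.1
    have r1 := (hle _).1 h1.2
    have r2 := (hle _).1 h2.2
    have r3 := (hle _).1 h3.2
    have r4 := (hle _).1 h4.2
    rw [Finset.sum_eq_single ((⌈p.1.1 * (n + 1)⌉₊ - 1, ⌈p.1.2 * (n + 1)⌉₊ - 1),
      (⌈p.2.1 * (n + 1)⌉₊ - 1, ⌈p.2.2 * (n + 1)⌉₊ - 1))]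
    · rw [indicator_of_mem, mul_one]
      · rfl
      · rw [mem_prod, mem_gridRect_iff, mem_gridRect_iff]
        simp only
        omega
    · intro x _ hx
      rw [indicator_of_notMem, mul_zero]
      rw [mem_prod, mem_gridRect_iff, mem_gridRect_iff]
      contrapose! hx
      ext <;> simp only <;> omega
    · intro hx
      exfalso
      apply hx
      rw [gridIndex, Finset.mem_filter]
      simp only [Finset.mem_product, Finset.mem_range]
      refine ⟨by omega, ?_⟩
      rw [ne_eq, Prod.mk.injEq, hcorner _ _ h1.1 h3.1, hcorner _ _ h2.1 h4.1] at hne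
      rw [ne_eq, Prod.mk.injEq]
      omega
  · refine Finset.sum_eq_zero fun x hx ↦ ?_
    rw [indicator_of_notMem, mul_zero]
    rw [mem_prod, mem_gridRect_iff, mem_gridRect_iff]
    rintro ⟨⟨a1, a2⟩, a3, a4⟩
    rw [gridIndex, Finset.mem_filter] at hx
    simp only [Finset.mem_product, Finset.mem_range] at hx
    obtain ⟨hx, hne⟩ := hx
    have q1 : 0 < p.1.1 := (hpos _).2 (by omega)
    have q2 : 0 < p.1.2 := (hpos _).2 (by omega)
    have q3 : 0 < p.2.1 := (hpos _).2 (by omega)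
    have q4 : 0 < p.2.2 := (hpos _).2 (by omega)
    refine h ⟨⟨⟨⟨q1, (hle _).2 (by omega)⟩, q2, (hle _).2 (by omega)⟩,
      ⟨q3, (hle _).2 (by omega)⟩, q4, (hle _).2 (by omega)⟩, ?_⟩
    rw [ne_eq, Prod.mk.injEq, hcorner _ _ q1 q3, hcorner _ _ q2 q4]
    rintro ⟨b1, b2⟩
    apply hne
    ext <;> omega

/-- The quadrant of the plane, squared. -/
def quadrantSq : Set ((ℝ × ℝ) × (ℝ × ℝ)) := (Ici 0 ×ˢ Ici 0) ×ˢ (Ici 0 ×ˢ Ici 0)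

lemma measurableSet_quadrantSq : MeasurableSet quadrantSq :=
  (measurableSet_Ici.prod measurableSet_Ici).prod (measurableSet_Ici.prod measurableSet_Ici)

lemma ae_fst_ne_zero_plane : ∀ᵐ q : ℝ × ℝ, q.1 ≠ 0 :=
  Measure.quasiMeasurePreserving_fst.ae (Measure.ae_ne volume 0)

lemma ae_snd_ne_zero_plane : ∀ᵐ q : ℝ × ℝ, q.2 ≠ 0 :=
  Measure.quasiMeasurePreserving_snd.ae (Measure.ae_ne volume 0)

lemma ae_fst_ne_snd {X : Type*} [MeasureSpace X] [SFinite (volume : Measure X)]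
    [NullSingletonClass (volume : Measure X)] [MeasurableEq X] :
    ∀ᵐ p : X × X, p.1 ≠ p.2 := by
  have hs : MeasurableSet {p : X × X | p.1 = p.2} :=
    measurableSet_eq_fun measurable_fst measurable_snd
  rw [ae_iff]
  simp only [ne_eq, not_not]
  rw [Measure.volume_eq_prod, Measure.measure_prod_null hs]
  refine ae_of_all _ fun x ↦ ?_
  have : Prod.mk x ⁻¹' {p : X × X | p.1 = p.2} = {x} := by
    ext y; simp [eq_comm]
  simp [this]

/-- Omitting the diagonal cells does no harm in the limit: if the two points differ, so do their
corners for large n, and coincident points form a null set. -/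
lemma tendsto_gridKernel_ae {φ : (ℝ × ℝ) × (ℝ × ℝ) → ℝ} (hφ : Continuous φ) {K : ℕ}
    (hK : ∀ p, (K : ℝ) < ‖p‖ → φ p = 0) :
    ∀ᵐ p, Tendsto (fun n ↦ (gridKernel φ n K).toFun p) atTop (𝓝 (quadrantSq.indicator φ p)) := by
  have a1 := Measure.quasiMeasurePreserving_fst (μ := (volume : Measure (ℝ × ℝ)))
    (ν := (volume : Measure (ℝ × ℝ))) |>.ae ae_fst_ne_zero_plane
  have a2 := Measure.quasiMeasurePreserving_fst (μ := (volume : Measure (ℝ × ℝ)))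
    (ν := (volume : Measure (ℝ × ℝ))) |>.ae ae_snd_ne_zero_plane
  have a3 := Measure.quasiMeasurePreserving_snd (μ := (volume : Measure (ℝ × ℝ)))
    (ν := (volume : Measure (ℝ × ℝ))) |>.ae ae_fst_ne_zero_plane
  have a4 := Measure.quasiMeasurePreserving_snd (μ := (volume : Measure (ℝ × ℝ)))
    (ν := (volume : Measure (ℝ × ℝ))) |>.ae ae_snd_ne_zero_plane
  filter_upwards [a1, a2, a3, a4, ae_fst_ne_snd (X := ℝ × ℝ)] with p h1 h2 h3 h4 h5
  by_cases hp : (p.1.1 ∈ Ioc (0 : ℝ) K ∧ p.1.2 ∈ Ioc (0 : ℝ) K) ∧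
          (p.2.1 ∈ Ioc (0 : ℝ) K ∧ p.2.2 ∈ Ioc (0 : ℝ) K)
  · have hq : p ∈ quadrantSq := ⟨⟨hp.1.1.1.le, hp.1.2.1.le⟩, hp.2.1.1.le, hp.2.2.1.le⟩
    rw [indicator_of_mem hq]
    have t1 := (tendsto_gridCorner hp.1.1.1).prodMk_nhds (tendsto_gridCorner hp.1.2.1)
    have t2 := (tendsto_gridCorner hp.2.1.1).prodMk_nhds (tendsto_gridCorner hp.2.2.1)
    refine ((hφ.tendsto p).comp (t1.prodMk_nhds t2)).congr' ?_
    filter_upwards [(t1.prodMk_nhds t2).eventually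
      (isClosed_diagonal.isOpen_compl.mem_nhds (show ((p.1.1, p.1.2), (p.2.1, p.2.2)) ∈ _ from h5))] with n hn
    rw [gridKernel_toFun, if_pos ⟨hp, hn⟩]
    rfl
  · have h0 : quadrantSq.indicator φ p = 0 := by
      rw [indicator_apply_eq_zero]
      intro hq
      apply hK
      by_contra! hle
      apply hp
      have b1 := (norm_fst_le p.1).trans ((norm_fst_le p).trans hle)
      have b2 := (norm_snd_le p.1).trans ((norm_fst_le p).trans hle)
      have b3 := (norm_fst_le p.2).trans ((norm_snd_le p).trans hle)
      have b4 := (norm_snd_le p.2).trans ((norm_snd_le p).trans hle)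
      obtain ⟨⟨q1, q2⟩, q3, q4⟩ := hq
      exact ⟨⟨⟨lt_of_le_of_ne q1 (Ne.symm h1), (le_abs_self _).trans b1⟩,
        lt_of_le_of_ne q2 (Ne.symm h2), (le_abs_self _).trans b2⟩,
        ⟨lt_of_le_of_ne q3 (Ne.symm h3), (le_abs_self _).trans b3⟩,
        lt_of_le_of_ne q4 (Ne.symm h4), (le_abs_self _).trans b4⟩
    rw [h0]
    refine tendsto_const_nhds.congr fun n ↦ ?_
    rw [gridKernel_toFun, if_neg fun h ↦ hp h.1]

lemma tendsto_eLpNorm_gridKernel {φ : (ℝ × ℝ) × (ℝ × ℝ) → ℝ} (hφ : Continuous φ) {K : ℕ}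
    (hK : ∀ p, (K : ℝ) < ‖p‖ → φ p = 0) {M : ℝ} (hM : ∀ p, ‖φ p‖ ≤ M) :
    Tendsto (fun n ↦ eLpNorm (quadrantSq.indicator φ - (gridKernel φ n K).toFun) 2) atTop
      (𝓝 0) := by
  have hM0 : 0 ≤ M := (norm_nonneg _).trans (hM 0)
  set D : Set ((ℝ × ℝ) × (ℝ × ℝ)) := Metric.closedBall 0 K with hD
  -- Domination by the constant (2M)² on a ball outside which both functions vanish.
  have hb : ∀ n p, ‖(quadrantSq.indicator φ - (gridKernel φ n K).toFun) p‖ₑ ^ (2 : ℝ) ≤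
      D.indicator (fun _ ↦ ENNReal.ofReal (M + M) ^ (2 : ℝ)) p := by
    intro n p
    by_cases hp : p ∈ D
    · rw [indicator_of_mem hp]
      gcongr
      rw [← ofReal_norm, Pi.sub_apply]
      refine ENNReal.ofReal_le_ofReal ((norm_sub_le _ _).trans (add_le_add ?_ ?_))
      · exact (norm_indicator_le_norm_self φ p).trans (hM p)
      · rw [gridKernel_toFun]
        split_ifs
        · exact hM _
        · simpa using hM0
    · have hp' : (K : ℝ) < ‖p‖ := by simpa [hD] using hp
      have h0 : (gridKernel φ n K).toFun p = 0 := by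
        rw [gridKernel_toFun, if_neg]
        rintro ⟨⟨⟨q1, q2⟩, q3, q4⟩, -⟩
        refine hp'.not_ge ?_
        refine max_le (max_le ?_ ?_) (max_le ?_ ?_)
        · rw [Real.norm_of_nonneg q1.1.le]; exact q1.2
        · rw [Real.norm_of_nonneg q2.1.le]; exact q2.2
        · rw [Real.norm_of_nonneg q3.1.le]; exact q3.2
        · rw [Real.norm_of_nonneg q4.1.le]; exact q4.2
      have h1 : quadrantSq.indicator φ p = 0 := by
        rw [indicator_apply_eq_zero]; exact fun _ ↦ hK p hp'
      simp [h0, h1]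
  have hfin : ∫⁻ p, D.indicator (fun _ ↦ ENNReal.ofReal (M + M) ^ (2 : ℝ)) p ≠ ∞ := by
    rw [lintegral_indicator_const Metric.isClosed_closedBall.measurableSet]
    exact ENNReal.mul_ne_top (by simp) (isCompact_closedBall _ _).measure_lt_top.ne
  have hlim := tendsto_lintegral_of_dominated_convergence'
    (F := fun n p ↦ ‖(quadrantSq.indicator φ - (gridKernel φ n K).toFun) p‖ₑ ^ (2 : ℝ))
    (f := fun _ ↦ 0) (μ := volume) _ (fun n ↦ ?_) (fun n ↦ ae_of_all _ (hb n)) hfin ?_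
  · rw [lintegral_zero] at hlim
    have := hlim.ennrpow_const (1 / 2)
    rw [ENNReal.zero_rpow_of_pos (by norm_num)] at this
    refine this.congr fun n ↦ ?_
    rw [eLpNorm_eq_lintegral_rpow_enorm_toReal (by simp) (by simp)]
    simp
  · exact ((((hφ.measurable.indicator measurableSet_quadrantSq).aestronglyMeasurable).sub
      (gridKernel φ n K).memLp_toFun.1).enorm.pow_const _)
  · filter_upwards [tendsto_gridKernel_ae hφ hK] with p hp
    have h1 : Tendsto (fun n ↦ quadrantSq.indicator φ p - (gridKernel φ n K).toFun p) atTop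
        (𝓝 0) := by simpa using hp.const_sub (quadrantSq.indicator φ p)
    have h2 := (h1.enorm).ennrpow_const 2
    simpa using h2

/-- Elementary kernels are dense among the square integrable kernels on the quadrant. -/
lemma exists_elemKernel_eLpNorm_sub_lt {g : (ℝ × ℝ) × (ℝ × ℝ) → ℝ} (hg : MemLp g 2)
    (hsupp : ∀ p, p ∉ quadrantSq → g p = 0) {ε : ℝ≥0∞} (hε : 0 < ε) :
    ∃ e : ElemKernel, eLpNorm (g - e.toFun) 2 < ε := by
  obtain ⟨δ, hδ, hδε⟩ := exists_between (ENNReal.half_pos hε.ne')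
  obtain ⟨φ, hφc, hφg, hφ, hφm⟩ := hg.exists_hasCompactSupport_eLpNorm_sub_le (by simp) hδ.ne'
  obtain ⟨M, hM⟩ := hφc.exists_bound_of_continuous hφ
  obtain ⟨R, hR⟩ := hφc.isCompact.isBounded.exists_norm_le
  obtain ⟨K, hRK⟩ := exists_nat_ge R
  have hK : ∀ p, (K : ℝ) < ‖p‖ → φ p = 0 := fun p hp ↦ by
    by_contra h
    exact absurd (hR p (subset_tsupport _ h)) (not_le.2 (hRK.trans_lt hp))
  have ht := tendsto_eLpNorm_gridKernel hφ hK hM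
  obtain ⟨n, hn⟩ := (ht.eventually_lt_const (ENNReal.half_pos hε.ne')).exists
  refine ⟨gridKernel φ n K, ?_⟩
  have h1 : g = quadrantSq.indicator g := by
    ext p
    by_cases hp : p ∈ quadrantSq
    · rw [indicator_of_mem hp]
    · rw [indicator_of_notMem hp, hsupp p hp]
  have hind : MemLp (quadrantSq.indicator φ) 2 := hφm.indicator measurableSet_quadrantSq
  -- Cutting the approximant off to the quadrant does not increase the distance, since `g` lives
  -- there.
  have h2 : eLpNorm (g - quadrantSq.indicator φ) 2 ≤ δ := by
    have : g - quadrantSq.indicator φ = quadrantSq.indicator (g - φ) := by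
      rw [indicator_sub', ← h1]
    rw [this]
    exact (eLpNorm_indicator_le _).trans hφg
  calc eLpNorm (g - (gridKernel φ n K).toFun) 2 volume
      = eLpNorm ((g - quadrantSq.indicator φ) +
          (quadrantSq.indicator φ - (gridKernel φ n K).toFun)) 2 volume := by
        rw [sub_add_sub_cancel]
    _ ≤ eLpNorm (g - quadrantSq.indicator φ) 2 volume +
          eLpNorm (quadrantSq.indicator φ - (gridKernel φ n K).toFun) 2 volume :=
        eLpNorm_add_le (hg.sub hind).1 (hind.sub (gridKernel φ n K).memLp_toFun).1 (by norm_num)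
    _ < ε / 2 + ε / 2 := ENNReal.add_lt_add (h2.trans_lt hδε) hn
    _ = ε := ENNReal.add_halves ε

variable {Ω : Type*} [MeasurableSpace Ω] {P : Measure Ω} {B : ℝ≥0 × ℝ≥0 → Ω → ℝ}

/-- Every square integrable kernel on the quadrant has a double Wiener–Itô integral. -/
lemma exists_isDoubleWiener (hB : IsBrownianSheet B P) {g : (ℝ × ℝ) × (ℝ × ℝ) → ℝ}
    (hg : MemLp g 2) (hsupp : ∀ p, p ∉ quadrantSq → g p = 0) :
    ∃ X, IsDoubleWiener B P g X := by
  -- A summable rate, as the completeness criterion applied below requires. Symmetrization turns δ +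
  -- δ into 4δ, and the constant 5 makes the Cauchy bound strict.
  set δ : ℕ → ℝ≥0∞ := fun n ↦ 2⁻¹ ^ n with hδ
  have hδpos : ∀ n, 0 < δ n := fun n ↦ ENNReal.pow_pos (by simp) n
  have hδtop : ∀ n, δ n ≠ ∞ := fun n ↦ ENNReal.pow_ne_top (by simp)
  have hanti : ∀ {m n}, m ≤ n → δ n ≤ δ m := fun h ↦
    pow_le_pow_right_of_le_one' (by simp) h
  choose e he using fun n ↦ exists_elemKernel_eLpNorm_sub_lt hg hsupp (hδpos n)
  have hcau : ∀ N n m : ℕ, N ≤ n → N ≤ m →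
      eLpNorm ((e n).integral B - (e m).integral B) 2 P < 5 * δ N := by
    intro N n m hn hm
    rw [ElemKernel.eLpNorm_integral_sub hB]
    have hmn := (hg.sub (e m).memLp_toFun)
    have hnn := (hg.sub (e n).memLp_toFun)
    refine (eLpNorm_symm_le ((e n).memLp_toFun.sub (e m).memLp_toFun)).trans_lt ?_
    have h1 : (e n).toFun - (e m).toFun = (g - (e m).toFun) - (g - (e n).toFun) := by abel
    rw [h1]
    calc 2 * eLpNorm ((g - (e m).toFun) - (g - (e n).toFun)) 2 volume
        ≤ 2 * (δ N + δ N) := by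
          gcongr
          exact (eLpNorm_sub_le hmn.1 hnn.1 (by norm_num)).trans
            (add_le_add ((he m).le.trans (hanti hm)) ((he n).le.trans (hanti hn)))
      _ = 4 * δ N := by ring
      _ < 5 * δ N := by
          rw [ENNReal.mul_lt_mul_iff_left (hδpos N).ne' (hδtop N)]
          norm_num
  obtain ⟨X, hX, hlim⟩ := Lp.cauchy_complete_eLpNorm (p := 2) (by norm_num)
    (fun n ↦ (e n).memLp_integral hB) (B := fun n ↦ 5 * δ n) (by
      rw [ENNReal.tsum_mul_left, hδ, ENNReal.tsum_geometric]
      refine ENNReal.mul_ne_top (by simp) ?_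
      simp) hcau
  refine ⟨X, hg, hX, fun ε hε ↦ ?_⟩
  have hδlim : Tendsto δ atTop (𝓝 0) :=
    ENNReal.tendsto_pow_atTop_nhds_zero_of_lt_one (by simp)
  obtain ⟨n, hn1, hn2⟩ := ((hlim.eventually_lt_const hε).and
    (hδlim.eventually_lt_const hε)).exists
  refine ⟨e n, (he n).trans hn2, ?_⟩
  rw [eLpNorm_sub_comm] at hn1
  exact hn1

lemma isDoubleWiener_doubleWiener (hB : IsBrownianSheet B P) {g : (ℝ × ℝ) × (ℝ × ℝ) → ℝ}
    (hg : MemLp g 2) (hsupp : ∀ p, p ∉ quadrantSq → g p = 0) :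
    IsDoubleWiener B P g (doubleWiener B P g) := by
  have h := exists_isDoubleWiener hB hg hsupp
  rw [doubleWiener, dif_pos h]
  exact h.choose_spec

end Density

/-! ### Beta integrals in extended nonnegative form -/

section BetaIntegrals

/-- The power `x ^ e` on `(0, ∞)`, extended by zero. -/
noncomputable def pw (e x : ℝ) : ℝ≥0∞ := if 0 < x then ENNReal.ofReal (x ^ e) else 0

lemma pw_of_pos {e x : ℝ} (hx : 0 < x) : pw e x = ENNReal.ofReal (x ^ e) := if_pos hx

lemma pw_of_nonpos {e x : ℝ} (hx : x ≤ 0) : pw e x = 0 := if_neg hx.not_gt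

/-- Thus `pw 0 (t - x)` is the indicator of x < t. Domains of integration become factors, and every
integral below is a Lebesgue integral over a full space, open to Tonelli and scaling without
integrability conditions. -/
lemma pw_zero_of_pos {x : ℝ} (hx : 0 < x) : pw 0 x = 1 := by simp [pw_of_pos hx]

lemma pw_ne_top {e x : ℝ} : pw e x ≠ ∞ := by
  rw [pw]; split_ifs <;> simp

lemma measurable_pw (e : ℝ) : Measurable (pw e) :=
  Measurable.ite measurableSet_Ioi (by fun_prop) measurable_const

@[fun_prop]
lemma Measurable.pw {X : Type*} [MeasurableSpace X] {e : ℝ} {u : X → ℝ} (hu : Measurable u) :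
    Measurable fun x ↦ pw e (u x) :=
  (measurable_pw e).comp hu

lemma pw_mul_pw (a b x : ℝ) : pw a x * pw b x = pw (a + b) x := by
  rcases le_or_gt x 0 with hx | hx
  · simp [pw_of_nonpos hx]
  · rw [pw_of_pos hx, pw_of_pos hx, pw_of_pos hx, ← ENNReal.ofReal_mul (by positivity),
      Real.rpow_add hx]

lemma pw_const_mul {c : ℝ} (hc : 0 < c) (e x : ℝ) : pw e (c * x) = pw e c * pw e x := by
  rcases le_or_gt x 0 with hx | hx
  · rw [pw_of_nonpos hx, pw_of_nonpos (mul_nonpos_of_nonneg_of_nonpos hc.le hx), mul_zero]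
  · rw [pw_of_pos hx, pw_of_pos hc, pw_of_pos (mul_pos hc hx), ← ENNReal.ofReal_mul (by positivity),
      Real.mul_rpow hc.le hx.le]

lemma pw_one_left (x : ℝ) : pw 1 x = ENNReal.ofReal x := by
  rcases le_or_gt x 0 with hx | hx
  · rw [pw_of_nonpos hx, ENNReal.ofReal_of_nonpos hx]
  · rw [pw_of_pos hx, Real.rpow_one]

lemma toReal_pw {e x : ℝ} (hx : 0 ≤ x) (he : e ≠ 0) : (pw e x).toReal = x ^ e := by
  rcases hx.eq_or_lt with rfl | hx
  · rw [pw_of_nonpos le_rfl, Real.zero_rpow he]; rfl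
  · rw [pw_of_pos hx, ENNReal.toReal_ofReal (by positivity)]

lemma lintegral_eq_mul_lintegral_comp_mul {c : ℝ} (hc : 0 < c) (u : ℝ → ℝ≥0∞)
    (hu : Measurable u) : ∫⁻ y, u y = pw 1 c * ∫⁻ w, u (c * w) := by
  conv_lhs => rw [← Real.smul_map_volume_mul_left hc.ne']
  rw [lintegral_smul_measure, lintegral_map hu (by fun_prop), abs_of_pos hc, pw_one_left,
    smul_eq_mul]

lemma beta_comm (a b : ℝ) : beta a b = beta b a := by
  rw [beta, beta, mul_comm, add_comm]

lemma beta_one_right {a : ℝ} (ha : 0 < a) : beta a 1 = 1 / a := by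
  rw [beta, Real.Gamma_one, Real.Gamma_add_one ha.ne']
  have := (Real.Gamma_pos_of_pos ha).ne'
  field_simp

lemma beta_one_left {a : ℝ} (ha : 0 < a) : beta 1 a = 1 / a := by
  rw [beta_comm, beta_one_right ha]

lemma lintegral_pw_mul_pw_one_sub {a b : ℝ} (ha : 0 < a) (hb : 0 < b) :
    ∫⁻ y, pw (a - 1) y * pw (b - 1) (1 - y) = ENNReal.ofReal (beta a b) := by
  have hpos := beta_pos ha hb
  have h1 : ∀ y, betaPDF a b y =
      ENNReal.ofReal (1 / beta a b) * (pw (a - 1) y * pw (b - 1) (1 - y)) := by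
    intro y
    rcases le_or_gt y 0 with hy | hy
    · rw [betaPDF_eq_zero_of_nonpos hy, pw_of_nonpos hy]; simp
    rcases le_or_gt 1 y with hy' | hy'
    · rw [betaPDF_eq_zero_of_one_le hy', pw_of_nonpos (x := 1 - y) (by linarith)]; simp
    have : 0 < 1 - y := by linarith
    rw [betaPDF_of_pos_lt_one hy hy', pw_of_pos hy, pw_of_pos this,
      ← ENNReal.ofReal_mul (by positivity), ← ENNReal.ofReal_mul (by positivity), mul_assoc]
  have h2 := lintegral_betaPDF_eq_one ha hb
  simp_rw [h1] at h2
  rw [lintegral_const_mul _ (by fun_prop)] at h2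
  have h3 := congrArg (fun z ↦ ENNReal.ofReal (beta a b) * z) h2
  simp only [mul_one] at h3
  rw [← mul_assoc, ← ENNReal.ofReal_mul hpos.le, mul_one_div_cancel hpos.ne', ENNReal.ofReal_one,
    one_mul] at h3
  exact h3

/-- The substitution y = x w reduces to the Beta integral. -/
lemma lintegral_pw_mul_pw_sub {a b : ℝ} (ha : 0 < a) (hb : 0 < b) (x : ℝ) :
    ∫⁻ y, pw (a - 1) y * pw (b - 1) (x - y) = ENNReal.ofReal (beta a b) * pw (a + b - 1) x := by
  rcases le_or_gt x 0 with hx | hx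
  · have : ∀ y, pw (a - 1) y * pw (b - 1) (x - y) = 0 := fun y ↦ by
      rcases le_or_gt y 0 with hy | hy
      · rw [pw_of_nonpos hy, zero_mul]
      · rw [pw_of_nonpos (x := x - y) (by linarith), mul_zero]
    simp [this, pw_of_nonpos hx]
  · rw [lintegral_eq_mul_lintegral_comp_mul hx _ (by fun_prop)]
    have : ∀ w, pw (a - 1) (x * w) * pw (b - 1) (x - x * w) =
        pw (a - 1) x * pw (b - 1) x * (pw (a - 1) w * pw (b - 1) (1 - w)) := fun w ↦ by
      rw [show x - x * w = x * (1 - w) by ring, pw_const_mul hx, pw_const_mul hx]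
      ring
    simp_rw [this]
    rw [lintegral_const_mul _ (by fun_prop), lintegral_pw_mul_pw_one_sub ha hb, pw_mul_pw,
      ← mul_assoc, pw_mul_pw, mul_comm]
    congr 2
    ring

lemma lintegral_pw_mul_pw_zero {a : ℝ} (ha : 0 < a) (t : ℝ) :
    ∫⁻ y, pw (a - 1) y * pw 0 (t - y) = ENNReal.ofReal (1 / a) * pw a t := by
  have := lintegral_pw_mul_pw_sub ha one_pos t
  simpa [beta_one_right ha] using this

/-- The decreasing Möbius map `ψ` sends (0, 1) onto (0, x). After substitution the total exponent of
its denominator x' - x w is 1 - a - 2b = 0, so the variables separate and a Beta integral is left.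
-/
lemma lintegral_moebius_unit {a b x x' : ℝ} (hab : a + 2 * b = 1)
    (hx : 0 < x) (hxx' : x < x') :
    ∫⁻ y, pw (a - 1) y * pw (b - 1) (x - y) * pw (b - 1) (x' - y) =
      pw (-b) x * pw (-b) x' * pw (2 * b - 1) (x' - x) *
        ∫⁻ w, pw (b - 1) w * pw (a - 1) (1 - w) := by
  have hx' : 0 < x' := hx.trans hxx'
  have hd : 0 < x' - x := sub_pos.2 hxx'
  set ψ : ℝ → ℝ := fun w ↦ x * x' * (1 - w) / (x' - x * w) with hψ
  have hD : ∀ w ∈ Ioo (0 : ℝ) 1, 0 < x' - x * w := fun w hw ↦ by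
    have := mul_lt_mul_of_pos_left hw.2 hx; linarith
  have himage : ψ '' Ioo 0 1 = Ioo 0 x := by
    ext y
    constructor
    · rintro ⟨w, hw, rfl⟩
      have h := hD w hw
      have h1 : 0 < 1 - w := by linarith [hw.2]
      refine ⟨by positivity, ?_⟩
      rw [hψ]
      simp only
      rw [div_lt_iff₀ h]
      have := mul_pos (mul_pos hx hw.1) hd
      nlinarith
    · rintro ⟨hy0, hyx⟩
      have h1 : 0 < x' - y := by linarith
      have h2 : 0 < x - y := by linarith
      -- The inverse Möbius map.
      refine ⟨x' * (x - y) / (x * (x' - y)), ⟨by positivity, ?_⟩, ?_⟩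
      · rw [div_lt_one (by positivity)]
        nlinarith
      · simp only [hψ]
        have : x' - x * (x' * (x - y) / (x * (x' - y))) = x' * (x' - x) / (x' - y) := by
          field_simp; ring
        rw [this]
        field_simp
        ring
  have hderiv : ∀ w ∈ Ioo (0 : ℝ) 1,
      HasDerivWithinAt ψ (-(x * x' * (x' - x)) / (x' - x * w) ^ 2) (Ioo 0 1) w := by
    intro w hw
    have h := (hD w hw).ne'
    have h1 : HasDerivAt (fun w ↦ x * x' * (1 - w)) (-(x * x')) w := by
      simpa using ((hasDerivAt_id w).const_sub 1).const_mul (x * x')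
    have h2 : HasDerivAt (fun w ↦ x' - x * w) (-x) w := by
      simpa using ((hasDerivAt_id w).const_mul x).const_sub x'
    refine (h1.div h2 h).hasDerivWithinAt.congr_deriv ?_
    congr 1
    ring
  have hinj : InjOn ψ (Ioo 0 1) := by
    intro w hw v hv h
    have h1 := (hD w hw).ne'
    have h2 := (hD v hv).ne'
    simp only [hψ] at h
    rw [div_eq_div_iff h1 h2] at h
    have h3 : x * x' * (x' - x) * (w - v) = 0 := by linear_combination -h
    rcases mul_eq_zero.1 h3 with h4 | h4
    · exact absurd h4 (by positivity)
    · linarith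
  have hlhs : ∫⁻ y, pw (a - 1) y * pw (b - 1) (x - y) * pw (b - 1) (x' - y) =
      ∫⁻ y in Ioo 0 x, pw (a - 1) y * pw (b - 1) (x - y) * pw (b - 1) (x' - y) := by
    rw [setLIntegral_eq_of_support_subset]
    intro y hy
    by_contra h
    apply hy
    simp only [mem_Ioo, not_and_or, not_lt] at h
    rcases h with h | h
    · simp [pw_of_nonpos h]
    · simp [pw_of_nonpos (x := x - y) (by linarith)]
  have hrhs : ∫⁻ w, pw (b - 1) w * pw (a - 1) (1 - w) =
      ∫⁻ w in Ioo 0 1, pw (b - 1) w * pw (a - 1) (1 - w) := by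
    rw [setLIntegral_eq_of_support_subset]
    intro y hy
    by_contra h
    apply hy
    simp only [mem_Ioo, not_and_or, not_lt] at h
    rcases h with h | h
    · simp [pw_of_nonpos h]
    · simp [pw_of_nonpos (x := 1 - y) (by linarith)]
  rw [hlhs, hrhs, ← himage, lintegral_image_eq_lintegral_abs_deriv_mul measurableSet_Ioo hderiv
    hinj, ← lintegral_const_mul _ (by fun_prop)]
  refine setLIntegral_congr_fun measurableSet_Ioo fun w hw ↦ ?_
  have h := hD w hw
  have hw0 : 0 < w := hw.1
  have hw1 : 0 < 1 - w := by linarith [hw.2]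
  have e1 : x - ψ w = x * w * (x' - x) / (x' - x * w) := by
    simp only [hψ]; field_simp; ring
  have e2 : x' - ψ w = x' * (x' - x) / (x' - x * w) := by
    simp only [hψ]; field_simp; ring
  have hψw : 0 < ψ w := by simp only [hψ]; positivity
  have e3 : |-(x * x' * (x' - x)) / (x' - x * w) ^ 2| = x * x' * (x' - x) / (x' - x * w) ^ 2 := by
    rw [neg_div, abs_neg, abs_of_pos (by positivity)]
  have p1 : 0 < x * w * (x' - x) / (x' - x * w) := by positivity
  have p2 : 0 < x' * (x' - x) / (x' - x * w) := by positivity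
  simp only [e1, e2, e3]
  rw [pw_of_pos hψw, pw_of_pos p1, pw_of_pos p2, pw_of_pos hx, pw_of_pos hx', pw_of_pos hd,
    pw_of_pos hw0, pw_of_pos hw1]
  have hb' : 0 < x * x' * (x' - x) / (x' - x * w) ^ 2 := by positivity
  -- Every factor is positive, so the identity of products of powers is checked as a linear identity
  -- between logarithms.
  have l1 : Real.log (ψ w) = Real.log x + Real.log x' + Real.log (1 - w) -
      Real.log (x' - x * w) := by
    simp only [hψ]
    rw [Real.log_div (by positivity) h.ne', Real.log_mul (by positivity) hw1.ne',
      Real.log_mul hx.ne' hx'.ne']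
  have l2 : Real.log (x * w * (x' - x) / (x' - x * w)) =
      Real.log x + Real.log w + Real.log (x' - x) - Real.log (x' - x * w) := by
    rw [Real.log_div (by positivity) h.ne', Real.log_mul (by positivity) hd.ne',
      Real.log_mul hx.ne' hw0.ne']
  have l3 : Real.log (x' * (x' - x) / (x' - x * w)) =
      Real.log x' + Real.log (x' - x) - Real.log (x' - x * w) := by
    rw [Real.log_div (by positivity) h.ne', Real.log_mul hx'.ne' hd.ne']
  have l4 : x * x' * (x' - x) / (x' - x * w) ^ 2 = Real.exp (Real.log x + Real.log x' +
      Real.log (x' - x) - 2 * Real.log (x' - x * w)) := by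
    rw [← Real.exp_log hb', Real.log_div (by positivity) (by positivity),
      Real.log_mul (by positivity) hd.ne', Real.log_mul hx.ne' hx'.ne', Real.log_pow]
    norm_num
  rw [Real.rpow_def_of_pos hψw, Real.rpow_def_of_pos p1, Real.rpow_def_of_pos p2,
    Real.rpow_def_of_pos hx, Real.rpow_def_of_pos hx', Real.rpow_def_of_pos hd,
    Real.rpow_def_of_pos hw0, Real.rpow_def_of_pos hw1, l1, l2, l3, l4]
  simp only [← ENNReal.ofReal_mul (Real.exp_nonneg _), ← Real.exp_add]
  congr 2
  linear_combination (Real.log x + Real.log x' - Real.log (x' - x * w)) * hab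

lemma lintegral_moebius {a b x x' : ℝ} (ha : 0 < a) (hb : 0 < b) (hab : a + 2 * b = 1)
    (hxx' : x < x') :
    ∫⁻ y, pw (a - 1) y * pw (b - 1) (x - y) * pw (b - 1) (x' - y) =
      ENNReal.ofReal (beta a b) * (pw (-b) x * pw (-b) x' * pw (2 * b - 1) (x' - x)) := by
  rcases le_or_gt x 0 with hx | hx
  · have : ∀ y, pw (a - 1) y * pw (b - 1) (x - y) * pw (b - 1) (x' - y) = 0 := fun y ↦ by
      rcases le_or_gt y 0 with hy | hy
      · simp [pw_of_nonpos hy]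
      · simp [pw_of_nonpos (x := x - y) (by linarith)]
    simp [this, pw_of_nonpos hx]
  · rw [lintegral_moebius_unit hab hx hxx', lintegral_pw_mul_pw_one_sub hb ha, beta_comm, mul_comm]

end BetaIntegrals

/-! ### The Gram matrix of the one-parameter kernels -/

section Gram

/-- The derivative of the fractional kernel, without its constant. -/
noncomputable def phi (α x y : ℝ) : ℝ≥0∞ :=
  pw (α / 2) x * pw (-(α / 2)) y * pw (α / 2 - 1) (x - y)

/-- The Rosenblatt kernel on `[0, t]²`, without its constant. -/
noncomputable def qHat (α t : ℝ) (p : ℝ × ℝ) : ℝ≥0∞ :=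
  ∫⁻ x, pw 0 (t - x) * (phi α x p.1 * phi α x p.2)

/-- The product kernel `(y₁ y₂)^{-α/2}` on `[0, t]²`. -/
noncomputable def hHat (α t : ℝ) (p : ℝ × ℝ) : ℝ≥0∞ :=
  (pw (-(α / 2)) p.1 * pw 0 (t - p.1)) * (pw (-(α / 2)) p.2 * pw 0 (t - p.2))

/-- The restriction of the kernel `gHat` to the triangle `p.2 < p.1`. -/
noncomputable def gHalf (α t : ℝ) (p : ℝ × ℝ) : ℝ≥0∞ :=
  pw (α / 2) p.1 * pw (-(α / 2)) p.2 * pw (α - 1) (p.1 - p.2) * pw 0 (t - p.1)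

/-- The kernel `(y₁ ∨ y₂)^{α/2} (y₁ ∧ y₂)^{-α/2} |y₁ - y₂|^{α-1}` on `[0, t]²`. -/
noncomputable def gHat (α t : ℝ) (p : ℝ × ℝ) : ℝ≥0∞ := gHalf α t p + gHalf α t p.swap

/-- The inner double integral of `C₂`, over the triangle `0 < r < y < x`. -/
noncomputable def tripleInt (α x : ℝ) : ℝ≥0∞ :=
  ∫⁻ y, ∫⁻ r, pw 0 y * pw (-α) r * pw (α / 2 - 1) (x - y) * pw (α / 2 - 1) (x - r) *
    pw (α - 1) (y - r)

@[fun_prop]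
lemma Measurable.phi {X : Type*} [MeasurableSpace X] {α : ℝ} {u v : X → ℝ} (hu : Measurable u)
    (hv : Measurable v) : Measurable fun x ↦ phi α (u x) (v x) := by
  unfold RosenblattSheet.phi; fun_prop

@[fun_prop]
lemma measurable_qHat (α t : ℝ) : Measurable (qHat α t) := by
  unfold qHat
  exact Measurable.lintegral_prod_right' (f := fun z : (ℝ × ℝ) × ℝ ↦
    pw 0 (t - z.2) * (phi α z.2 z.1.1 * phi α z.2 z.1.2)) (by fun_prop)

@[fun_prop]
lemma measurable_hHat (α t : ℝ) : Measurable (hHat α t) := by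
  unfold hHat; fun_prop

@[fun_prop]
lemma measurable_gHalf (α t : ℝ) : Measurable (gHalf α t) := by
  unfold gHalf; fun_prop

@[fun_prop]
lemma measurable_gHat (α t : ℝ) : Measurable (gHat α t) := by
  unfold gHat; fun_prop

lemma hHat_swap (α t : ℝ) (p : ℝ × ℝ) : hHat α t p.swap = hHat α t p := by
  simp only [hHat, Prod.fst_swap, Prod.snd_swap]; ring

lemma gHat_swap (α t : ℝ) (p : ℝ × ℝ) : gHat α t p.swap = gHat α t p := by
  simp only [gHat, Prod.swap_swap]; ring

/-- From y < x < t the constraint y < t follows, so its indicator is redundant. -/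
lemma pw_mul_pw_zero_absorb (t x y e : ℝ) :
    pw 0 (t - x) * pw e (x - y) * pw 0 (t - y) = pw 0 (t - x) * pw e (x - y) := by
  rcases le_or_gt x y with h | h
  · simp [pw_of_nonpos (x := x - y) (by linarith)]
  rcases le_or_gt t x with h' | h'
  · simp [pw_of_nonpos (x := t - x) (by linarith)]
  rw [pw_zero_of_pos (x := t - y) (by linarith), mul_one]

/-- Folds an integral of a symmetric function onto the triangle that carries `S`; it is used with
`gHalf`, and again for the norm of `qHat`. -/
lemma lintegral_mul_add_swap {F S : ℝ × ℝ → ℝ≥0∞} (hF : Measurable F) (hS : Measurable S)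
    (hsymm : ∀ p, F p.swap = F p) :
    ∫⁻ p, F p * (S p + S p.swap) = 2 * ∫⁻ y, ∫⁻ r, F (y, r) * S (y, r) := by
  have h1 : ∫⁻ p : ℝ × ℝ, F p * S p.swap = ∫⁻ p, F p * S p := by
    have := (Measure.measurePreserving_swap (μ := (volume : Measure ℝ))
      (ν := (volume : Measure ℝ))).lintegral_comp (f := fun p ↦ F p * S p) (by fun_prop)
    simp only [hsymm] at this
    exact this
  simp only [mul_add]
  rw [lintegral_add_left (by fun_prop), h1, ← two_mul, Measure.volume_eq_prod,
    lintegral_prod _ (by fun_prop)]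

/-- Tonelli brings the integration over x outside; for fixed x the kernel is then a product in the
two remaining variables. -/
lemma lintegral_qHat_mul (α t : ℝ) {F : ℝ × ℝ → ℝ≥0∞} (hF : Measurable F) :
    ∫⁻ p, qHat α t p * F p = ∫⁻ x, pw 0 (t - x) * ∫⁻ p : ℝ × ℝ,
      phi α x p.1 * phi α x p.2 * F p := by
  have h1 : ∀ p, qHat α t p * F p =
      ∫⁻ x, pw 0 (t - x) * (phi α x p.1 * phi α x p.2 * F p) := fun p ↦ by
    rw [qHat, ← lintegral_mul_const _ (by fun_prop)]
    simp only [mul_assoc]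
  simp_rw [h1]
  rw [lintegral_lintegral_swap (by fun_prop)]
  congr 1 with x
  rw [lintegral_const_mul _ (by fun_prop)]

lemma lintegral_prod_mul_self {u : ℝ → ℝ≥0∞} (hu : Measurable u) :
    ∫⁻ p : ℝ × ℝ, u p.1 * u p.2 = (∫⁻ y, u y) ^ 2 := by
  rw [Measure.volume_eq_prod, lintegral_prod_mul hu.aemeasurable hu.aemeasurable, sq]

/-! ### The six one-parameter inner products. -/

variable {α : ℝ}

lemma lintegral_hHat_mul_hHat (h1 : α < 1) (t : ℝ) :
    ∫⁻ p, hHat α t p * hHat α t p = ENNReal.ofReal (1 / (1 - α)) ^ 2 * pw (2 - 2 * α) t := by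
  have e : ∀ p, hHat α t p * hHat α t p = (pw ((1 - α) - 1) p.1 * pw 0 (t - p.1)) *
      (pw ((1 - α) - 1) p.2 * pw 0 (t - p.2)) := fun p ↦ by
    have h0 : ∀ y, pw ((1 - α) - 1) y * pw 0 (t - y) =
        (pw (-(α / 2)) y * pw (-(α / 2)) y) * (pw 0 (t - y) * pw 0 (t - y)) := fun y ↦ by
      rw [pw_mul_pw, pw_mul_pw]; ring_nf
    rw [h0, h0, hHat]
    ring
  simp_rw [e]
  rw [lintegral_prod_mul_self (u := fun y ↦ pw ((1 - α) - 1) y * pw 0 (t - y)) (by fun_prop),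
    lintegral_pw_mul_pw_zero (by linarith), mul_pow, sq (pw _ _), pw_mul_pw]
  ring_nf

/-- The two halves of `gHat` have disjoint supports, so the cross term is zero. -/
lemma gHat_mul_gHalf (t : ℝ) (p : ℝ × ℝ) :
    gHat α t p * gHalf α t p =
      pw α p.1 * pw 0 (t - p.1) * (pw (-α) p.2 * pw (2 * α - 2) (p.1 - p.2)) := by
  have h0 : gHalf α t p.swap * gHalf α t p = 0 := by
    simp only [gHalf, Prod.fst_swap, Prod.snd_swap]
    rcases le_total p.1 p.2 with h | h
    · simp [pw_of_nonpos (x := p.1 - p.2) (by linarith)]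
    · simp [pw_of_nonpos (x := p.2 - p.1) (by linarith)]
  rw [gHat, add_mul, h0, add_zero, gHalf]
  have e1 : pw α p.1 = pw (α / 2) p.1 * pw (α / 2) p.1 := by rw [pw_mul_pw]; ring_nf
  have e2 : pw (-α) p.2 = pw (-(α / 2)) p.2 * pw (-(α / 2)) p.2 := by rw [pw_mul_pw]; ring_nf
  have e3 : pw (2 * α - 2) (p.1 - p.2) = pw (α - 1) (p.1 - p.2) * pw (α - 1) (p.1 - p.2) := by
    rw [pw_mul_pw]; ring_nf
  have e4 : pw 0 (t - p.1) * pw 0 (t - p.1) = pw 0 (t - p.1) := by rw [pw_mul_pw]; ring_nf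
  rw [e1, e2, e3]
  calc _ = pw (α / 2) p.1 * pw (α / 2) p.1 * (pw 0 (t - p.1) * pw 0 (t - p.1)) *
        (pw (-(α / 2)) p.2 * pw (-(α / 2)) p.2 *
          (pw (α - 1) (p.1 - p.2) * pw (α - 1) (p.1 - p.2))) := by ring
    _ = _ := by rw [e4]

lemma lintegral_gHat_mul_gHat (h0 : 1 / 2 < α) (h1 : α < 1) (t : ℝ) :
    ∫⁻ p, gHat α t p * gHat α t p =
      2 * (ENNReal.ofReal (beta (1 - α) (2 * α - 1)) *
        (ENNReal.ofReal (1 / (2 * α)) * pw (2 * α) t)) := by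
  have := lintegral_mul_add_swap (measurable_gHat α t) (measurable_gHalf α t) (gHat_swap α t)
  change ∫⁻ p, gHat α t p * gHat α t p = _ at this
  rw [this]
  congr 1
  simp_rw [gHat_mul_gHalf]
  have e : ∀ y, ∫⁻ r, pw α y * pw 0 (t - y) * (pw (-α) r * pw (2 * α - 2) (y - r)) =
      ENNReal.ofReal (beta (1 - α) (2 * α - 1)) * (pw (2 * α - 1) y * pw 0 (t - y)) := fun y ↦ by
    rw [lintegral_const_mul _ (by fun_prop)]
    -- The squared singularity has exponent 2α - 2, integrable exactly because α > 1/2.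
    have := lintegral_pw_mul_pw_sub (a := 1 - α) (b := 2 * α - 1) (by linarith) (by linarith) y
    rw [show (1 - α - 1 : ℝ) = -α by ring, show (2 * α - 1 - 1 : ℝ) = 2 * α - 2 by ring,
      show (1 - α + (2 * α - 1) - 1 : ℝ) = α - 1 by ring] at this
    rw [this, show (2 * α - 1 : ℝ) = α + (α - 1) by ring, ← pw_mul_pw]
    ring
  simp_rw [e]
  rw [lintegral_const_mul _ (by fun_prop), lintegral_pw_mul_pw_zero (by linarith)]

lemma lintegral_hHat_mul_gHat (h0 : 1 / 2 < α) (h1 : α < 1) (t : ℝ) :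
    ∫⁻ p, hHat α t p * gHat α t p =
      2 * (ENNReal.ofReal (beta (1 - α) α) * ENNReal.ofReal t) := by
  have := lintegral_mul_add_swap (measurable_hHat α t) (measurable_gHalf α t) (hHat_swap α t)
  change ∫⁻ p, hHat α t p * gHat α t p = _ at this
  rw [this]
  congr 1
  have e0 : ∀ y r, hHat α t (y, r) * gHalf α t (y, r) =
      (pw 0 y * pw 0 (t - y)) * (pw ((1 - α) - 1) r * pw (α - 1) (y - r)) := fun y r ↦ by
    have a1 := pw_mul_pw_zero_absorb t y r (α - 1)
    have a2 : pw 0 y = pw (-(α / 2)) y * pw (α / 2) y := by rw [pw_mul_pw]; ring_nf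
    have a3 : pw ((1 - α) - 1) r = pw (-(α / 2)) r * pw (-(α / 2)) r := by
      rw [pw_mul_pw]; ring_nf
    have a4 : pw 0 (t - y) * pw 0 (t - y) = pw 0 (t - y) := by rw [pw_mul_pw]; ring_nf
    simp only [hHat, gHalf]
    rw [a2, a3]
    calc _ = pw (-(α / 2)) y * pw (α / 2) y * (pw (-(α / 2)) r * pw (-(α / 2)) r) *
          (pw 0 (t - y) * (pw 0 (t - y) * pw (α - 1) (y - r) * pw 0 (t - r))) := by ring
      _ = pw (-(α / 2)) y * pw (α / 2) y * (pw (-(α / 2)) r * pw (-(α / 2)) r) *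
          ((pw 0 (t - y) * pw 0 (t - y)) * pw (α - 1) (y - r)) := by rw [a1]; ring
      _ = _ := by rw [a4]; ring
  have e : ∀ y, ∫⁻ r, hHat α t (y, r) * gHalf α t (y, r) =
      ENNReal.ofReal (beta (1 - α) α) * (pw (1 - 1) y * pw 0 (t - y)) := fun y ↦ by
    simp_rw [e0]
    rw [lintegral_const_mul _ (by fun_prop),
      lintegral_pw_mul_pw_sub (a := 1 - α) (b := α) (by linarith) (by linarith) y]
    have : pw (1 - 1) y = pw 0 y * pw (1 - α + α - 1) y := by rw [pw_mul_pw]; ring_nf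
    rw [this]
    ring
  simp_rw [e]
  rw [lintegral_const_mul _ (by fun_prop), lintegral_pw_mul_pw_zero one_pos, pw_one_left]
  simp

lemma lintegral_qHat_mul_hHat (h0 : 1 / 2 < α) (h1 : α < 1) (t : ℝ) :
    ∫⁻ p, qHat α t p * hHat α t p =
      ENNReal.ofReal (beta (1 - α) (α / 2)) ^ 2 * ENNReal.ofReal t := by
  rw [lintegral_qHat_mul α t (measurable_hHat α t)]
  have e : ∀ x, pw 0 (t - x) * ∫⁻ p : ℝ × ℝ, phi α x p.1 * phi α x p.2 * hHat α t p =
      ENNReal.ofReal (beta (1 - α) (α / 2)) ^ 2 * (pw (1 - 1) x * pw 0 (t - x)) := fun x ↦ by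
    have e1 : ∀ p : ℝ × ℝ, pw 0 (t - x) * (phi α x p.1 * phi α x p.2 * hHat α t p) =
        pw 0 (t - x) * ((pw (α / 2) x * (pw ((1 - α) - 1) p.1 * pw (α / 2 - 1) (x - p.1))) *
          (pw (α / 2) x * (pw ((1 - α) - 1) p.2 * pw (α / 2 - 1) (x - p.2)))) := fun p ↦ by
      have a1 := pw_mul_pw_zero_absorb t x p.1 (α / 2 - 1)
      have a2 := pw_mul_pw_zero_absorb t x p.2 (α / 2 - 1)
      have a3 : ∀ r, pw ((1 - α) - 1) r = pw (-(α / 2)) r * pw (-(α / 2)) r := fun r ↦ by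
        rw [pw_mul_pw]; ring_nf
      simp only [phi, hHat, a3]
      calc _ = pw (α / 2) x * pw (α / 2) x * (pw (-(α / 2)) p.1 * pw (-(α / 2)) p.1) *
            (pw (-(α / 2)) p.2 * pw (-(α / 2)) p.2) *
            ((pw 0 (t - x) * pw (α / 2 - 1) (x - p.1) * pw 0 (t - p.1)) *
              (pw (α / 2 - 1) (x - p.2) * pw 0 (t - p.2))) := by ring
        _ = pw (α / 2) x * pw (α / 2) x * (pw (-(α / 2)) p.1 * pw (-(α / 2)) p.1) *
            (pw (-(α / 2)) p.2 * pw (-(α / 2)) p.2) * pw (α / 2 - 1) (x - p.1) *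
            (pw 0 (t - x) * pw (α / 2 - 1) (x - p.2) * pw 0 (t - p.2)) := by rw [a1]; ring
        _ = _ := by rw [a2]; ring
    rw [← lintegral_const_mul _ (by fun_prop)]
    simp_rw [e1]
    rw [lintegral_const_mul _ (by fun_prop), lintegral_prod_mul_self
      (u := fun y ↦ pw (α / 2) x * (pw ((1 - α) - 1) y * pw (α / 2 - 1) (x - y))) (by fun_prop),
      lintegral_const_mul _ (by fun_prop), lintegral_pw_mul_pw_sub (by linarith) (by linarith)]
    have : pw (1 - 1) x = (pw (α / 2) x * pw (1 - α + α / 2 - 1) x) ^ 2 := by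
      rw [pw_mul_pw, sq, pw_mul_pw]; ring_nf
    rw [this]
    ring
  simp_rw [e]
  rw [lintegral_const_mul _ (by fun_prop), lintegral_pw_mul_pw_zero one_pos, pw_one_left]
  simp

lemma measurable_lintegral_triple (α x : ℝ) : Measurable fun y ↦ ∫⁻ r, pw 0 y * pw (-α) r *
    pw (α / 2 - 1) (x - y) * pw (α / 2 - 1) (x - r) * pw (α - 1) (y - r) :=
  Measurable.lintegral_prod_right' (f := fun z : ℝ × ℝ ↦ pw 0 z.1 * pw (-α) z.2 *
    pw (α / 2 - 1) (x - z.1) * pw (α / 2 - 1) (x - z.2) * pw (α - 1) (z.1 - z.2)) (by fun_prop)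

/-- Homogeneity: scaling both variables by x gives the exponent 2 - α + 2(α/2 - 1) + (α - 1) = α -
1. -/
lemma tripleInt_eq {x : ℝ} (hx : 0 < x) : tripleInt α x = pw (α - 1) x * tripleInt α 1 := by
  unfold tripleInt
  rw [lintegral_eq_mul_lintegral_comp_mul hx _ (measurable_lintegral_triple α x)]
  have e : ∀ w, ∫⁻ r, pw 0 (x * w) * pw (-α) r * pw (α / 2 - 1) (x - x * w) *
      pw (α / 2 - 1) (x - r) * pw (α - 1) (x * w - r) =
      (pw 1 x * (pw 0 x * pw (-α) x * pw (α / 2 - 1) x * pw (α / 2 - 1) x * pw (α - 1) x)) *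
      ∫⁻ v, pw 0 w * pw (-α) v * pw (α / 2 - 1) (1 - w) * pw (α / 2 - 1) (1 - v) *
        pw (α - 1) (w - v) := fun w ↦ by
    rw [lintegral_eq_mul_lintegral_comp_mul hx _ (by fun_prop),
      ← lintegral_const_mul _ (by fun_prop), ← lintegral_const_mul _ (by fun_prop)]
    refine lintegral_congr fun v ↦ ?_
    rw [show x - x * w = x * (1 - w) by ring, show x - x * v = x * (1 - v) by ring,
      show x * w - x * v = x * (w - v) by ring]
    simp only [pw_const_mul hx]
    ring
  simp_rw [e]
  rw [lintegral_const_mul _ (measurable_lintegral_triple α 1), ← mul_assoc]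
  congr 1
  simp only [pw_mul_pw]
  ring_nf

lemma lintegral_qHat_mul_gHat (h0 : 1 / 2 < α) (t : ℝ) :
    ∫⁻ p, qHat α t p * gHat α t p =
      2 * (tripleInt α 1 * (ENNReal.ofReal (1 / (2 * α)) * pw (2 * α) t)) := by
  rw [lintegral_qHat_mul α t (measurable_gHat α t)]
  have e : ∀ x, pw 0 (t - x) * ∫⁻ p : ℝ × ℝ, phi α x p.1 * phi α x p.2 * gHat α t p =
      2 * tripleInt α 1 * (pw (2 * α - 1) x * pw 0 (t - x)) := fun x ↦ by
    rcases le_or_gt x 0 with hx | hx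
    · simp [phi, pw_of_nonpos hx]
    have := lintegral_mul_add_swap (F := fun p ↦ phi α x p.1 * phi α x p.2) (by fun_prop)
      (measurable_gHalf α t) (fun p ↦ by simp [mul_comm])
    change ∫⁻ p : ℝ × ℝ, phi α x p.1 * phi α x p.2 * gHat α t p = _ at this
    rw [this]
    have e1 : ∀ y r, pw 0 (t - x) * (phi α x y * phi α x r * gHalf α t (y, r)) =
        (pw 0 (t - x) * pw α x) * (pw 0 y * pw (-α) r * pw (α / 2 - 1) (x - y) *
          pw (α / 2 - 1) (x - r) * pw (α - 1) (y - r)) := fun y r ↦ by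
      have a1 := pw_mul_pw_zero_absorb t x y (α / 2 - 1)
      have a2 : pw 0 y = pw (-(α / 2)) y * pw (α / 2) y := by rw [pw_mul_pw]; ring_nf
      have a3 : pw (-α) r = pw (-(α / 2)) r * pw (-(α / 2)) r := by rw [pw_mul_pw]; ring_nf
      have a4 : pw α x = pw (α / 2) x * pw (α / 2) x := by rw [pw_mul_pw]; ring_nf
      simp only [phi, gHalf, a2, a3, a4]
      calc _ = pw (α / 2) x * pw (α / 2) x * (pw (-(α / 2)) y * pw (α / 2) y) *
            (pw (-(α / 2)) r * pw (-(α / 2)) r) * pw (α / 2 - 1) (x - r) * pw (α - 1) (y - r) *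
            (pw 0 (t - x) * pw (α / 2 - 1) (x - y) * pw 0 (t - y)) := by ring
        _ = _ := by rw [a1]; ring
    have e2 : pw 0 (t - x) * ∫⁻ y, ∫⁻ r, phi α x y * phi α x r * gHalf α t (y, r) =
        pw 0 (t - x) * pw α x * tripleInt α x := by
      have hm : Measurable fun y ↦ ∫⁻ r, phi α x y * phi α x r * gHalf α t (y, r) :=
        Measurable.lintegral_prod_right' (f := fun z : ℝ × ℝ ↦
          phi α x z.1 * phi α x z.2 * gHalf α t z) (by fun_prop)
      rw [← lintegral_const_mul _ hm, tripleInt,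
        ← lintegral_const_mul _ (measurable_lintegral_triple α x)]
      congr 1 with y
      rw [← lintegral_const_mul _ (by fun_prop), ← lintegral_const_mul _ (by fun_prop)]
      simp_rw [e1]
    calc _ = 2 * (pw 0 (t - x) *
          ∫⁻ y, ∫⁻ r, phi α x y * phi α x r * gHalf α t (y, r)) := by ring
      _ = _ := by
        rw [e2, tripleInt_eq hx, show (2 * α - 1 : ℝ) = α + (α - 1) by ring, ← pw_mul_pw]
        ring
  simp_rw [e]
  rw [lintegral_const_mul _ (by fun_prop), lintegral_pw_mul_pw_zero (by linarith)]
  ring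

/-- The covariance density of fractional Brownian motion of index (α + 1)/2, up to a constant. The
Möbius integral applies because (1 - α) + 2(α/2) = 1, and the prefactors cancel its powers of x and
x'. -/
lemma lintegral_phi_mul_phi_of_lt (h0 : 0 < α) (h1 : α < 1) {x x' : ℝ} (h : x < x') :
    ∫⁻ y, phi α x y * phi α x' y =
      ENNReal.ofReal (beta (1 - α) (α / 2)) * (pw 0 x * pw (α - 1) (x' - x)) := by
  have e : ∀ y, phi α x y * phi α x' y = (pw (α / 2) x * pw (α / 2) x') *
      (pw ((1 - α) - 1) y * pw (α / 2 - 1) (x - y) * pw (α / 2 - 1) (x' - y)) := fun y ↦ by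
    have a3 : pw ((1 - α) - 1) y = pw (-(α / 2)) y * pw (-(α / 2)) y := by
      rw [pw_mul_pw]; ring_nf
    rw [a3, phi, phi]; ring
  simp_rw [e]
  rw [lintegral_const_mul _ (by fun_prop),
    lintegral_moebius (a := 1 - α) (b := α / 2) (by linarith) (by linarith) (by ring) h]
  rcases le_or_gt x 0 with hx | hx
  · simp [pw_of_nonpos hx]
  have hx' := hx.trans h
  have a1 : pw (α / 2) x * pw (-(α / 2)) x = pw 0 x := by rw [pw_mul_pw]; ring_nf
  have a2 : pw (α / 2) x' * pw (-(α / 2)) x' = 1 := by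
    rw [pw_mul_pw, add_neg_cancel, pw_zero_of_pos hx']
  calc _ = ENNReal.ofReal (beta (1 - α) (α / 2)) * ((pw (α / 2) x * pw (-(α / 2)) x) *
        (pw (α / 2) x' * pw (-(α / 2)) x') * pw (2 * (α / 2) - 1) (x' - x)) := by ring
    _ = _ := by rw [a1, a2, mul_one]; ring_nf

lemma sq_lintegral_phi_mul_phi (h0 : 0 < α) (h1 : α < 1) {x x' : ℝ} (h : x ≠ x') :
    (∫⁻ y, phi α x y * phi α x' y) ^ 2 = ENNReal.ofReal (beta (1 - α) (α / 2)) ^ 2 *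
      (pw 0 x' * pw (2 * α - 2) (x - x') + pw 0 x * pw (2 * α - 2) (x' - x)) := by
  have hs : ∀ u v : ℝ, (pw 0 u * pw (α - 1) v) ^ 2 = pw 0 u * pw (2 * α - 2) v := fun u v ↦ by
    rw [mul_pow, sq, sq, pw_mul_pw, pw_mul_pw]; ring_nf
  rcases h.lt_or_gt with h | h
  · rw [lintegral_phi_mul_phi_of_lt h0 h1 h, pw_of_nonpos (x := x - x') (by linarith), mul_pow, hs]
    simp
  · simp_rw [mul_comm (phi α x _)]
    rw [lintegral_phi_mul_phi_of_lt h0 h1 h, pw_of_nonpos (x := x' - x) (by linarith), mul_pow, hs]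
    simp

/-- Writing both kernels as integrals over x and x' turns the integral over the plane into the
square of ∫ φ(x, y) φ(x', y) dy. What remains is the integral of |x - x'|^(2α-2) over [0, t]². -/
lemma lintegral_qHat_mul_qHat (h0 : 1 / 2 < α) (h1 : α < 1) (t : ℝ) :
    ∫⁻ p, qHat α t p * qHat α t p = ENNReal.ofReal (beta (1 - α) (α / 2)) ^ 2 *
      (2 * (ENNReal.ofReal (1 / (2 * α - 1)) * (ENNReal.ofReal (1 / (2 * α)) * pw (2 * α) t))) := by
  rw [lintegral_qHat_mul α t (measurable_qHat α t)]
  have e1 : ∀ x, ∫⁻ p : ℝ × ℝ, phi α x p.1 * phi α x p.2 * qHat α t p =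
      ∫⁻ x', pw 0 (t - x') * (∫⁻ y, phi α x y * phi α x' y) ^ 2 := fun x ↦ by
    simp_rw [mul_comm _ (qHat α t _)]
    rw [lintegral_qHat_mul α t (by fun_prop)]
    congr 1 with x'
    congr 1
    rw [← lintegral_prod_mul_self (u := fun y ↦ phi α x y * phi α x' y) (by fun_prop)]
    congr 1 with p
    ring
  simp_rw [e1]
  have e2 : ∀ x, ∫⁻ x', pw 0 (t - x') * (∫⁻ y, phi α x y * phi α x' y) ^ 2 =
      ENNReal.ofReal (beta (1 - α) (α / 2)) ^ 2 * ∫⁻ x', pw 0 (t - x') *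
        (pw 0 x' * pw (2 * α - 2) (x - x') + pw 0 x * pw (2 * α - 2) (x' - x)) := fun x ↦ by
    rw [← lintegral_const_mul _ (by fun_prop)]
    refine lintegral_congr_ae ?_
    -- The formula for the squared inner integral is available off the null set x' = x.
    filter_upwards [Measure.ae_ne volume x] with x' hx'
    rw [sq_lintegral_phi_mul_phi (by linarith) h1 hx'.symm]
    ring
  simp_rw [e2]
  have e3 : ∀ x, pw 0 (t - x) * (ENNReal.ofReal (beta (1 - α) (α / 2)) ^ 2 * ∫⁻ x', pw 0 (t - x') *
        (pw 0 x' * pw (2 * α - 2) (x - x') + pw 0 x * pw (2 * α - 2) (x' - x))) =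
      ENNReal.ofReal (beta (1 - α) (α / 2)) ^ 2 * ∫⁻ x', (pw 0 (t - x) * pw 0 (t - x')) *
        (pw 0 x' * pw (2 * α - 2) (x - x') + pw 0 x * pw (2 * α - 2) (x' - x)) := fun x ↦ by
    rw [mul_left_comm, ← lintegral_const_mul _ (by fun_prop)]
    simp only [mul_assoc]
  simp_rw [e3]
  have hm : Measurable fun z : ℝ × ℝ ↦ (pw 0 (t - z.1) * pw 0 (t - z.2)) *
      (pw 0 z.2 * pw (2 * α - 2) (z.1 - z.2) + pw 0 z.1 * pw (2 * α - 2) (z.2 - z.1)) := by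
    fun_prop
  rw [lintegral_const_mul _ hm.lintegral_prod_right']
  congr 1
  have := lintegral_mul_add_swap (F := fun z ↦ pw 0 (t - z.1) * pw 0 (t - z.2))
    (S := fun z ↦ pw 0 z.2 * pw (2 * α - 2) (z.1 - z.2)) (by fun_prop) (by fun_prop)
    (fun z ↦ by simp [mul_comm])
  simp only [Prod.fst_swap, Prod.snd_swap] at this
  rw [← lintegral_prod _ hm.aemeasurable, ← Measure.volume_eq_prod, this]
  congr 1
  have e4 : ∀ y, ∫⁻ r, pw 0 (t - y) * pw 0 (t - r) * (pw 0 r * pw (2 * α - 2) (y - r)) =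
      ENNReal.ofReal (1 / (2 * α - 1)) * (pw (2 * α - 1) y * pw 0 (t - y)) := fun y ↦ by
    have e5 : ∀ r, pw 0 (t - y) * pw 0 (t - r) * (pw 0 r * pw (2 * α - 2) (y - r)) =
        pw 0 (t - y) * (pw (1 - 1) r * pw (2 * α - 1 - 1) (y - r)) := fun r ↦ by
      have a1 := pw_mul_pw_zero_absorb t y r (2 * α - 2)
      rw [show (1 - 1 : ℝ) = 0 by ring, show (2 * α - 1 - 1 : ℝ) = 2 * α - 2 by ring]
      calc _ = pw 0 r * (pw 0 (t - y) * pw (2 * α - 2) (y - r) * pw 0 (t - r)) := by ring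
        _ = _ := by rw [a1]; ring
    simp_rw [e5]
    rw [lintegral_const_mul _ (by fun_prop), lintegral_pw_mul_pw_sub one_pos (by linarith),
      beta_one_left (by linarith), show (1 + (2 * α - 1) - 1 : ℝ) = 2 * α - 1 by ring]
    ring
  simp_rw [e4]
  rw [lintegral_const_mul _ (by fun_prop), lintegral_pw_mul_pw_zero (by linarith)]

end Gram

/-! ### The real kernels -/

section RealKernels

lemma memLp_toReal_of_lintegral_mul_self {X : Type*} [MeasurableSpace X] {μ : Measure X}
    {u : X → ℝ≥0∞} (hu : Measurable u) (h : ∫⁻ x, u x * u x ∂μ ≠ ∞) :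
    MemLp (fun x ↦ (u x).toReal) 2 μ := by
  rw [memLp_two_iff_integrable_sq hu.ennreal_toReal.aestronglyMeasurable]
  have := integrable_toReal_of_lintegral_ne_top (hu.mul hu).aemeasurable h
  simpa only [Pi.mul_apply, ENNReal.toReal_mul, sq] using this

lemma integral_toReal_mul_toReal {X : Type*} [MeasurableSpace X] {μ : Measure X}
    {u v : X → ℝ≥0∞} (hu : Measurable u) (hv : Measurable v) (hu2 : ∫⁻ x, u x * u x ∂μ ≠ ∞)
    (hv2 : ∫⁻ x, v x * v x ∂μ ≠ ∞) :
    ∫ x, (u x).toReal * (v x).toReal ∂μ = (∫⁻ x, u x * v x ∂μ).toReal := by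
  simp_rw [← ENNReal.toReal_mul]
  rw [integral_toReal (f := fun x ↦ u x * v x) (hu.mul hv).aemeasurable]
  filter_upwards [ae_lt_top (hu.mul hu) hu2, ae_lt_top (hv.mul hv) hv2] with x h1 h2
  simp only [Pi.mul_apply] at h1 h2
  refine ENNReal.mul_lt_top ?_ ?_
  · by_contra h; simp only [not_lt, top_le_iff] at h; simp [h] at h1
  · by_contra h; simp only [not_lt, top_le_iff] at h; simp [h] at h2

lemma lintegral_mul_ne_top {X : Type*} [MeasurableSpace X] {μ : Measure X}
    {u v : X → ℝ≥0∞} (hu : Measurable u) (hu2 : ∫⁻ x, u x * u x ∂μ ≠ ∞)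
    (hv2 : ∫⁻ x, v x * v x ∂μ ≠ ∞) : ∫⁻ x, u x * v x ∂μ ≠ ∞ := by
  have h : ∫⁻ x, u x * v x ∂μ ≤ ∫⁻ x, u x * u x + v x * v x ∂μ := by
    refine lintegral_mono fun x ↦ ?_
    rcases le_total (u x) (v x) with h | h
    · exact (mul_le_mul_left h _).trans le_add_self
    · exact (mul_le_mul_right h _).trans le_self_add
  rw [lintegral_add_left (f := fun x ↦ u x * u x) (hu.mul hu)] at h
  exact ne_top_of_le_ne_top (ENNReal.add_ne_top.2 ⟨hu2, hv2⟩) h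

lemma setLIntegral_Ioo_eq_lintegral {a b : ℝ} {u : ℝ → ℝ≥0∞} (hu : ∀ x, x ≤ a → u x = 0)
    (hu' : ∀ x, b ≤ x → u x = 0) : ∫⁻ x in Ioo a b, u x = ∫⁻ x, u x := by
  refine setLIntegral_eq_of_support_subset fun x hx ↦ ⟨?_, ?_⟩
  · by_contra! h; exact hx (hu x h)
  · by_contra! h; exact hx (hu' x h)

/-- The constant of the Rosenblatt kernel. -/
noncomputable def qConst (α : ℝ) : ℝ := dConst α * cConst ((α + 1) / 2) ^ 2

/-- The real Rosenblatt kernel on `[0, t]²`. -/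
noncomputable def qReal (α t : ℝ) (p : ℝ × ℝ) : ℝ := qConst α * (qHat α t p).toReal

/-- The real product kernel on `[0, t]²`. -/
noncomputable def hReal (α t : ℝ) (p : ℝ × ℝ) : ℝ := (hHat α t p).toReal

/-- The real singular kernel on `[0, t]²`. -/
noncomputable def gReal (α t : ℝ) (p : ℝ × ℝ) : ℝ := (gHat α t p).toReal

variable {α : ℝ}

lemma lintegral_qHat_mul_qHat_ne_top (h0 : 1 / 2 < α) (h1 : α < 1) (t : ℝ) :
    ∫⁻ p, qHat α t p * qHat α t p ≠ ∞ := by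
  rw [lintegral_qHat_mul_qHat h0 h1]
  simp [ENNReal.mul_eq_top, pw_ne_top]

lemma lintegral_hHat_mul_hHat_ne_top (h1 : α < 1) (t : ℝ) :
    ∫⁻ p, hHat α t p * hHat α t p ≠ ∞ := by
  rw [lintegral_hHat_mul_hHat h1]
  simp [ENNReal.mul_eq_top, pw_ne_top]

lemma lintegral_gHat_mul_gHat_ne_top (h0 : 1 / 2 < α) (h1 : α < 1) (t : ℝ) :
    ∫⁻ p, gHat α t p * gHat α t p ≠ ∞ := by
  rw [lintegral_gHat_mul_gHat h0 h1]
  simp [ENNReal.mul_eq_top, pw_ne_top]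

lemma memLp_qReal (h0 : 1 / 2 < α) (h1 : α < 1) (t : ℝ) : MemLp (qReal α t) 2 :=
  (memLp_toReal_of_lintegral_mul_self (measurable_qHat α t)
    (lintegral_qHat_mul_qHat_ne_top h0 h1 t)).const_mul _

lemma memLp_hReal (h1 : α < 1) (t : ℝ) : MemLp (hReal α t) 2 :=
  memLp_toReal_of_lintegral_mul_self (measurable_hHat α t) (lintegral_hHat_mul_hHat_ne_top h1 t)

lemma memLp_gReal (h0 : 1 / 2 < α) (h1 : α < 1) (t : ℝ) : MemLp (gReal α t) 2 :=
  memLp_toReal_of_lintegral_mul_self (measurable_gHat α t)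
    (lintegral_gHat_mul_gHat_ne_top h0 h1 t)

/-- No direct estimate is needed: an infinite value would make the inner product of the square
integrable kernels `qHat` and `gHat` infinite. -/
lemma tripleInt_one_ne_top (h0 : 1 / 2 < α) (h1 : α < 1) : tripleInt α 1 ≠ ∞ := by
  intro h
  have h2 := lintegral_mul_ne_top (measurable_qHat α 1) (lintegral_qHat_mul_qHat_ne_top h0 h1 1)
    (lintegral_gHat_mul_gHat_ne_top h0 h1 1)
  rw [lintegral_qHat_mul_gHat h0, h, pw_of_pos one_pos] at h2
  have h3 : ENNReal.ofReal (1 / (2 * α)) ≠ 0 := by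
    rw [ne_eq, ENNReal.ofReal_eq_zero, not_le]; positivity
  simp only [Real.one_rpow, ENNReal.ofReal_one, mul_one] at h2
  rw [ENNReal.top_mul h3] at h2
  simp at h2

lemma integral_pw_triple {s : ℝ} (hs0 : 0 < s) (hs1 : s < 1) :
    ∫ r in (0 : ℝ)..s, r ^ (-α) * (1 - s) ^ (α / 2 - 1) * (1 - r) ^ (α / 2 - 1) *
      (s - r) ^ (α - 1) =
    (∫⁻ r, pw 0 s * pw (-α) r * pw (α / 2 - 1) (1 - s) * pw (α / 2 - 1) (1 - r) *
      pw (α - 1) (s - r)).toReal := by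
  have hs : 0 < 1 - s := by linarith
  rw [intervalIntegral.integral_of_le hs0.le, integral_Ioc_eq_integral_Ioo,
    integral_eq_lintegral_of_nonneg_ae]
  · congr 1
    refine Eq.trans ?_ (setLIntegral_Ioo_eq_lintegral (a := 0) (b := s)
      (fun r hr ↦ by simp [pw_of_nonpos hr])
      (fun r hr ↦ by simp [pw_of_nonpos (x := s - r) (by linarith)]))
    refine setLIntegral_congr_fun measurableSet_Ioo fun r hr ↦ ?_
    have h1 : 0 < 1 - r := by linarith [hr.2]
    have h2 : 0 < s - r := by linarith [hr.2]
    have h3 : 0 < r := hr.1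
    rw [pw_zero_of_pos hs0, pw_of_pos h3, pw_of_pos hs, pw_of_pos h1, pw_of_pos h2, one_mul,
      ← ENNReal.ofReal_mul (by positivity), ← ENNReal.ofReal_mul (by positivity),
      ← ENNReal.ofReal_mul (by positivity)]
  · refine (ae_restrict_iff' measurableSet_Ioo).2 (ae_of_all _ fun r hr ↦ ?_)
    have h1 : 0 < 1 - r := by linarith [hr.2]
    have h2 : 0 < s - r := by linarith [hr.2]
    have h3 : 0 < r := hr.1
    simp only [Pi.zero_apply]
    positivity
  · exact Measurable.aestronglyMeasurable (by fun_prop)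

lemma C₂_eq (h0 : 1 / 2 < α) (h1 : α < 1) : C₂ α = qConst α * (tripleInt α 1).toReal := by
  rw [C₂, qConst]
  congr 1
  rw [intervalIntegral.integral_of_le zero_le_one, integral_Ioc_eq_integral_Ioo,
    setIntegral_congr_fun measurableSet_Ioo fun s hs ↦ integral_pw_triple hs.1 hs.2,
    integral_toReal (measurable_lintegral_triple α 1).aemeasurable]
  · congr 1
    exact setLIntegral_Ioo_eq_lintegral (fun y hy ↦ by simp [pw_of_nonpos hy])
      (fun y hy ↦ by simp [pw_of_nonpos (x := 1 - y) (by linarith)])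
  · exact ae_restrict_of_ae (ae_lt_top (measurable_lintegral_triple α 1)
      (tripleInt_one_ne_top h0 h1))

/-- The constants d and c are normalized so that ‖Q‖² = t^(2α)/2; this produces the leading 1 in
`aCoef`. -/
lemma qConst_sq_mul (h0 : 1 / 2 < α) (h1 : α < 1) :
    qConst α ^ 2 * beta (1 - α) (α / 2) ^ 2 = α * (2 * α - 1) / 2 := by
  have hb := beta_pos (show 0 < 1 - α by linarith) (show 0 < α / 2 by linarith)
  have hα : 0 < α := by linarith
  have hα2 : 0 < 2 * α - 1 := by linarith
  have hc : cConst ((α + 1) / 2) ^ 2 = (α + 1) / 2 * α / beta (1 - α) (α / 2) := by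
    rw [cConst, show 2 - 2 * ((α + 1) / 2) = 1 - α by ring,
      show (α + 1) / 2 - 1 / 2 = α / 2 by ring, show 2 * ((α + 1) / 2) - 1 = α by ring,
      Real.sq_sqrt (by positivity)]
  have hd : dConst α ^ 2 = 1 / (α + 1) ^ 2 * (2 * (2 * α - 1) / α) := by
    rw [dConst, mul_pow, Real.sq_sqrt (by positivity), div_pow, one_pow]
  rw [qConst, mul_pow, hd, hc]
  field_simp

/-! ### Values of the inner products for the real kernels. -/

variable {t : ℝ}

lemma integral_qReal_mul_qReal (h0 : 1 / 2 < α) (h1 : α < 1) (ht : 0 ≤ t) :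
    ∫ p, qReal α t p * qReal α t p = t ^ (2 * α) / 2 := by
  have hb := beta_pos (show 0 < 1 - α by linarith) (show 0 < α / 2 by linarith)
  have hα2 : 0 < 2 * α - 1 := by linarith
  have hα : 0 < α := by linarith
  have e : ∀ p, qReal α t p * qReal α t p =
      qConst α ^ 2 * ((qHat α t p).toReal * (qHat α t p).toReal) := fun p ↦ by
    rw [qReal]; ring
  simp_rw [e]
  rw [integral_const_mul, integral_toReal_mul_toReal (measurable_qHat α t) (measurable_qHat α t)
    (lintegral_qHat_mul_qHat_ne_top h0 h1 t) (lintegral_qHat_mul_qHat_ne_top h0 h1 t),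
    lintegral_qHat_mul_qHat h0 h1]
  simp only [ENNReal.toReal_mul, ENNReal.toReal_pow, toReal_pw ht (mul_pos two_pos hα).ne',
    ENNReal.toReal_ofReal hb.le, ENNReal.toReal_ofReal (one_div_pos.2 hα2).le,
    ENNReal.toReal_ofReal (one_div_pos.2 (mul_pos two_pos hα)).le, ENNReal.toReal_ofNat]
  rw [← mul_assoc, qConst_sq_mul h0 h1]
  have : α * 2 - 1 ≠ 0 := by linarith
  field_simp

lemma integral_hReal_mul_hReal (h1 : α < 1) (ht : 0 ≤ t) :
    ∫ p, hReal α t p * hReal α t p = t ^ (2 - 2 * α) / (1 - α) ^ 2 := by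
  have hα : 0 < 1 - α := by linarith
  unfold hReal
  rw [integral_toReal_mul_toReal (measurable_hHat α t) (measurable_hHat α t)
    (lintegral_hHat_mul_hHat_ne_top h1 t) (lintegral_hHat_mul_hHat_ne_top h1 t),
    lintegral_hHat_mul_hHat h1, ENNReal.toReal_mul, ENNReal.toReal_pow,
    toReal_pw ht (show 2 - 2 * α ≠ 0 by linarith), ENNReal.toReal_ofReal (one_div_pos.2 hα).le]
  field_simp

lemma integral_gReal_mul_gReal (h0 : 1 / 2 < α) (h1 : α < 1) (ht : 0 ≤ t) :
    ∫ p, gReal α t p * gReal α t p = beta (1 - α) (2 * α - 1) * t ^ (2 * α) / α := by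
  have hb := beta_pos (show 0 < 1 - α by linarith) (show 0 < 2 * α - 1 by linarith)
  have hα : 0 < α := by linarith
  unfold gReal
  rw [integral_toReal_mul_toReal (measurable_gHat α t) (measurable_gHat α t)
    (lintegral_gHat_mul_gHat_ne_top h0 h1 t) (lintegral_gHat_mul_gHat_ne_top h0 h1 t),
    lintegral_gHat_mul_gHat h0 h1]
  simp only [ENNReal.toReal_mul, toReal_pw ht (mul_pos two_pos hα).ne',
    ENNReal.toReal_ofReal hb.le,
    ENNReal.toReal_ofReal (one_div_pos.2 (mul_pos two_pos hα)).le, ENNReal.toReal_ofNat]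
  field_simp

lemma integral_hReal_mul_gReal (h0 : 1 / 2 < α) (h1 : α < 1) (ht : 0 ≤ t) :
    ∫ p, hReal α t p * gReal α t p = 2 * beta (1 - α) α * t := by
  have hb := beta_pos (show 0 < 1 - α by linarith) (show 0 < α by linarith)
  unfold gReal hReal
  rw [integral_toReal_mul_toReal (measurable_hHat α t) (measurable_gHat α t)
    (lintegral_hHat_mul_hHat_ne_top h1 t) (lintegral_gHat_mul_gHat_ne_top h0 h1 t),
    lintegral_hHat_mul_gHat h0 h1]
  simp only [ENNReal.toReal_mul, ENNReal.toReal_ofReal hb.le, ENNReal.toReal_ofReal ht,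
    ENNReal.toReal_ofNat]
  ring

lemma integral_qReal_mul_hReal (h0 : 1 / 2 < α) (h1 : α < 1) (ht : 0 ≤ t) :
    ∫ p, qReal α t p * hReal α t p = C₁ α * t := by
  have hb := beta_pos (show 0 < 1 - α by linarith) (show 0 < α / 2 by linarith)
  simp only [qReal, hReal, mul_assoc]
  rw [integral_const_mul, integral_toReal_mul_toReal (measurable_qHat α t) (measurable_hHat α t)
    (lintegral_qHat_mul_qHat_ne_top h0 h1 t) (lintegral_hHat_mul_hHat_ne_top h1 t),
    lintegral_qHat_mul_hHat h0 h1]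
  simp only [ENNReal.toReal_mul, ENNReal.toReal_pow, ENNReal.toReal_ofReal hb.le,
    ENNReal.toReal_ofReal ht, C₁, qConst]
  ring

lemma integral_qReal_mul_gReal (h0 : 1 / 2 < α) (h1 : α < 1) (ht : 0 ≤ t) :
    ∫ p, qReal α t p * gReal α t p = C₂ α * t ^ (2 * α) / α := by
  have hα : 0 < α := by linarith
  simp only [qReal, gReal, mul_assoc]
  rw [integral_const_mul, integral_toReal_mul_toReal (measurable_qHat α t) (measurable_gHat α t)
    (lintegral_qHat_mul_qHat_ne_top h0 h1 t) (lintegral_gHat_mul_gHat_ne_top h0 h1 t),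
    lintegral_qHat_mul_gHat h0, C₂_eq h0 h1]
  simp only [ENNReal.toReal_mul, toReal_pw ht (mul_pos two_pos hα).ne',
    ENNReal.toReal_ofReal (one_div_pos.2 (mul_pos two_pos hα)).le, ENNReal.toReal_ofNat]
  field_simp

/-! ### Identification of the kernels -/

/-- The fundamental theorem of calculus: the singularity at u = y is integrable and the integrand is
continuous at x > y. -/
lemma deriv_fbmKernel (h0 : 0 < α) {x y : ℝ} (hy : 0 < y) (hyx : y < x) :
    deriv (fun z ↦ fbmKernel ((α + 1) / 2) z y) x =
      cConst ((α + 1) / 2) * (y ^ (-(α / 2)) * ((x - y) ^ (α / 2 - 1) * x ^ (α / 2))) := by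
  have e : (fun z ↦ fbmKernel ((α + 1) / 2) z y) = fun z ↦
      cConst ((α + 1) / 2) * y ^ (-(α / 2)) *
        ∫ u in y..z, (u - y) ^ (α / 2 - 1) * u ^ (α / 2) := by
    ext z
    rw [fbmKernel, show (1 / 2 - (α + 1) / 2 : ℝ) = -(α / 2) by ring,
      show ((α + 1) / 2 - 3 / 2 : ℝ) = α / 2 - 1 by ring,
      show ((α + 1) / 2 - 1 / 2 : ℝ) = α / 2 by ring]
  rw [e]
  have hintg : IntervalIntegrable (fun u ↦ (u - y) ^ (α / 2 - 1) * u ^ (α / 2)) volume y x := by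
    refine IntervalIntegrable.mul_continuousOn ?_
      (Real.continuous_rpow_const (by positivity)).continuousOn
    have := (intervalIntegral.intervalIntegrable_rpow' (a := 0) (b := x - y)
      (r := α / 2 - 1) (by linarith)).comp_sub_right y
    simpa using this
  have hmeas : Measurable fun u : ℝ ↦ (u - y) ^ (α / 2 - 1) * u ^ (α / 2) := by fun_prop
  have hx : x - y ≠ 0 := by linarith
  have hx' : x ≠ 0 := by linarith
  have hcont : ContinuousAt (fun u : ℝ ↦ (u - y) ^ (α / 2 - 1) * u ^ (α / 2)) x :=
    ((continuousAt_id.sub continuousAt_const).rpow_const (Or.inl hx)).mul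
      (continuousAt_id.rpow_const (Or.inl hx'))
  have := (intervalIntegral.integral_hasDerivAt_right hintg
    hmeas.stronglyMeasurable.stronglyMeasurableAtFilter hcont).const_mul
      (cConst ((α + 1) / 2) * y ^ (-(α / 2)))
  rw [this.deriv]
  ring

lemma Q_eq_qReal (h0 : 0 < α) {y₁ y₂ : ℝ} (hy₁ : y₁ ≠ 0) (hy₂ : y₂ ≠ 0) :
    Q α t y₁ y₂ = qReal α t (y₁, y₂) := by
  by_cases h : y₁ ∈ Icc 0 t ∧ y₂ ∈ Icc 0 t
  · obtain ⟨h1, h2⟩ := h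
    have p1 : 0 < y₁ := lt_of_le_of_ne h1.1 hy₁.symm
    have p2 : 0 < y₂ := lt_of_le_of_ne h2.1 hy₂.symm
    rw [Q, indicator_of_mem h1, indicator_of_mem h2, mul_one, mul_one, qReal, qConst, mul_assoc]
    congr 1
    have hm : max y₁ y₂ ≤ t := max_le h1.2 h2.2
    rw [intervalIntegral.integral_of_le hm, integral_Ioc_eq_integral_Ioo]
    have e : ∀ x ∈ Ioo (max y₁ y₂) t, deriv (fun z ↦ fbmKernel ((α + 1) / 2) z y₁) x *
        deriv (fun z ↦ fbmKernel ((α + 1) / 2) z y₂) x = cConst ((α + 1) / 2) ^ 2 *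
        ((y₁ ^ (-(α / 2)) * ((x - y₁) ^ (α / 2 - 1) * x ^ (α / 2))) *
          (y₂ ^ (-(α / 2)) * ((x - y₂) ^ (α / 2 - 1) * x ^ (α / 2)))) := fun x hx ↦ by
      rw [deriv_fbmKernel h0 p1 ((le_max_left _ _).trans_lt hx.1),
        deriv_fbmKernel h0 p2 ((le_max_right _ _).trans_lt hx.1)]
      ring
    rw [setIntegral_congr_fun measurableSet_Ioo e, integral_const_mul]
    congr 1
    rw [integral_eq_lintegral_of_nonneg_ae]
    · congr 1
      rw [qHat]
      refine Eq.trans ?_ (setLIntegral_Ioo_eq_lintegral (a := max y₁ y₂) (b := t) (fun x hx ↦ ?_)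
        (fun x hx ↦ by simp [pw_of_nonpos (x := t - x) (by linarith)]))
      · refine setLIntegral_congr_fun measurableSet_Ioo fun x hx ↦ ?_
        have q1 : 0 < x - y₁ := sub_pos.2 ((le_max_left _ _).trans_lt hx.1)
        have q2 : 0 < x - y₂ := sub_pos.2 ((le_max_right _ _).trans_lt hx.1)
        have q3 : 0 < x := by linarith
        have q4 : 0 < t - x := by linarith [hx.2]
        simp only [phi]
        rw [pw_zero_of_pos q4, pw_of_pos p1, pw_of_pos p2, pw_of_pos q1, pw_of_pos q2,
          pw_of_pos q3, one_mul, ENNReal.ofReal_mul (by positivity),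
          ENNReal.ofReal_mul (by positivity), ENNReal.ofReal_mul (by positivity),
          ENNReal.ofReal_mul (by positivity), ENNReal.ofReal_mul (by positivity)]
        ring
      · rcases le_max_iff.1 hx with h | h
        · simp [phi, pw_of_nonpos (x := x - y₁) (by linarith)]
        · simp [phi, pw_of_nonpos (x := x - y₂) (by linarith)]
    · refine (ae_restrict_iff' measurableSet_Ioo).2 (ae_of_all _ fun x hx ↦ ?_)
      have q1 : 0 < x - y₁ := sub_pos.2 ((le_max_left _ _).trans_lt hx.1)
      have q2 : 0 < x - y₂ := sub_pos.2 ((le_max_right _ _).trans_lt hx.1)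
      have q3 : 0 < x := by linarith
      simp only [Pi.zero_apply]
      positivity
    · exact Measurable.aestronglyMeasurable (by fun_prop)
  · have hz : ∀ y, y ∉ Icc 0 t → ∀ x, pw 0 (t - x) * phi α x y = 0 := fun y hy x ↦ by
      simp only [mem_Icc, not_and_or, not_le] at hy
      rcases hy with hy | hy
      · simp [phi, pw_of_nonpos hy.le]
      · rcases le_or_gt t x with h | h
        · simp [pw_of_nonpos (x := t - x) (by linarith)]
        · simp [phi, pw_of_nonpos (x := x - y) (by linarith)]
    rw [not_and_or] at h
    rcases h with h | h
    · simp [Q, indicator_of_notMem h, qReal, qHat, ← mul_assoc, hz y₁ h]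
    · simp [Q, indicator_of_notMem h, qReal, qHat, mul_comm (phi α _ y₁), ← mul_assoc, hz y₂ h]

/-- The interval is open because `pw 0 (t - y)` vanishes at y = t; the edges of the square are a
null set. -/
lemma hReal_eq_of_mem {y₁ y₂ : ℝ} (h1 : y₁ ∈ Ioo 0 t) (h2 : y₂ ∈ Ioo 0 t) :
    hReal α t (y₁, y₂) = (y₁ * y₂) ^ (-(α / 2)) := by
  have p1 := h1.1
  have p2 := h2.1
  rw [hReal, hHat, pw_zero_of_pos (x := t - y₁) (by linarith [h1.2]),
    pw_zero_of_pos (x := t - y₂) (by linarith [h2.2]), pw_of_pos p1, pw_of_pos p2, mul_one, mul_one,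
    ENNReal.toReal_mul, ENNReal.toReal_ofReal (by positivity),
    ENNReal.toReal_ofReal (by positivity), Real.mul_rpow p1.le p2.le]

lemma hReal_eq_zero {y₁ y₂ : ℝ} (h : ¬(y₁ ∈ Icc 0 t ∧ y₂ ∈ Icc 0 t)) :
    hReal α t (y₁, y₂) = 0 := by
  simp only [mem_Icc, not_and_or, not_le] at h
  rw [hReal, hHat]
  rcases h with (h | h) | (h | h)
  · simp [pw_of_nonpos h.le]
  · simp [pw_of_nonpos (x := t - y₁) (by linarith)]
  · simp [pw_of_nonpos h.le]
  · simp [pw_of_nonpos (x := t - y₂) (by linarith)]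

lemma gHalf_toReal_of_lt {y r : ℝ} (hr : 0 < r) (hry : r < y) (hy : y < t) :
    (gHat α t (y, r)).toReal = y ^ (α / 2) * r ^ (-(α / 2)) * (y - r) ^ (α - 1) := by
  have h1 : 0 < y := hr.trans hry
  have h2 : 0 < y - r := by linarith
  simp only [gHat, gHalf, Prod.fst_swap, Prod.snd_swap]
  rw [pw_of_nonpos (x := r - y) (by linarith), pw_zero_of_pos (x := t - y) (by linarith),
    pw_of_pos h1, pw_of_pos hr, pw_of_pos h2]
  simp only [mul_zero, zero_mul, add_zero, mul_one, ENNReal.toReal_mul]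
  rw [ENNReal.toReal_ofReal (by positivity), ENNReal.toReal_ofReal (by positivity),
    ENNReal.toReal_ofReal (by positivity)]

lemma gReal_eq_of_mem {y₁ y₂ : ℝ} (h1 : y₁ ∈ Ioo 0 t) (h2 : y₂ ∈ Ioo 0 t) (hne : y₁ ≠ y₂) :
    gReal α t (y₁, y₂) =
      (max y₁ y₂) ^ (α / 2) * (min y₁ y₂) ^ (-(α / 2)) * |y₁ - y₂| ^ (α - 1) := by
  rw [gReal]
  rcases hne.lt_or_gt with h | h
  · rw [← gHat_swap, Prod.swap_prod_mk, gHalf_toReal_of_lt h1.1 h h2.2, max_eq_right h.le,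
      min_eq_left h.le, abs_of_neg (by linarith), neg_sub]
  · rw [gHalf_toReal_of_lt h2.1 h h1.2, max_eq_left h.le, min_eq_right h.le,
      abs_of_pos (by linarith)]

lemma gReal_eq_zero {y₁ y₂ : ℝ} (h : ¬(y₁ ∈ Icc 0 t ∧ y₂ ∈ Icc 0 t)) :
    gReal α t (y₁, y₂) = 0 := by
  have key : ∀ y r : ℝ, ¬(y ∈ Icc 0 t ∧ r ∈ Icc 0 t) → gHalf α t (y, r) = 0 := fun y r h ↦ by
    simp only [mem_Icc, not_and_or, not_le] at h
    rw [gHalf]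
    simp only
    rcases h with (h | h) | (h | h)
    · simp [pw_of_nonpos h.le]
    · simp [pw_of_nonpos (x := t - y) (by linarith)]
    · simp [pw_of_nonpos h.le]
    · rcases le_or_gt t y with h' | h'
      · simp [pw_of_nonpos (x := t - y) (by linarith)]
      · simp [pw_of_nonpos (x := y - r) (by linarith)]
  rw [gReal, gHat, key _ _ h, Prod.swap_prod_mk, key _ _ (fun h' ↦ h h'.symm)]
  simp

end RealKernels

/-! ### Tensor products and the explicit form of the error -/

section ErrorFormula

/-- Exchanges the first two of three coordinates; conjugated by reassociation, it regroups (y₁, u₁,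
y₂, u₂) as (y₁, y₂, u₁, u₂). -/
lemma measurePreserving_rotate :
    MeasurePreserving (fun z : ℝ × (ℝ × ℝ) ↦ (z.2.1, (z.1, z.2.2))) := by
  have h1 := (measurePreserving_prodAssoc (volume : Measure ℝ) (volume : Measure ℝ)
    (volume : Measure ℝ))
  have h2 := (Measure.measurePreserving_swap (μ := (volume : Measure ℝ))
    (ν := (volume : Measure ℝ))).prod (MeasurePreserving.id (volume : Measure ℝ))
  exact h1.comp (h2.comp h1.symm)

/-- Regrouping the coordinates of a pair of points of the plane preserves the volume. -/
lemma measurePreserving_regroup :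
    MeasurePreserving (fun p : (ℝ × ℝ) × (ℝ × ℝ) ↦ ((p.1.1, p.2.1), (p.1.2, p.2.2))) := by
  have h1 := (measurePreserving_prodAssoc (volume : Measure ℝ) (volume : Measure ℝ)
    (volume : Measure (ℝ × ℝ)))
  have h2 := (MeasurePreserving.id (volume : Measure ℝ)).prod measurePreserving_rotate
  exact h1.symm.comp (h2.comp h1)

/-- The tensor product of two kernels, one in each pair of coordinates. -/
def tens (u v : ℝ × ℝ → ℝ) (p : (ℝ × ℝ) × (ℝ × ℝ)) : ℝ :=
  u (p.1.1, p.2.1) * v (p.1.2, p.2.2)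

lemma memLp_tens {u v : ℝ × ℝ → ℝ} (hu : MemLp u 2) (hv : MemLp v 2) : MemLp (tens u v) 2 := by
  have h : MemLp (fun z : (ℝ × ℝ) × (ℝ × ℝ) ↦ u z.1 * v z.2) 2 := by
    have hm : AEStronglyMeasurable (fun z : (ℝ × ℝ) × (ℝ × ℝ) ↦ u z.1 * v z.2) :=
      hu.1.comp_fst.mul hv.1.comp_snd
    rw [memLp_two_iff_integrable_sq hm]
    simp only [mul_pow]
    exact hu.integrable_sq.mul_prod hv.integrable_sq
  exact h.comp_measurePreserving measurePreserving_regroup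

lemma integral_tens_mul_tens {u v u' v' : ℝ × ℝ → ℝ} (hu : MemLp u 2) (hv : MemLp v 2)
    (hu' : MemLp u' 2) (hv' : MemLp v' 2) :
    ∫ p, tens u v p * tens u' v' p = (∫ z, u z * u' z) * ∫ z, v z * v' z := by
  have hintg : Integrable (fun z : (ℝ × ℝ) × (ℝ × ℝ) ↦ (u z.1 * u' z.1) * (v z.2 * v' z.2)) :=
    (hu.integrable_mul hu').mul_prod (hv.integrable_mul hv')
  have h1 := integral_map (μ := volume) measurePreserving_regroup.measurable.aemeasurable
    (f := fun z : (ℝ × ℝ) × (ℝ × ℝ) ↦ (u z.1 * u' z.1) * (v z.2 * v' z.2))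
    (by rw [measurePreserving_regroup.map_eq]; exact hintg.1)
  rw [measurePreserving_regroup.map_eq] at h1
  rw [← integral_prod_mul (fun z ↦ u z * u' z) (fun z ↦ v z * v' z), ← Measure.volume_eq_prod, h1]
  congr 1 with p
  simp only [tens]
  ring

lemma ae_of_ae_pairs {A B : ℝ × ℝ → Prop} (hA : ∀ᵐ z, A z) (hB : ∀ᵐ z, B z) :
    ∀ᵐ p : (ℝ × ℝ) × (ℝ × ℝ), A (p.1.1, p.2.1) ∧ B (p.1.2, p.2.2) := by
  have h1 : ∀ᵐ z : (ℝ × ℝ) × (ℝ × ℝ), A z.1 := Measure.quasiMeasurePreserving_fst.ae hA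
  have h2 : ∀ᵐ z : (ℝ × ℝ) × (ℝ × ℝ), B z.2 := Measure.quasiMeasurePreserving_snd.ae hB
  exact measurePreserving_regroup.quasiMeasurePreserving.ae (h1.and h2)

/-- Covers all the points at which the explicit kernels and their versions with values extended by
zero might differ. -/
lemma ae_generic (t : ℝ) :
    ∀ᵐ z : ℝ × ℝ, (z.1 ≠ 0 ∧ z.1 ≠ t) ∧ (z.2 ≠ 0 ∧ z.2 ≠ t) ∧ z.1 ≠ z.2 := by
  have h := (Measure.ae_ne (volume : Measure ℝ) 0).and (Measure.ae_ne (volume : Measure ℝ) t)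
  have h1 : ∀ᵐ z : ℝ × ℝ, z.1 ≠ 0 ∧ z.1 ≠ t := Measure.quasiMeasurePreserving_fst.ae h
  have h2 : ∀ᵐ z : ℝ × ℝ, z.2 ≠ 0 ∧ z.2 ≠ t := Measure.quasiMeasurePreserving_snd.ae h
  filter_upwards [h1, h2, ae_fst_ne_snd (X := ℝ)] with z a b c using ⟨a, b, c⟩

variable {α β t s : ℝ}

/-- The square of the rectangle `[0, t] × [0, s]`. -/
def boxSq (t s : ℝ) : Set ((ℝ × ℝ) × (ℝ × ℝ)) := (Icc 0 t ×ˢ Icc 0 s) ×ˢ (Icc 0 t ×ˢ Icc 0 s)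

lemma mem_boxSq_iff {p : (ℝ × ℝ) × (ℝ × ℝ)} : p ∈ boxSq t s ↔
    (p.1.1 ∈ Icc 0 t ∧ p.2.1 ∈ Icc 0 t) ∧ (p.1.2 ∈ Icc 0 s ∧ p.2.2 ∈ Icc 0 s) := by
  simp only [boxSq, mem_prod]
  tauto

lemma boxSq_subset_quadrantSq : boxSq t s ⊆ quadrantSq := fun p hp ↦ by
  rw [mem_boxSq_iff] at hp
  exact ⟨⟨hp.1.1.1, hp.2.1.1⟩, hp.1.2.1, hp.2.2.1⟩

lemma swap_mem_boxSq_iff {p : (ℝ × ℝ) × (ℝ × ℝ)} : p.swap ∈ boxSq t s ↔ p ∈ boxSq t s := by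
  simp only [mem_boxSq_iff, Prod.fst_swap, Prod.snd_swap]
  tauto

lemma Q_eq_zero {y₁ y₂ : ℝ} (h : ¬(y₁ ∈ Icc 0 t ∧ y₂ ∈ Icc 0 t)) : Q α t y₁ y₂ = 0 := by
  rw [not_and_or] at h
  rcases h with h | h
  · simp [Q, indicator_of_notMem h]
  · simp [Q, indicator_of_notMem h]

lemma Q_comm (y₁ y₂ : ℝ) : Q α t y₁ y₂ = Q α t y₂ y₁ := by
  simp only [Q, max_comm y₁ y₂]
  congr 1
  · ring
  · congr 1 with x
    ring

/-- The kernel of the Rosenblatt sheet. -/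
noncomputable def sheetKernel (α β t s : ℝ) : (ℝ × ℝ) × (ℝ × ℝ) → ℝ :=
  (boxSq t s).indicator fun p ↦ Q α t p.1.1 p.2.1 * Q β s p.1.2 p.2.2

/-- The approximating kernel on the square of `[0, t] × [0, s]`. -/
noncomputable def approxKernel (α β t s k₁ k₂ : ℝ) : (ℝ × ℝ) × (ℝ × ℝ) → ℝ :=
  (boxSq t s).indicator fun p ↦ zeta α β k₁ k₂ p.1.1 p.2.1 p.1.2 p.2.2

lemma sheetKernel_ae_eq (hα : 0 < α) (hβ : 0 < β) :
    sheetKernel α β t s =ᵐ[volume] tens (qReal α t) (qReal β s) := by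
  filter_upwards [ae_of_ae_pairs (ae_generic t) (ae_generic s)] with p hp
  rw [tens, ← Q_eq_qReal hα hp.1.1.1 hp.1.2.1.1, ← Q_eq_qReal hβ hp.2.1.1 hp.2.2.1.1, sheetKernel]
  by_cases h : p ∈ boxSq t s
  · rw [indicator_of_mem h]
  · rw [indicator_of_notMem h]
    rw [mem_boxSq_iff, not_and_or] at h
    rcases h with h | h
    · rw [Q_eq_zero h, zero_mul]
    · rw [Q_eq_zero h, mul_zero]

lemma approxKernel_ae_eq (k₁ k₂ : ℝ) : approxKernel α β t s k₁ k₂ =ᵐ[volume] fun p ↦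
    k₁ * tens (hReal α t) (hReal β s) p + k₂ * tens (gReal α t) (gReal β s) p := by
  filter_upwards [ae_of_ae_pairs (ae_generic t) (ae_generic s)] with p hp
  obtain ⟨⟨⟨a1, a2⟩, ⟨a3, a4⟩, a5⟩, ⟨b1, b2⟩, ⟨b3, b4⟩, b5⟩ := hp
  rw [approxKernel, tens, tens]
  by_cases h : p ∈ boxSq t s
  · rw [indicator_of_mem h]
    rw [mem_boxSq_iff] at h
    have key : ∀ {y T : ℝ}, y ∈ Icc 0 T → y ≠ 0 → y ≠ T → y ∈ Ioo 0 T := fun h h1 h2 ↦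
      ⟨lt_of_le_of_ne h.1 h1.symm, lt_of_le_of_ne h.2 h2⟩
    have m1 := key h.1.1 a1 a2
    have m2 := key h.1.2 a3 a4
    have m3 := key h.2.1 b1 b2
    have m4 := key h.2.2 b3 b4
    rw [hReal_eq_of_mem m1 m2, hReal_eq_of_mem m3 m4, gReal_eq_of_mem m1 m2 a5,
      gReal_eq_of_mem m3 m4 b5, zeta]
    ring
  · rw [indicator_of_notMem h]
    rw [mem_boxSq_iff, not_and_or] at h
    rcases h with h | h
    · rw [hReal_eq_zero h, gReal_eq_zero h]; ring
    · rw [hReal_eq_zero h, gReal_eq_zero h]; ring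

lemma sheetKernel_swap (p : (ℝ × ℝ) × (ℝ × ℝ)) :
    sheetKernel α β t s p.swap = sheetKernel α β t s p := by
  classical
  simp only [sheetKernel, indicator_apply, swap_mem_boxSq_iff, Prod.fst_swap, Prod.snd_swap,
    Q_comm p.2.1, Q_comm p.2.2]

lemma approxKernel_swap (k₁ k₂ : ℝ) (p : (ℝ × ℝ) × (ℝ × ℝ)) :
    approxKernel α β t s k₁ k₂ p.swap = approxKernel α β t s k₁ k₂ p := by
  classical
  simp only [approxKernel, indicator_apply, swap_mem_boxSq_iff, Prod.fst_swap, Prod.snd_swap,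
    zeta, mul_comm p.2.1, mul_comm p.2.2, max_comm p.2.1, max_comm p.2.2, min_comm p.2.1,
    min_comm p.2.2, abs_sub_comm p.2.1, abs_sub_comm p.2.2]

variable {Ω : Type*} [MeasurableSpace Ω] {P : Measure Ω} {B : ℝ≥0 × ℝ≥0 → Ω → ℝ}

lemma memLp_approx_tens (hα : 1 / 2 < α) (hα' : α < 1) (hβ : 1 / 2 < β) (hβ' : β < 1)
    (k₁ k₂ : ℝ) : MemLp (fun p ↦ k₁ * tens (hReal α t) (hReal β s) p +
      k₂ * tens (gReal α t) (gReal β s) p) 2 :=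
  ((memLp_tens (memLp_hReal hα' t) (memLp_hReal hβ' s)).const_mul k₁).add
    ((memLp_tens (memLp_gReal hα hα' t) (memLp_gReal hβ hβ' s)).const_mul k₂)

/-- One factor 2 of the 4 is in the definition of `error`, the other comes from the isometry for
symmetric kernels. -/
lemma f_eq_integral (hB : IsBrownianSheet B P) (hα : 1 / 2 < α) (hα' : α < 1) (hβ : 1 / 2 < β)
    (hβ' : β < 1) (k₁ k₂ : ℝ) :
    f B P α β t s k₁ k₂ = 4 * ∫ p, (tens (qReal α t) (qReal β s) p -
      (k₁ * tens (hReal α t) (hReal β s) p + k₂ * tens (gReal α t) (gReal β s) p)) ^ 2 := by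
  have e1 : sheetKernel α β t s =ᵐ[volume] tens (qReal α t) (qReal β s) :=
    sheetKernel_ae_eq (by linarith) (by linarith)
  have e2 := approxKernel_ae_eq (α := α) (β := β) (t := t) (s := s) k₁ k₂
  have m1 : MemLp (sheetKernel α β t s) 2 :=
    (memLp_congr_ae e1).2 (memLp_tens (memLp_qReal hα hα' t) (memLp_qReal hβ hβ' s))
  have m2 : MemLp (approxKernel α β t s k₁ k₂) 2 :=
    (memLp_congr_ae e2).2 (memLp_approx_tens hα hα' hβ hβ' k₁ k₂)
  have w1 := isDoubleWiener_doubleWiener hB m1 fun p hp ↦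
    indicator_of_notMem (fun h ↦ hp (boxSq_subset_quadrantSq h)) _
  have w2 := isDoubleWiener_doubleWiener hB m2 fun p hp ↦
    indicator_of_notMem (fun h ↦ hp (boxSq_subset_quadrantSq h)) _
  have key := w1.integral_sq_sub hB w2 sheetKernel_swap (approxKernel_swap k₁ k₂)
  change 2 * ∫ ω, (doubleWiener B P (sheetKernel α β t s) ω -
    doubleWiener B P (approxKernel α β t s k₁ k₂) ω) ^ 2 ∂P = _
  rw [key, ← mul_assoc]
  congr 1
  · norm_num
  · refine integral_congr_ae ?_
    filter_upwards [e1, e2] with p h1 h2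
    rw [h1, h2]

lemma integral_sq_sub_lincomb {X : Type*} [MeasurableSpace X] {μ : Measure X} {u v w : X → ℝ}
    (hu : MemLp u 2 μ) (hv : MemLp v 2 μ) (hw : MemLp w 2 μ) (a b : ℝ) :
    ∫ x, (u x - (a * v x + b * w x)) ^ 2 ∂μ =
      (∫ x, u x * u x ∂μ) + a ^ 2 * (∫ x, v x * v x ∂μ) + b ^ 2 * (∫ x, w x * w x ∂μ) +
        (-2 * a) * (∫ x, u x * v x ∂μ) + (-2 * b) * (∫ x, u x * w x ∂μ) +
        (2 * a * b) * (∫ x, v x * w x ∂μ) := by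
  have i : ∀ {y z : X → ℝ}, MemLp y 2 μ → MemLp z 2 μ → ∀ r : ℝ,
      Integrable (fun x ↦ r * (y x * z x)) μ := fun hy hz r ↦ (hy.integrable_mul hz).const_mul r
  have e : ∀ x, (u x - (a * v x + b * w x)) ^ 2 = 1 * (u x * u x) + a ^ 2 * (v x * v x) +
      b ^ 2 * (w x * w x) + (-2 * a) * (u x * v x) + (-2 * b) * (u x * w x) +
      (2 * a * b) * (v x * w x) := fun x ↦ by ring
  simp_rw [e]
  have j1 := i hu hu 1
  have j2 := j1.fun_add (i hv hv (a ^ 2))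
  have j3 := j2.fun_add (i hw hw (b ^ 2))
  have j4 := j3.fun_add (i hu hv (-2 * a))
  have j5 := j4.fun_add (i hu hw (-2 * b))
  rw [integral_add j5 (i hv hw _), integral_add j4 (i hu hw _), integral_add j3 (i hu hv _),
    integral_add j2 (i hw hw _), integral_add j1 (i hv hv _)]
  simp only [integral_const_mul, one_mul]

/-- The explicit form of the error. -/
noncomputable def errFun (α β k₁ k₂ t s : ℝ) : ℝ :=
  t ^ (2 * α) * s ^ (2 * β) * aCoef α β k₂ - 8 * k₁ * bCoef α β k₂ * t * s +
    4 * k₁ ^ 2 * (t ^ (2 - 2 * α) * s ^ (2 - 2 * β) / ((1 - α) ^ 2 * (1 - β) ^ 2))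

theorem f_eq_errFun (hB : IsBrownianSheet B P) (hα : 1 / 2 < α) (hα' : α < 1) (hβ : 1 / 2 < β)
    (hβ' : β < 1) (ht : 0 ≤ t) (hs : 0 ≤ s) (k₁ k₂ : ℝ) :
    f B P α β t s k₁ k₂ = errFun α β k₁ k₂ t s := by
  have q1 := memLp_qReal hα hα' t
  have q2 := memLp_qReal hβ hβ' s
  have h1 := memLp_hReal hα' t
  have h2 := memLp_hReal hβ' s
  have g1 := memLp_gReal hα hα' t
  have g2 := memLp_gReal hβ hβ' s
  rw [f_eq_integral hB hα hα' hβ hβ', integral_sq_sub_lincomb (memLp_tens q1 q2)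
    (memLp_tens h1 h2) (memLp_tens g1 g2), integral_tens_mul_tens q1 q2 q1 q2,
    integral_tens_mul_tens h1 h2 h1 h2, integral_tens_mul_tens g1 g2 g1 g2,
    integral_tens_mul_tens q1 q2 h1 h2, integral_tens_mul_tens q1 q2 g1 g2,
    integral_tens_mul_tens h1 h2 g1 g2, integral_qReal_mul_qReal hα hα' ht,
    integral_qReal_mul_qReal hβ hβ' hs, integral_hReal_mul_hReal hα' ht,
    integral_hReal_mul_hReal hβ' hs, integral_gReal_mul_gReal hα hα' ht,
    integral_gReal_mul_gReal hβ hβ' hs, integral_qReal_mul_hReal hα hα' ht,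
    integral_qReal_mul_hReal hβ hβ' hs, integral_qReal_mul_gReal hα hα' ht,
    integral_qReal_mul_gReal hβ hβ' hs, integral_hReal_mul_gReal hα hα' ht,
    integral_hReal_mul_gReal hβ hβ' hs, errFun, aCoef, bCoef]
  have a0 : α ≠ 0 := by linarith
  have b0 : β ≠ 0 := by linarith
  have a1 : 1 - α ≠ 0 := by linarith
  have b1 : 1 - β ≠ 0 := by linarith
  field_simp
  ring

end ErrorFormula

/-! ### The minimization -/

section Minimization

open Filter Topology

/-- Cauchy–Schwarz on (0, 1) for w^(-α/2) and w^(-α/2) (1 - w)^(α-1): the squared norms are 1/(1 -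
α) and B(1 - α, 2α - 1), the inner product is B(1 - α, α). -/
lemma one_sub_mul_sq_beta_le {α : ℝ} (h0 : 1 / 2 < α) (h1 : α < 1) :
    (1 - α) * beta (1 - α) α ^ 2 ≤ beta (1 - α) (2 * α - 1) := by
  have p0 : 0 < 1 - α := by linarith
  have pb := beta_pos p0 (show 0 < α by linarith)
  have pb2 := beta_pos p0 (show 0 < 2 * α - 1 by linarith)
  set u : ℝ → ℝ≥0∞ := fun w ↦ pw (-(α / 2)) w * pw 0 (1 - w) with hu
  set v : ℝ → ℝ≥0∞ := fun w ↦ pw (-(α / 2)) w * pw (α - 1) (1 - w) with hv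
  have hmu : Measurable u := by fun_prop
  have hmv : Measurable v := by fun_prop
  have I1 : ∫⁻ w, (u * v) w = ENNReal.ofReal (beta (1 - α) α) := by
    rw [← lintegral_pw_mul_pw_one_sub p0 (by linarith)]
    congr 1 with w
    have e1 : pw (1 - α - 1) w = pw (-(α / 2)) w * pw (-(α / 2)) w := by rw [pw_mul_pw]; ring_nf
    have e2 : pw (α - 1) (1 - w) = pw 0 (1 - w) * pw (α - 1) (1 - w) := by
      rw [pw_mul_pw]; ring_nf
    rw [e1, e2]
    simp only [hu, hv, Pi.mul_apply]
    ring
  have I2 : ∫⁻ w, u w ^ (2 : ℝ) = ENNReal.ofReal (1 / (1 - α)) := by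
    have := lintegral_pw_mul_pw_zero p0 1
    rw [pw_of_pos one_pos, Real.one_rpow, ENNReal.ofReal_one, mul_one] at this
    rw [← this]
    congr 1 with w
    simp only [hu]
    rw [ENNReal.rpow_two, mul_pow, sq, sq, pw_mul_pw, pw_mul_pw]
    ring_nf
  have I3 : ∫⁻ w, v w ^ (2 : ℝ) = ENNReal.ofReal (beta (1 - α) (2 * α - 1)) := by
    rw [← lintegral_pw_mul_pw_one_sub p0 (by linarith)]
    congr 1 with w
    simp only [hv]
    rw [ENNReal.rpow_two, mul_pow, sq, sq, pw_mul_pw, pw_mul_pw]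
    ring_nf
  have H := ENNReal.lintegral_mul_le_Lp_mul_Lq volume Real.HolderConjugate.two_two
    hmu.aemeasurable hmv.aemeasurable
  rw [I1, I2, I3, ← ENNReal.mul_rpow_of_nonneg _ _ (by norm_num),
    ← ENNReal.ofReal_mul (by positivity),
    ENNReal.ofReal_rpow_of_nonneg (by positivity) (by norm_num),
    ENNReal.ofReal_le_ofReal_iff (by positivity), ← Real.sqrt_eq_rpow,
    Real.le_sqrt' pb] at H
  rw [one_div_mul_eq_div, le_div_iff₀ p0] at H
  linarith

lemma four_mul_sq_beta_lt {α : ℝ} (h0 : 1 / 2 < α) (h1 : α < 1) :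
    4 * α * (1 - α) ^ 2 * beta (1 - α) α ^ 2 < beta (1 - α) (2 * α - 1) := by
  have p0 : 0 < 1 - α := by linarith
  have pb := beta_pos p0 (show 0 < α by linarith)
  refine lt_of_lt_of_le ?_ (one_sub_mul_sq_beta_le h0 h1)
  -- Strictness comes from 1 - 4α(1 - α) = (2α - 1)² > 0, not from the equality case of
  -- Cauchy–Schwarz.
  have h2 : 4 * α * (1 - α) < 1 := by nlinarith [sq_pos_of_pos (show 0 < 2 * α - 1 by linarith)]
  have h3 : 0 < (1 - α) * beta (1 - α) α ^ 2 := by positivity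
  nlinarith [mul_lt_mul_of_pos_right h2 h3]

/-- The Gram determinant of the two approximating kernels, up to a positive factor. -/
lemma gram_pos {α β : ℝ} (hα : 1 / 2 < α) (hα' : α < 1) (hβ : 1 / 2 < β) (hβ' : β < 1) :
    0 < beta (1 - α) (2 * α - 1) * beta (1 - β) (2 * β - 1) -
      16 * α * β * (1 - α) ^ 2 * (1 - β) ^ 2 * beta (1 - α) α ^ 2 * beta (1 - β) β ^ 2 := by
  have h1 := four_mul_sq_beta_lt hα hα'
  have h2 := four_mul_sq_beta_lt hβ hβ'
  have n1 : 0 ≤ 4 * α * (1 - α) ^ 2 * beta (1 - α) α ^ 2 := by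
    have : 0 < α := by linarith
    positivity
  have n2 : 0 ≤ 4 * β * (1 - β) ^ 2 * beta (1 - β) β ^ 2 := by
    have : 0 < β := by linarith
    positivity
  have := mul_lt_mul'' h1 h2 n1 n2
  linarith

/-- A quadratic polynomial in two variables. -/
def quadFun (c₀ c₁ c₂ c₁₁ c₁₂ c₂₂ : ℝ) (κ : ℝ × ℝ) : ℝ :=
  c₀ + c₁ * κ.1 + c₂ * κ.2 + c₁₁ * κ.1 ^ 2 + c₁₂ * (κ.1 * κ.2) + c₂₂ * κ.2 ^ 2

lemma hasFDerivAt_quadFun_zero_iff (c₀ c₁ c₂ c₁₁ c₁₂ c₂₂ : ℝ) (k : ℝ × ℝ) :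
    HasFDerivAt (quadFun c₀ c₁ c₂ c₁₁ c₁₂ c₂₂) (0 : ℝ × ℝ →L[ℝ] ℝ) k ↔
      c₁ + 2 * c₁₁ * k.1 + c₁₂ * k.2 = 0 ∧ c₂ + 2 * c₂₂ * k.2 + c₁₂ * k.1 = 0 := by
  have h1 : HasFDerivAt (fun κ : ℝ × ℝ ↦ κ.1) (ContinuousLinearMap.fst ℝ ℝ ℝ) k := hasFDerivAt_fst
  have h2 : HasFDerivAt (fun κ : ℝ × ℝ ↦ κ.2) (ContinuousLinearMap.snd ℝ ℝ ℝ) k := hasFDerivAt_snd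
  set L : ℝ × ℝ →L[ℝ] ℝ := (c₁ + 2 * c₁₁ * k.1 + c₁₂ * k.2) • ContinuousLinearMap.fst ℝ ℝ ℝ +
    (c₂ + 2 * c₂₂ * k.2 + c₁₂ * k.1) • ContinuousLinearMap.snd ℝ ℝ ℝ with hL
  have hd : HasFDerivAt (quadFun c₀ c₁ c₂ c₁₁ c₁₂ c₂₂) L k := by
    have := ((((h1.const_mul c₁).const_add c₀).add (h2.const_mul c₂)).add
      ((h1.pow 2).const_mul c₁₁)).add ((h1.mul h2).const_mul c₁₂) |>.add
      ((h2.pow 2).const_mul c₂₂)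
    refine this.congr_fderiv ?_
    ext <;> simp [hL] <;> ring
  constructor
  · intro h
    have e := hd.unique h
    have e1 := congrArg (fun M : ℝ × ℝ →L[ℝ] ℝ ↦ M (1, 0)) e
    have e2 := congrArg (fun M : ℝ × ℝ →L[ℝ] ℝ ↦ M (0, 1)) e
    simp [hL] at e1 e2
    exact ⟨e1, e2⟩
  · rintro ⟨e1, e2⟩
    rw [hL, e1, e2, zero_smul, zero_smul, add_zero] at hd
    exact hd

lemma quadFun_le_of_stationary {c₀ c₁ c₂ c₁₁ c₁₂ c₂₂ : ℝ} {k : ℝ × ℝ} (hpos : 0 < c₁₁)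
    (hdisc : c₁₂ ^ 2 ≤ 4 * c₁₁ * c₂₂) (h1 : c₁ + 2 * c₁₁ * k.1 + c₁₂ * k.2 = 0)
    (h2 : c₂ + 2 * c₂₂ * k.2 + c₁₂ * k.1 = 0) (κ : ℝ × ℝ) :
    quadFun c₀ c₁ c₂ c₁₁ c₁₂ c₂₂ k ≤ quadFun c₀ c₁ c₂ c₁₁ c₁₂ c₂₂ κ := by
  set x := κ.1 - k.1 with hx
  set y := κ.2 - k.2 with hy
  -- Exact Taylor expansion at `k`, where the gradient is zero; completing the square then shows
  -- that the quadratic form is nonnegative.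
  have e : quadFun c₀ c₁ c₂ c₁₁ c₁₂ c₂₂ κ - quadFun c₀ c₁ c₂ c₁₁ c₁₂ c₂₂ k =
      c₁₁ * x ^ 2 + c₁₂ * (x * y) + c₂₂ * y ^ 2 := by
    simp only [quadFun, hx, hy]
    linear_combination (κ.1 - k.1) * h1 + (κ.2 - k.2) * h2
  have h3 : 0 ≤ 4 * c₁₁ * (c₁₁ * x ^ 2 + c₁₂ * (x * y) + c₂₂ * y ^ 2) := by
    have e2 : 4 * c₁₁ * (c₁₁ * x ^ 2 + c₁₂ * (x * y) + c₂₂ * y ^ 2) =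
        (2 * c₁₁ * x + c₁₂ * y) ^ 2 + (4 * c₁₁ * c₂₂ - c₁₂ ^ 2) * y ^ 2 := by ring
    rw [e2]
    have := mul_nonneg (sub_nonneg.2 hdisc) (sq_nonneg y)
    positivity
  have h4 := nonneg_of_mul_nonneg_right h3 (by positivity)
  linarith

/-! ### The stationary point and the minimum of the explicit error. -/

variable {α β T S : ℝ}

lemma errFun_eq_quadFun (k₁ k₂ : ℝ) : errFun α β k₁ k₂ T S =
    quadFun (T ^ (2 * α) * S ^ (2 * β)) (-(8 * (C₁ α * C₁ β) * T * S))
      (-(8 / (α * β) * (C₂ α * C₂ β) * (T ^ (2 * α) * S ^ (2 * β))))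
      (4 * (T ^ (2 - 2 * α) * S ^ (2 - 2 * β) / ((1 - α) ^ 2 * (1 - β) ^ 2)))
      (32 * (beta (1 - α) α * beta (1 - β) β) * T * S)
      (4 / (α * β) * (beta (1 - α) (2 * α - 1) * beta (1 - β) (2 * β - 1)) *
        (T ^ (2 * α) * S ^ (2 * β))) (k₁, k₂) := by
  simp only [errFun, aCoef, bCoef, quadFun]
  ring

lemma rpow_two_mul_eq (hT : 0 < T) : T ^ (2 * α) = T * T ^ (2 * α - 1) := by
  nth_rewrite 2 [← Real.rpow_one T]
  rw [← Real.rpow_add hT]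
  ring_nf

lemma rpow_two_sub_eq (hT : 0 < T) : T ^ (2 - 2 * α) = T / T ^ (2 * α - 1) := by
  nth_rewrite 2 [← Real.rpow_one T]
  rw [← Real.rpow_sub hT]
  ring_nf

/-- Two linear equations in k₁, k₂. Solving the first for k₁ and substituting leaves D k₂ = const,
where D > 0 is the expression in `gram_pos`. -/
lemma stationary_iff (hα : 1 / 2 < α) (hα' : α < 1) (hβ : 1 / 2 < β) (hβ' : β < 1)
    (hT : 0 < T) (hS : 0 < S) (k : ℝ × ℝ) :
    (-(8 * (C₁ α * C₁ β) * T * S) +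
        2 * (4 * (T ^ (2 - 2 * α) * S ^ (2 - 2 * β) / ((1 - α) ^ 2 * (1 - β) ^ 2))) * k.1 +
        32 * (beta (1 - α) α * beta (1 - β) β) * T * S * k.2 = 0 ∧
      -(8 / (α * β) * (C₂ α * C₂ β) * (T ^ (2 * α) * S ^ (2 * β))) +
        2 * (4 / (α * β) * (beta (1 - α) (2 * α - 1) * beta (1 - β) (2 * β - 1)) *
          (T ^ (2 * α) * S ^ (2 * β))) * k.2 +
        32 * (beta (1 - α) α * beta (1 - β) β) * T * S * k.1 = 0) ↔
      k = (kOneStar α β T S, kTwoStar α β) := by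
  have hD := gram_pos hα hα' hβ hβ'
  have a0 : 0 < α := by linarith
  have b0 : 0 < β := by linarith
  have a1 : 0 < 1 - α := by linarith
  have b1 : 0 < 1 - β := by linarith
  rw [rpow_two_mul_eq hT, rpow_two_mul_eq hS, rpow_two_sub_eq hT, rpow_two_sub_eq hS, kOneStar,
    kTwoStar, Prod.ext_iff]
  have hτ : 0 < T ^ (2 * α - 1) := by positivity
  have hσ : 0 < S ^ (2 * β - 1) := by positivity
  -- Once powers, Beta values and the constants C₁, C₂ are opaque, the claim is rational algebra.
  generalize T ^ (2 * α - 1) = τ at *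
  generalize S ^ (2 * β - 1) = σ at *
  generalize C₁ α = p₁
  generalize C₁ β = p₂
  generalize C₂ α = q₁
  generalize C₂ β = q₂
  generalize beta (1 - α) (2 * α - 1) = m₁ at *
  generalize beta (1 - β) (2 * β - 1) = m₂ at *
  generalize beta (1 - α) α = n₁ at *
  generalize beta (1 - β) β = n₂ at *
  obtain ⟨x, y⟩ := k
  simp only
  set D := m₁ * m₂ - 16 * α * β * (1 - α) ^ 2 * (1 - β) ^ 2 * n₁ ^ 2 * n₂ ^ 2 with hDdef
  -- The denominators of k₁* and k₂* are opposite to each other.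
  have hD' : 16 * α * β * (1 - α) ^ 2 * (1 - β) ^ 2 * n₁ ^ 2 * n₂ ^ 2 - m₁ * m₂ = -D := by
    rw [hDdef]; ring
  rw [hD']
  set w := (1 - α) ^ 2 * (1 - β) ^ 2 with hw
  have hwpos : 0 < w := by positivity
  have eq1 : -(8 * (p₁ * p₂) * T * S) + 2 * (4 * (T / τ * (S / σ) / w)) * x +
      32 * (n₁ * n₂) * T * S * y = 0 ↔ x = w * τ * σ * (p₁ * p₂ - 4 * (n₁ * n₂) * y) := by
    have e : -(8 * (p₁ * p₂) * T * S) + 2 * (4 * (T / τ * (S / σ) / w)) * x +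
        32 * (n₁ * n₂) * T * S * y =
        8 * T * S / (w * τ * σ) * (x - w * τ * σ * (p₁ * p₂ - 4 * (n₁ * n₂) * y)) := by
      field_simp; ring
    rw [e, mul_eq_zero, or_iff_right (by positivity), sub_eq_zero]
  have eq2 : -(8 / (α * β) * (q₁ * q₂) * (T * τ * (S * σ))) +
      2 * (4 / (α * β) * (m₁ * m₂) * (T * τ * (S * σ))) * y + 32 * (n₁ * n₂) * T * S * x = 0 ↔
      τ * σ * (m₁ * m₂ * y - q₁ * q₂) + 4 * α * β * (n₁ * n₂) * x = 0 := by
    have e : -(8 / (α * β) * (q₁ * q₂) * (T * τ * (S * σ))) +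
        2 * (4 / (α * β) * (m₁ * m₂) * (T * τ * (S * σ))) * y + 32 * (n₁ * n₂) * T * S * x =
        8 * T * S / (α * β) *
          (τ * σ * (m₁ * m₂ * y - q₁ * q₂) + 4 * α * β * (n₁ * n₂) * x) := by
      field_simp; ring
    rw [e, mul_eq_zero, or_iff_right (by positivity)]
  rw [eq1, eq2]
  have hτσ : τ * σ ≠ 0 := by positivity
  have hy : ∀ y, τ * σ * (m₁ * m₂ * y - q₁ * q₂) +
      4 * α * β * (n₁ * n₂) * (w * τ * σ * (p₁ * p₂ - 4 * (n₁ * n₂) * y)) = 0 ↔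
      y = (q₁ * q₂ - 4 * α * β * (1 - α) ^ 2 * (1 - β) ^ 2 * n₁ * n₂ * p₁ * p₂) / D := fun y ↦ by
    have e : τ * σ * (m₁ * m₂ * y - q₁ * q₂) +
        4 * α * β * (n₁ * n₂) * (w * τ * σ * (p₁ * p₂ - 4 * (n₁ * n₂) * y)) =
        τ * σ * (y * D - (q₁ * q₂ - 4 * α * β * (1 - α) ^ 2 * (1 - β) ^ 2 * n₁ * n₂ * p₁ * p₂)) := by
      rw [hDdef, hw]; ring
    rw [e, mul_eq_zero, or_iff_right hτσ, sub_eq_zero, eq_div_iff hD.ne']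
  have hx : w * τ * σ * (p₁ * p₂ - 4 * (n₁ * n₂) *
      ((q₁ * q₂ - 4 * α * β * (1 - α) ^ 2 * (1 - β) ^ 2 * n₁ * n₂ * p₁ * p₂) / D)) =
      (4 * n₁ * n₂ * q₁ * q₂ - m₁ * m₂ * p₁ * p₂) / -D * (w * τ * σ) := by
    have e : m₁ * m₂ = D + 16 * α * β * (1 - α) ^ 2 * (1 - β) ^ 2 * n₁ ^ 2 * n₂ ^ 2 := by
      rw [hDdef]; ring
    rw [show m₁ * m₂ * p₁ * p₂ = (m₁ * m₂) * (p₁ * p₂) by ring, e]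
    have := hD.ne'
    field_simp
    ring
  constructor
  · rintro ⟨e1, e2⟩
    rw [e1, hy] at e2
    refine ⟨?_, e2⟩
    rw [e1, e2, hx]
  · rintro ⟨e1, e2⟩
    have e3 : x = w * τ * σ * (p₁ * p₂ - 4 * (n₁ * n₂) * y) := by rw [e1, e2, hx]
    refine ⟨e3, ?_⟩
    rw [e3, hy, e2]

lemma errFun_kStar_le (hα : 1 / 2 < α) (hα' : α < 1) (hβ : 1 / 2 < β) (hβ' : β < 1)
    (hT : 0 < T) (hS : 0 < S) (k₁ k₂ : ℝ) :
    errFun α β (kOneStar α β T S) (kTwoStar α β) T S ≤ errFun α β k₁ k₂ T S := by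
  rw [errFun_eq_quadFun, errFun_eq_quadFun]
  have a0 : 0 < α := by linarith
  have b0 : 0 < β := by linarith
  have a1 : 0 < 1 - α := by linarith
  have b1 : 0 < 1 - β := by linarith
  obtain ⟨h1, h2⟩ := (stationary_iff hα hα' hβ hβ' hT hS _).2 rfl
  refine quadFun_le_of_stationary (by positivity) ?_ h1 h2 _
  have hD := gram_pos hα hα' hβ hβ'
  have e1 : T ^ (2 * α) * T ^ (2 - 2 * α) = T ^ 2 := by
    rw [← Real.rpow_add hT, ← Real.rpow_natCast]; congr 1; push_cast; ring
  have e2 : S ^ (2 * β) * S ^ (2 - 2 * β) = S ^ 2 := by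
    rw [← Real.rpow_add hS, ← Real.rpow_natCast]; congr 1; push_cast; ring
  have e3 : 4 * (4 * (T ^ (2 - 2 * α) * S ^ (2 - 2 * β) / ((1 - α) ^ 2 * (1 - β) ^ 2))) *
      (4 / (α * β) * (beta (1 - α) (2 * α - 1) * beta (1 - β) (2 * β - 1)) *
        (T ^ (2 * α) * S ^ (2 * β))) =
      64 / (α * β * ((1 - α) ^ 2 * (1 - β) ^ 2)) *
        (beta (1 - α) (2 * α - 1) * beta (1 - β) (2 * β - 1)) * (T ^ 2 * S ^ 2) := by
    rw [← e1, ← e2]; field_simp; ring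
  rw [e3, ← sub_nonneg]
  -- The discriminant condition is `gram_pos` up to a positive factor, since t^(2α) t^(2-2α) = t².
  have e4 : 64 / (α * β * ((1 - α) ^ 2 * (1 - β) ^ 2)) *
        (beta (1 - α) (2 * α - 1) * beta (1 - β) (2 * β - 1)) * (T ^ 2 * S ^ 2) -
      (32 * (beta (1 - α) α * beta (1 - β) β) * T * S) ^ 2 =
      64 * (T ^ 2 * S ^ 2) / (α * β * ((1 - α) ^ 2 * (1 - β) ^ 2)) *
      (beta (1 - α) (2 * α - 1) * beta (1 - β) (2 * β - 1) -
      16 * α * β * (1 - α) ^ 2 * (1 - β) ^ 2 * beta (1 - α) α ^ 2 * beta (1 - β) β ^ 2) := by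
    field_simp; ring
  rw [e4]
  positivity

/-! ### Monotonicity in time. -/

lemma errFun_comm (k₁ k₂ t s : ℝ) : errFun α β k₁ k₂ t s = errFun β α k₁ k₂ s t := by
  simp only [errFun, aCoef, bCoef]
  ring

lemma errFun_monotoneOn {k₁ k₂ t : ℝ} (hα : 1 / 2 < α) (hα' : α < 1) (hβ : 1 / 2 < β)
    (hβ' : β < 1) (hT : 0 < T) (hΔ : disc α β T k₂ ≤ 0) (ht : 0 ≤ t) :
    MonotoneOn (fun s ↦ errFun α β k₁ k₂ t s) (Ici 0) := by
  have a1 : 0 < 1 - α := by linarith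
  have b0 : 0 < β := by linarith
  have b1 : 0 < 1 - β := by linarith
  -- At t = 0 the error vanishes identically; the case is split off because the derivative is
  -- factored through 1/Y.
  rcases ht.eq_or_lt with rfl | ht
  · intro s _ s' _ _
    simp only [errFun]
    rw [Real.zero_rpow (by linarith), Real.zero_rpow (by linarith)]
    simp
  set M := (1 - α) ^ 2 * (1 - β) with hM
  have hMpos : 0 < M := by positivity
  -- T enters the discriminant only through a positive factor, so the condition serves every t.
  have hab : M * bCoef α β k₂ ^ 2 ≤ β * aCoef α β k₂ := by
    rw [disc] at hΔ
    have h1 : bCoef α β k₂ ^ 2 - β * aCoef α β k₂ / M ≤ 0 :=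
      nonpos_of_mul_nonpos_right hΔ (by positivity)
    rw [sub_nonpos, le_div_iff₀ hMpos] at h1
    linarith
  have hderiv : ∀ s, 0 < s → HasDerivAt (fun s ↦ errFun α β k₁ k₂ t s)
      (t ^ (2 * α) * (2 * β * s ^ (2 * β - 1)) * aCoef α β k₂ - 8 * k₁ * bCoef α β k₂ * t * 1 +
        4 * k₁ ^ 2 * (t ^ (2 - 2 * α) * ((2 - 2 * β) * s ^ (2 - 2 * β - 1)) /
          ((1 - α) ^ 2 * (1 - β) ^ 2))) s := fun s hs ↦ by
    have d1 := Real.hasDerivAt_rpow_const (p := 2 * β) (Or.inl hs.ne')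
    have d2 := Real.hasDerivAt_rpow_const (p := 2 - 2 * β) (Or.inl hs.ne')
    exact (((d1.const_mul (t ^ (2 * α))).mul_const (aCoef α β k₂)).sub
      ((hasDerivAt_id s).const_mul (8 * k₁ * bCoef α β k₂ * t))).add
      (((d2.const_mul (t ^ (2 - 2 * α))).div_const _).const_mul (4 * k₁ ^ 2))
  refine monotoneOn_of_deriv_nonneg (convex_Ici 0) ?_ ?_ ?_
  · have c1 : Continuous fun s : ℝ ↦ s ^ (2 * β) := Real.continuous_rpow_const (by linarith)
    have c2 : Continuous fun s : ℝ ↦ s ^ (2 - 2 * β) := Real.continuous_rpow_const (by linarith)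
    unfold errFun
    fun_prop
  · intro s hs
    rw [interior_Ici] at hs
    exact (hderiv s hs).differentiableAt.differentiableWithinAt
  · intro s hs
    rw [interior_Ici] at hs
    have hs : 0 < s := hs
    rw [(hderiv s hs).deriv, rpow_two_mul_eq ht, rpow_two_sub_eq ht,
      show (2 - 2 * β - 1 : ℝ) = -(2 * β - 1) by ring, Real.rpow_neg hs.le]
    have hτ : 0 < t ^ (2 * α - 1) := by positivity
    have hσ : 0 < s ^ (2 * β - 1) := by positivity
    set Y := t ^ (2 * α - 1) * s ^ (2 * β - 1) with hY
    have hYpos : 0 < Y := by positivity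
    -- The derivative is 2t/Y times βaY² - 4k₁bY + 4k₁²/M; completing the square in k₁ leaves the
    -- coefficient βa - Mb² ≥ 0, whatever the sign of k₁.
    have e : t * t ^ (2 * α - 1) * (2 * β * s ^ (2 * β - 1)) * aCoef α β k₂ -
        8 * k₁ * bCoef α β k₂ * t * 1 + 4 * k₁ ^ 2 * (t / t ^ (2 * α - 1) *
          ((2 - 2 * β) * (s ^ (2 * β - 1))⁻¹) / ((1 - α) ^ 2 * (1 - β) ^ 2)) =
        2 * t / Y * ((β * aCoef α β k₂ - M * bCoef α β k₂ ^ 2) * Y ^ 2 +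
          (M * bCoef α β k₂ * Y - 2 * k₁) ^ 2 / M) := by
      rw [hY, hM]
      field_simp
      ring
    rw [e]
    have := sub_nonneg.2 hab
    positivity

/-- A bound for the increase of the error on `[0, T] × [0, S]` when both parameters are
increased by `η`. -/
noncomputable def errShift (α β T S k₁ k₂ η : ℝ) : ℝ :=
  T ^ (2 * α) * S ^ (2 * β) * |aCoef α β (k₂ + η) - aCoef α β k₂| +
    8 * T * S * |(k₁ + η) * bCoef α β (k₂ + η) - k₁ * bCoef α β k₂| +
    4 * (T ^ (2 - 2 * α) * S ^ (2 - 2 * β) / ((1 - α) ^ 2 * (1 - β) ^ 2)) *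
      |(k₁ + η) ^ 2 - k₁ ^ 2|

lemma tendsto_errShift (α β T S k₁ k₂ : ℝ) :
    Tendsto (errShift α β T S k₁ k₂) (𝓝[>] 0) (𝓝 0) := by
  have hc : Continuous (errShift α β T S k₁ k₂) := by
    unfold errShift aCoef bCoef
    fun_prop
  have := hc.tendsto 0
  simp only [errShift, add_zero, sub_self, abs_zero, mul_zero] at this
  exact this.mono_left nhdsWithin_le_nhds

lemma errFun_add_le {t s : ℝ} (hα : 1 / 2 < α) (hα' : α < 1) (hβ : 1 / 2 < β) (hβ' : β < 1)
    (ht : t ∈ Icc 0 T) (hs : s ∈ Icc 0 S) (k₁ k₂ η : ℝ) :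
    errFun α β (k₁ + η) (k₂ + η) t s ≤ errFun α β k₁ k₂ t s + errShift α β T S k₁ k₂ η := by
  have t0 := ht.1
  have s0 := hs.1
  have T0 : 0 ≤ T := t0.trans ht.2
  have S0 : 0 ≤ S := s0.trans hs.2
  have e : errFun α β (k₁ + η) (k₂ + η) t s = errFun α β k₁ k₂ t s +
      (t ^ (2 * α) * s ^ (2 * β) * (aCoef α β (k₂ + η) - aCoef α β k₂) +
        8 * t * s * -((k₁ + η) * bCoef α β (k₂ + η) - k₁ * bCoef α β k₂) +
        4 * (t ^ (2 - 2 * α) * s ^ (2 - 2 * β) / ((1 - α) ^ 2 * (1 - β) ^ 2)) *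
          ((k₁ + η) ^ 2 - k₁ ^ 2)) := by
    simp only [errFun]; ring
  have r1 : t ^ (2 * α) ≤ T ^ (2 * α) := Real.rpow_le_rpow t0 ht.2 (by linarith)
  have r2 : s ^ (2 * β) ≤ S ^ (2 * β) := Real.rpow_le_rpow s0 hs.2 (by linarith)
  have r3 : t ^ (2 - 2 * α) ≤ T ^ (2 - 2 * α) := Real.rpow_le_rpow t0 ht.2 (by linarith)
  have r4 : s ^ (2 - 2 * β) ≤ S ^ (2 - 2 * β) := Real.rpow_le_rpow s0 hs.2 (by linarith)
  have r5 := ht.2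
  have r6 := hs.2
  have key : ∀ {c C x y : ℝ}, 0 ≤ c → c ≤ C → x ≤ |y| → c * x ≤ C * |y| := fun hc hC hx ↦
    (mul_le_mul_of_nonneg_left hx hc).trans (mul_le_mul_of_nonneg_right hC (abs_nonneg _))
  rw [e, errShift]
  refine add_le_add le_rfl (add_le_add (add_le_add ?_ ?_) ?_)
  · exact key (by positivity) (by gcongr) (le_abs_self _)
  · exact key (by positivity) (by gcongr) (neg_le_abs _)
  · exact key (by positivity) (by gcongr) (le_abs_self _)

/-- The class requires positive parameters while k₁, k₂ may be zero, so the infimum need not be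
attained; shifting both by η > 0 enters the class, and η → 0 gives the upper bound. -/
lemma iInf_classK_eq {Φ : (ℝ → ℝ → ℝ → ℝ → ℝ) → EReal} {c k₁ k₂ : ℝ} {ε : ℝ → ℝ}
    (hk₁ : 0 ≤ k₁) (hk₂ : 0 ≤ k₂) (hε : Tendsto ε (𝓝[>] 0) (𝓝 0))
    (hlow : ∀ x y, (c : EReal) ≤ Φ (zeta α β x y))
    (hup : ∀ η, 0 < η → Φ (zeta α β (k₁ + η) (k₂ + η)) ≤ ((c + ε η : ℝ) : EReal)) :
    ⨅ ζ ∈ classK α β, Φ ζ = (c : EReal) := by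
  apply le_antisymm
  · have ht : Tendsto (fun η ↦ ((c + ε η : ℝ) : EReal)) (𝓝[>] 0) (𝓝 (c : EReal)) := by
      refine (continuous_coe_real_ereal.tendsto c).comp ?_
      simpa using hε.const_add c
    refine ge_of_tendsto ht ?_
    filter_upwards [self_mem_nhdsWithin] with η hη
    have hη : 0 < η := hη
    exact (iInf₂_le _ ⟨k₁ + η, k₂ + η, by positivity, by positivity, rfl⟩).trans (hup η hη)
  · refine le_iInf₂ fun ζ hζ ↦ ?_
    obtain ⟨x, y, -, -, rfl⟩ := hζ
    exact hlow x y

end Minimization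

end RosenblattSheet

/-! ### The minimax theorem. -/

theorem theorem4p1 {Ω : Type*} [MeasurableSpace Ω] (P : MeasureTheory.Measure Ω)
    [MeasureTheory.IsProbabilityMeasure P] (B : ℝ≥0 × ℝ≥0 → Ω → ℝ)
    (hB : RosenblattSheet.IsBrownianSheet B P)
    (α β T S : ℝ) (hα : 1 / 2 < α) (hα' : α < 1) (hβ : 1 / 2 < β) (hβ' : β < 1)
    (hT : 0 < T) (hS : 0 < S)
    (hΔ : RosenblattSheet.disc α β T (RosenblattSheet.kTwoStar α β) ≤ 0)
    (hk₁ : 0 ≤ RosenblattSheet.kOneStar α β T S) (hk₂ : 0 ≤ RosenblattSheet.kTwoStar α β) :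
    -- `(k₁*, k₂*)` is the only stationary point of `(k₁, k₂) ↦ f(T, S, k₁, k₂)`
    (∀ k : ℝ × ℝ,
      HasFDerivAt (fun κ : ℝ × ℝ => RosenblattSheet.f B P α β T S κ.1 κ.2)
          (0 : ℝ × ℝ →L[ℝ] ℝ) k ↔
        k = (RosenblattSheet.kOneStar α β T S, RosenblattSheet.kTwoStar α β)) ∧
    -- the value `f(T, S, k₁*, k₂*)`
    RosenblattSheet.f B P α β T S
        (RosenblattSheet.kOneStar α β T S) (RosenblattSheet.kTwoStar α β) =
      T ^ (2 * α) * S ^ (2 * β) * RosenblattSheet.aCoef α β (RosenblattSheet.kTwoStar α β) -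
        8 * RosenblattSheet.kOneStar α β T S *
          RosenblattSheet.bCoef α β (RosenblattSheet.kTwoStar α β) * T * S +
        4 * RosenblattSheet.kOneStar α β T S ^ 2 *
          (T ^ (2 - 2 * α) * S ^ (2 - 2 * β) / ((1 - α) ^ 2 * (1 - β) ^ 2)) ∧
    -- the optimal error over `{T} × [0, S]`
    (⨅ ζ ∈ RosenblattSheet.classK α β, ⨆ s ∈ Set.Icc (0 : ℝ) S,
        (RosenblattSheet.error B P α β ζ T s : EReal)) =
      (RosenblattSheet.f B P α β T S
        (RosenblattSheet.kOneStar α β T S) (RosenblattSheet.kTwoStar α β) : EReal) ∧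
    -- the optimal error over `[0, T] × [0, S]`, if the discriminant of the edge `[0, T] × {S}`
    -- is nonpositive as well
    (RosenblattSheet.disc β α S (RosenblattSheet.kTwoStar α β) ≤ 0 →
      (⨅ ζ ∈ RosenblattSheet.classK α β, ⨆ t ∈ Set.Icc (0 : ℝ) T, ⨆ s ∈ Set.Icc (0 : ℝ) S,
          (RosenblattSheet.error B P α β ζ t s : EReal)) =
        (RosenblattSheet.f B P α β T S
          (RosenblattSheet.kOneStar α β T S) (RosenblattSheet.kTwoStar α β) : EReal)) := by
  have hf : ∀ {t s : ℝ}, 0 ≤ t → 0 ≤ s → ∀ k₁ k₂, RosenblattSheet.f B P α β t s k₁ k₂ =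
      RosenblattSheet.errFun α β k₁ k₂ t s := fun ht hs k₁ k₂ ↦
    RosenblattSheet.f_eq_errFun hB hα hα' hβ hβ' ht hs k₁ k₂
  have herr : ∀ {t s : ℝ}, 0 ≤ t → 0 ≤ s → ∀ k₁ k₂,
      RosenblattSheet.error B P α β (RosenblattSheet.zeta α β k₁ k₂) t s =
      RosenblattSheet.errFun α β k₁ k₂ t s := hf
  have hmono : ∀ {t s : ℝ}, 0 ≤ t → s ∈ Set.Icc 0 S →
      RosenblattSheet.errFun α β (RosenblattSheet.kOneStar α β T S)
        (RosenblattSheet.kTwoStar α β) t s ≤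
      RosenblattSheet.errFun α β (RosenblattSheet.kOneStar α β T S)
        (RosenblattSheet.kTwoStar α β) t S := fun ht hs ↦
    RosenblattSheet.errFun_monotoneOn hα hα' hβ hβ' hT hΔ ht hs.1 hS.le hs.2
  have hε := RosenblattSheet.tendsto_errShift α β T S (RosenblattSheet.kOneStar α β T S)
    (RosenblattSheet.kTwoStar α β)
  refine ⟨fun k ↦ ?_, hf hT.le hS.le _ _, ?_, fun hΔ' ↦ ?_⟩
  · rw [← RosenblattSheet.stationary_iff hα hα' hβ hβ' hT hS k,
      ← RosenblattSheet.hasFDerivAt_quadFun_zero_iff (T ^ (2 * α) * S ^ (2 * β))]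
    simp_rw [hf hT.le hS.le, RosenblattSheet.errFun_eq_quadFun]
  · rw [hf hT.le hS.le]
    refine RosenblattSheet.iInf_classK_eq hk₁ hk₂ hε (fun x y ↦ ?_) fun η hη ↦ ?_
    -- The lower bound uses only the corner s = S of the supremum, where (k₁*, k₂*) is a global
    -- minimum.
    · refine le_trans ?_ (le_iSup₂_of_le S (Set.right_mem_Icc.2 hS.le) le_rfl)
      rw [herr hT.le hS.le, EReal.coe_le_coe_iff]
      exact RosenblattSheet.errFun_kStar_le hα hα' hβ hβ' hT hS x y
    · refine iSup₂_le fun s hs ↦ ?_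
      rw [herr hT.le hs.1, EReal.coe_le_coe_iff]
      exact (RosenblattSheet.errFun_add_le hα hα' hβ hβ' (Set.right_mem_Icc.2 hT.le) hs _ _
        η).trans (add_le_add (hmono hT.le hs) le_rfl)
  · rw [hf hT.le hS.le]
    refine RosenblattSheet.iInf_classK_eq hk₁ hk₂ hε (fun x y ↦ ?_) fun η hη ↦ ?_
    · refine le_trans ?_ (le_iSup₂_of_le T (Set.right_mem_Icc.2 hT.le)
        (le_iSup₂_of_le S (Set.right_mem_Icc.2 hS.le) le_rfl))
      rw [herr hT.le hS.le, EReal.coe_le_coe_iff]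
      exact RosenblattSheet.errFun_kStar_le hα hα' hβ hβ' hT hS x y
    · refine iSup₂_le fun t ht ↦ iSup₂_le fun s hs ↦ ?_
      rw [herr ht.1 hs.1, EReal.coe_le_coe_iff]
      refine (RosenblattSheet.errFun_add_le hα hα' hβ hβ' ht hs _ _ η).trans
        (add_le_add ((hmono ht.1 hs).trans ?_) le_rfl)
      -- Monotonicity in s has already moved the point to the edge s = S, so monotonicity in t is
      -- needed there only; it is the same lemma with the two parameters exchanged.
      rw [RosenblattSheet.errFun_comm, RosenblattSheet.errFun_comm (t := T)]
      exact RosenblattSheet.errFun_monotoneOn hβ hβ' hα hα' hS hΔ' hS.le ht.1 hT.le ht.2
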